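/- **Setting.** A joint graph/group pair $(G,S)$ consists of a finite vertex-colored graph $G=(V,E)$ with $E\subseteq V\times V$ and a set $S=\{s_1,\dots,s_m\}$ of permutations of $V$ with $\Gamma:=\langle S\rangle=\operatorname{Aut}(G)$. Each generator is given sparsely, by listing its moved points and their images; put $\operatorname{enc}(S)=\sum_{i}|\operatorname{supp}(s_i)|$ and $N=|V|+|E|+\operatorname{enc}(S)$. Running times are those of a unit-cost RAM with words of $O(\log N)$ bits (for the matching algorithms, $O(\log |V|)$ bits). Two orbits $\Delta_1,\Delta_2$ of $\Gamma$ are *equivalent*, $\Delta_1\equiv\Delta_2$, if there is a bijection $b:\Delta_1\to\Delta_2$ with $\varphi(b(\delta))=b(\varphi(\delta))$ for all $\varphi\in\Gamma$, $\delta\in\Delta_1$ (a *commuting* bijection). A permutation $\pi$ of $V$ is *invariant* if every permutation of $V$ that commutes with all $s_i$ commutes with $\pi$. *Unique cycles.* We are given, for each orbit $\Delta$ with at least two points, a cycle $C_\Delta$ of length greater than one on points of $\Delta$, such that the product $C=\prod_\Delta C_\Delta$ is invariant. *Cycle overlap.* Overlapping a permutation $C$ with a permutation $g$ means inserting, after each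 point $x$ moved by $C$, the points $g(x),g^2(x),\dots$ preceding the next point moved by $C$ into the cycle of $C$ through $x$. Call $C'$ a *canonical order* if it arises from $C$ by successively overlapping with generators from $S$ and the cycles of $C'$ (including fixed points) are exactly the orbits of $\Gamma$. *Enhanced cycle type graph* $\mathcal C'(S)$ for a canonical order $C'$. Its vertices are the points of $V$, a copy of each $x\in\operatorname{supp}(s_i)$ for each $i$, and a copy of each $x\in\operatorname{supp}(C')$. Every copy is joined to its point by an undirected edge. There are directed edges from the $s_i$-copy of $x$ to the $s_i$-copy of $s_i(x)$, labelled with the least $k$ such that $C'^k(x)=s_i(x)$, and from the $C'$-copy of $x$ to the $C'$-copy of $C'(x)$, labelled $1$. All points of $V$ have one color; a copy is colored by the permutation ($s_i$ or $C'$) it belongs to and the length of its cycle there. *Color refinement* yields the coarsest partition of the vertices that refines this coloring and is equitable (vertices in the same class have, for each edge label and each class, equally many out-neighbors and equally many in-neighbors in that class). **Theorem.** 1. There is an instance-quasi-linear algorithm, i.e. one with running time $O(N(\log N)^{\kappa})$ for a constant $\kappa$ (with $N+2$ in place of $N$ in the degenerate cases $N\le 1$), which, given $(G,S)$ and the unique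 cycles, computes an invariant canonical order $C'$, the partition $\pi$ of $V$ that color refinement produces on the points of the enhanced cycle type graph $\mathcal C'(S)$, and the partition of the orbits of $\Gamma$ into equivalence classes. Two orbits $\Delta_1,\Delta_2$ are equivalent if and only if some class of $\pi$ meets both. 2. There is an algorithm which, given any canonical order $C'$ (in particular the one computed in 1), the corresponding $\pi$, and two equivalent orbits $\Delta_1\equiv\Delta_2$ (as lists of their points), computes a commuting bijection $b:\Delta_1\to\Delta_2$ in time $O(|\Delta_1|)$. 3. If moreover $\Gamma$ induces the full symmetric group on $\Delta_1$, then a commuting bijection can be computed in time $O(|\Delta_1|)$ from $\pi$, $\Delta_1$, $\Delta_2$ alone, without $C'$. All implied constants are absolute. -/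

import Mathlib

namespace OrbitEquivalence

/-! ### Machine model: unit-cost word RAM, structured programs

A machine has registers and arrays (indexed by natural numbers; a program mentions only finitely
many of them, so the arrays can be interleaved in one random access memory).  Every elementary
operation and every test costs one step.  Sums must fit in a machine word, i.e. be at most `W`;
a computation that overflows does not terminate successfully. -/

/-- Memory contents: registers and arrays of natural numbers. -/
structure State where
  reg : ℕ → ℕ
  arr : ℕ → ℕ → ℕ

/-- The state after writing `v` into register `r`. -/
def State.setReg (σ : State) (r v : ℕ) : State :=
  { σ with reg := Function.update σ.reg r v }

/-- The state after writing `v` into cell `i` of array `a`. -/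
def State.setArr (σ : State) (a i v : ℕ) : State :=
  { σ with arr := Function.update σ.arr a (Function.update (σ.arr a) i v) }

/-- Programs. -/
inductive Prog where
  | skip : Prog
  /-- `r := c` -/
  | const (r c : ℕ) : Prog
  /-- `r := p` -/
  | move (r p : ℕ) : Prog
  /-- `r := p + q` -/
  | add (r p q : ℕ) : Prog
  /-- `r := max (p - q) 0` -/
  | sub (r p q : ℕ) : Prog
  /-- `r := a[p]` -/
  | load (r a p : ℕ) : Prog
  /-- `a[p] := q` -/
  | store (a p q : ℕ) : Prog
  | seq (P Q : Prog) : Prog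
  /-- if `p < q` then `P` else `Q` -/
  | ifLt (p q : ℕ) (P Q : Prog) : Prog
  /-- while `p < q` do `P` -/
  | whileLt (p q : ℕ) (P : Prog) : Prog

/-- `Exec W P σ t τ`: with words bounded by `W`, the program `P` started in state `σ` halts after
exactly `t` steps in state `τ`.  (The final state and the number of steps are unique.) -/
inductive Exec (W : ℕ) : Prog → State → ℕ → State → Prop
  | skip (σ : State) : Exec W .skip σ 1 σ
  | const (σ : State) (r c : ℕ) (h : c ≤ W) : Exec W (.const r c) σ 1 (σ.setReg r c)
  | move (σ : State) (r p : ℕ) : Exec W (.move r p) σ 1 (σ.setReg r (σ.reg p))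
  | add (σ : State) (r p q : ℕ) (h : σ.reg p + σ.reg q ≤ W) :
      Exec W (.add r p q) σ 1 (σ.setReg r (σ.reg p + σ.reg q))
  | sub (σ : State) (r p q : ℕ) : Exec W (.sub r p q) σ 1 (σ.setReg r (σ.reg p - σ.reg q))
  | load (σ : State) (r a p : ℕ) : Exec W (.load r a p) σ 1 (σ.setReg r (σ.arr a (σ.reg p)))
  | store (σ : State) (a p q : ℕ) :
      Exec W (.store a p q) σ 1 (σ.setArr a (σ.reg p) (σ.reg q))
  | seq {P Q : Prog} {σ σ' σ'' : State} {t t' : ℕ} (hP : Exec W P σ t σ')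
      (hQ : Exec W Q σ' t' σ'') : Exec W (.seq P Q) σ (t + t') σ''
  | ifTrue {P Q : Prog} {p q : ℕ} {σ σ' : State} {t : ℕ} (h : σ.reg p < σ.reg q)
      (hP : Exec W P σ t σ') : Exec W (.ifLt p q P Q) σ (t + 1) σ'
  | ifFalse {P Q : Prog} {p q : ℕ} {σ σ' : State} {t : ℕ} (h : ¬ σ.reg p < σ.reg q)
      (hQ : Exec W Q σ t σ') : Exec W (.ifLt p q P Q) σ (t + 1) σ'
  | whileTrue {P : Prog} {p q : ℕ} {σ σ' σ'' : State} {t t' : ℕ} (h : σ.reg p < σ.reg q)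
      (hP : Exec W P σ t σ') (hW : Exec W (.whileLt p q P) σ' t' σ'') :
      Exec W (.whileLt p q P) σ (t + t' + 1) σ''
  | whileFalse {P : Prog} {p q : ℕ} {σ : State} (h : ¬ σ.reg p < σ.reg q) :
      Exec W (.whileLt p q P) σ 1 σ

/-! ### Joint graph/group pairs -/

/-- A vertex-colored graph on the vertex set `{0, …, n - 1}` with edge set `E ⊆ V × V`.  As there
are at most `n` colors, they are numbered by elements of `Fin n`. -/
structure ColoredGraph (n : ℕ) where
  edges : Finset (Fin n × Fin n)
  color : Fin n → Fin n

/-- The automorphism group of a colored graph. -/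
def ColoredGraph.aut {n : ℕ} (G : ColoredGraph n) : Subgroup (Equiv.Perm (Fin n)) where
  carrier := {φ | (∀ u v, (φ u, φ v) ∈ G.edges ↔ (u, v) ∈ G.edges) ∧
    ∀ v, G.color (φ v) = G.color v}
  one_mem' := by simp
  mul_mem' := by
    rintro φ ψ ⟨h1, h2⟩ ⟨h3, h4⟩
    refine ⟨fun u v => ?_, fun v => ?_⟩
    · rw [Equiv.Perm.mul_apply, Equiv.Perm.mul_apply, h1, h3]
    · rw [Equiv.Perm.mul_apply, h2, h4]
  inv_mem' := by
    rintro φ ⟨h1, h2⟩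
    refine ⟨fun u v => ?_, fun v => ?_⟩
    · rw [← h1]; simp
    · rw [← h2]; simp

/-- The group `⟨S⟩` generated by `S = {s₁, …, sₘ}`. -/
def group {n m : ℕ} (s : Fin m → Equiv.Perm (Fin n)) : Subgroup (Equiv.Perm (Fin n)) :=
  Subgroup.closure (Set.range s)

/-- `(G, S)` is a joint graph/group pair, where `s` enumerates the set `S` without repetition. -/
def IsJointPair {n m : ℕ} (G : ColoredGraph n) (s : Fin m → Equiv.Perm (Fin n)) : Prop :=
  Function.Injective s ∧ group s = G.aut

/-- The encoding size `enc(S) = ∑ |supp p|`. -/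
def enc {n m : ℕ} (s : Fin m → Equiv.Perm (Fin n)) : ℕ :=
  ∑ i, (s i).support.card

/-- The instance size `|V| + |E| + enc(S)`. -/
def instanceSize {n m : ℕ} (G : ColoredGraph n) (s : Fin m → Equiv.Perm (Fin n)) : ℕ :=
  n + G.edges.card + enc s

/-! ### Equivalent orbits -/

/-- `b` restricts to a bijection `Δ₁ → Δ₂` commuting with the action of `Γ`. -/
def IsCommutingBijection {Ω : Type*} (Γ : Subgroup (Equiv.Perm Ω)) (Δ₁ Δ₂ : Set Ω)
    (b : Ω → Ω) : Prop :=
  Set.BijOn b Δ₁ Δ₂ ∧ ∀ φ ∈ Γ, ∀ δ ∈ Δ₁, φ (b δ) = b (φ δ)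

/-- Equivalence of two orbits `Δ₁`, `Δ₂` of `Γ`. -/
def OrbitEquiv {Ω : Type*} (Γ : Subgroup (Equiv.Perm Ω)) (Δ₁ Δ₂ : Set Ω) : Prop :=
  ∃ b : Ω → Ω, IsCommutingBijection Γ Δ₁ Δ₂ b

/-- `Γ` induces the full symmetric group on `Δ`. -/
def HasNaturalSymmetricAction {Ω : Type*} (Γ : Subgroup (Equiv.Perm Ω)) (Δ : Set Ω) : Prop :=
  ∀ τ : Equiv.Perm Ω, Set.BijOn τ Δ Δ → ∃ φ ∈ Γ, ∀ δ ∈ Δ, φ δ = τ δ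

/-! ### Invariant unique cycles and the cycle overlap algorithm -/

/-- `c` is invariant with respect to the ordered generating set `s`: every permutation that fixes
`s₁, …, sₘ` under conjugation also fixes `c`. -/
def IsInvariant {n m : ℕ} (s : Fin m → Equiv.Perm (Fin n)) (c : Equiv.Perm (Fin n)) : Prop :=
  ∀ φ : Equiv.Perm (Fin n), (∀ i, φ * s i * φ⁻¹ = s i) → φ * c * φ⁻¹ = c

/-- A choice of one cycle per orbit, invariant under relabelling.  The family `(C_Δ)` of cycles is
given as its product `c`: on each orbit with at least two points, `c` has exactly one cycle of
length greater than one, namely `C_Δ`. -/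
structure IsInvariantUniqueCycles {n m : ℕ} (s : Fin m → Equiv.Perm (Fin n))
    (c : Equiv.Perm (Fin n)) : Prop where
  invariant : IsInvariant s c
  mem_orbit : ∀ x, c x ∈ MulAction.orbit (group s) x
  exists_cycle : ∀ x, (MulAction.orbit (group s) x).Nontrivial →
    ∃ y ∈ MulAction.orbit (group s) x, c y ≠ y
  unique_cycle : ∀ x, ∀ y ∈ MulAction.orbit (group s) x, c x ≠ x → c y ≠ y → c.SameCycle x y

/-- `d` is the result of the cycle overlap algorithm applied to the (disjoint) cycles of `c` and
those cycles of `g` that meet them: after each point `x` of a cycle of `c` one inserts the points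
`g x, g² x, …` that precede the next point on a cycle of `c`. -/
structure IsOverlap {n : ℕ} (c g d : Equiv.Perm (Fin n)) : Prop where
  /-- reading along the cycle of `g` through a point of a cycle of `c` -/
  read : ∀ x ∈ c.support, ∀ y, g.SameCycle x y → g y ∉ c.support → d y = g y
  /-- when the next point on a cycle of `c` is reached, one continues with the old successor -/
  back : ∀ x ∈ c.support, ∀ k : ℕ, (∀ j, 1 ≤ j → j ≤ k → (g ^ j) x ∉ c.support) →
    (g ^ (k + 1)) x ∈ c.support → d ((g ^ k) x) = c x
  /-- points on no cycle of `g` that meets `c` remain unused -/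
  other : ∀ y, (∀ x ∈ c.support, ¬ g.SameCycle x y) → d y = y

/-- `d` is a system of canonical cycles, one for each orbit and encompassing the orbit, obtained
from `c` by repeatedly overlapping with the cycles of the generators. -/
structure IsCanonicalOrder {n m : ℕ} (s : Fin m → Equiv.Perm (Fin n))
    (c d : Equiv.Perm (Fin n)) : Prop where
  reachable : Relation.ReflTransGen (fun e e' => ∃ i, IsOverlap e (s i) e') c d
  cycles : ∀ x y, y ∈ MulAction.orbit (group s) x ↔ d.SameCycle x y

/-! ### Color refinement and the enhanced cycle type graph -/

/-- Vertex-colored directed graphs with edge labels; an undirected edge is a pair of opposite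
directed edges with the same label. -/
structure LabelledGraph (V L K : Type*) where
  color : V → K
  edge : L → V → V → Prop

/-- The partition `r` of the vertices refines the vertex coloring and is equitable: equivalent
vertices have, for each label and each class, the same number of out-neighbors and the same number
of in-neighbors in this class. -/
def LabelledGraph.IsEquitableRefinement {V L K : Type*} (H : LabelledGraph V L K)
    (r : Setoid V) : Prop :=
  ∀ u v, r u v → H.color u = H.color v ∧ ∀ (l : L) (w : V),
    {x | r w x ∧ H.edge l u x}.ncard = {x | r w x ∧ H.edge l v x}.ncard ∧
    {x | r w x ∧ H.edge l x u}.ncard = {x | r w x ∧ H.edge l x v}.ncard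

/-- The result of color refinement: the coarsest equitable refinement. -/
def LabelledGraph.IsColorRefinement {V L K : Type*} (H : LabelledGraph V L K)
    (r : Setoid V) : Prop :=
  H.IsEquitableRefinement r ∧ ∀ r' : Setoid V, H.IsEquitableRefinement r' → r' ≤ r

/-- The length of the directed path from `x` to `y` in the cycle of `d` containing both. -/
noncomputable def cycleDist {n : ℕ} (d : Equiv.Perm (Fin n)) (x y : Fin n) : ℕ :=
  sInf {k : ℕ | (d ^ k) x = y}

/-- Vertices of the enhanced cycle type graph: the points, a copy of each point moved by the
generator `sᵢ`, for each `i`, and a copy of each point on a canonical cycle. -/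
abbrev EVertex {n m : ℕ} (s : Fin m → Equiv.Perm (Fin n)) (d : Equiv.Perm (Fin n)) : Type :=
  Fin n ⊕ (Σ i : Fin m, {x : Fin n // s i x ≠ x}) ⊕ {x : Fin n // d x ≠ x}

/-- Colors: points get one color, the copy of `x` for `sᵢ` the pair of `i` and the length of the
cycle of `sᵢ` through `x`, and the copies on canonical cycles the length of the cycle. -/
noncomputable def enhancedColor {n m : ℕ} (s : Fin m → Equiv.Perm (Fin n))
    (d : Equiv.Perm (Fin n)) : EVertex s d → Option (Option (Fin m) × ℕ)
  | .inl _ => none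
  | .inr (.inl ⟨i, x⟩) => some (some i, Function.minimalPeriod (s i) x)
  | .inr (.inr x) => some (none, Function.minimalPeriod d x)

/-- Edges: label `none` joins points with their copies (undirected); the directed edges of the
gadget of `sᵢ` are labelled with the distance of their ends on the canonical cycle, and those of
the canonical cycles with `1`. -/
def enhancedEdge {n m : ℕ} (s : Fin m → Equiv.Perm (Fin n)) (d : Equiv.Perm (Fin n)) :
    Option ℕ → EVertex s d → EVertex s d → Prop
  | none, .inl x, .inr (.inl ⟨_, y⟩) => x = y
  | none, .inr (.inl ⟨_, y⟩), .inl x => x = y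
  | none, .inl x, .inr (.inr y) => x = y
  | none, .inr (.inr y), .inl x => x = y
  | some k, .inr (.inl ⟨i, x⟩), .inr (.inl ⟨j, y⟩) =>
      i = j ∧ (y : Fin n) = s i x ∧ k = cycleDist d x y
  | some k, .inr (.inr x), .inr (.inr y) => (y : Fin n) = d x ∧ k = 1
  | _, _, _ => False

/-- The enhanced cycle type graph. -/
noncomputable def enhancedCycleTypeGraph {n m : ℕ} (s : Fin m → Equiv.Perm (Fin n))
    (d : Equiv.Perm (Fin n)) : LabelledGraph (EVertex s d) (Option ℕ) (Option (Option (Fin m) × ℕ)) :=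
  ⟨enhancedColor s d, enhancedEdge s d⟩

/-- `π` numbers the color classes that color refinement of the enhanced cycle type graph produces
on the points. -/
def IsRefinedColoring {n m : ℕ} (s : Fin m → Equiv.Perm (Fin n)) (d : Equiv.Perm (Fin n))
    (π : Fin n → Fin n) : Prop :=
  ∃ r : Setoid (EVertex s d), (enhancedCycleTypeGraph s d).IsColorRefinement r ∧
    ∀ x y, π x = π y ↔ r (.inl x) (.inl y)

/-! ### Input and output formats -/

/-- Array `a` stores the function `f`. -/
def Stores {n : ℕ} (σ : State) (a : ℕ) (f : Fin n → Fin n) : Prop :=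
  ∀ x : Fin n, σ.arr a x = f x

/-- The input: `|V|`, `|E|`, `|S|` in registers 0, 1, 2; the vertex colors in array 0; the list of
edges in arrays 1 and 2; from position `off i` (array 3) on, in some order, the points moved by
the `i`-th generator (array 4) and their images (array 5); the unique cycles, as a successor
function, in array 6.  The work memory is empty.  (In the lists, the number of entries is the
number of objects to be listed, so each object occurs exactly once.) -/
structure EncodesInput {n m : ℕ} (G : ColoredGraph n) (s : Fin m → Equiv.Perm (Fin n))
    (c : Equiv.Perm (Fin n)) (σ : State) : Prop where
  card_vertices : σ.reg 0 = n
  card_edges : σ.reg 1 = G.edges.card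
  card_gens : σ.reg 2 = m
  colors : Stores σ 0 G.color
  edges : ∀ e ∈ G.edges, ∃ k < G.edges.card, σ.arr 1 k = (e.1 : ℕ) ∧ σ.arr 2 k = (e.2 : ℕ)
  off_zero : σ.arr 3 0 = 0
  off_succ : ∀ i : Fin m, σ.arr 3 (i + 1) = σ.arr 3 i + (s i).support.card
  gens : ∀ i : Fin m, ∀ x ∈ (s i).support, ∃ k < (s i).support.card,
    σ.arr 4 (σ.arr 3 i + k) = (x : ℕ) ∧ σ.arr 5 (σ.arr 3 i + k) = (s i x : ℕ)
  cycles : Stores σ 6 c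
  regs_zero : ∀ r, 3 ≤ r → σ.reg r = 0
  arrs_zero : ∀ a, 7 ≤ a → ∀ k, σ.arr a k = 0

/-- The input of a matching query: the points of `Δ₁` and of `Δ₂`, in some order, in arrays 10 and
11, their numbers in registers 0 and 1. -/
structure EncodesOrbits {n : ℕ} (Δ₁ Δ₂ : Set (Fin n)) (σ : State) : Prop where
  card_fst : σ.reg 0 = Δ₁.ncard
  card_snd : σ.reg 1 = Δ₂.ncard
  points_fst : ∀ x ∈ Δ₁, ∃ k < Δ₁.ncard, σ.arr 10 k = (x : ℕ)
  points_snd : ∀ x ∈ Δ₂, ∃ k < Δ₂.ncard, σ.arr 11 k = (x : ℕ)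

/-- The output of a matching query: array 12 stores the values on `Δ₁` of a bijection `Δ₁ → Δ₂`
commuting with the group. -/
def StoresMatching {n : ℕ} (Γ : Subgroup (Equiv.Perm (Fin n))) (Δ₁ Δ₂ : Set (Fin n))
    (σ : State) : Prop :=
  ∃ b : Fin n → Fin n, IsCommutingBijection Γ Δ₁ Δ₂ b ∧ ∀ x ∈ Δ₁, σ.arr 12 x = b x

end OrbitEquivalence

open OrbitEquivalence

namespace OrbitEquivalence

/-! ### Reasoning about programs -/

/-! Everything rests on one relation between points. With `d` the canonical order, `x` and `y` are
similar (`Sim`) if `d ^ j x ↦ d ^ j y` is a bijection between their cycles of `d` that respects the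
generators.

Color refinement computes similarity (`isRefinedColoring_iff`). In the enhanced cycle type graph a
vertex has at most one neighbor per label in each class of similar vertices, so equitability amounts
to the transfer of single edges, and similarity transfers them. Conversely, from the points `x` and
`y` one can pass to their copies on the canonical cycles, along the edges labelled 1, and back to
points; so an equitable refinement that identifies `x` and `y` identifies `d x` and `d y`. The
labels in the gadgets tell where each generator sends a point relative to `d`, and similarity
follows.

Similarity detects equivalence of orbits (`orbitEquiv_iff`). The orbits are the cycles of `d`, so
similar points yield a commuting bijection. Conversely, a commuting bijection extends to a
permutation of all points that commutes with the generators (`exists_perm_of_isCommutingBijection`).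
It then commutes with `d` and maps points to similar ones, because `d` is invariant: an overlap is
determined by its two arguments and compatible with conjugation (`IsOverlap.apply_eq`,
`IsOverlap.conj`).

For the canonical order, an entry is a generator together with a point it moves. Entries are queued
when their point enters a cycle, and marked when their generator's cycle has been traversed. Each
entry is queued, marked and passed at most once, so the overlaps take linear time altogether
(`wp_overlapLoop`). When every queued entry is marked, the moved points are closed under the
generators, and the cycles fill the orbits (`HasUniqueCycles.cyclesAreOrbits`).

For the coloring, the letter of a point consists of its cycle length and its distances to its
images. Similarity means equality of the words of letters read along `d` (`sim_iff_letterSim`).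
Prefix doubling compares words of length at least `n` in logarithmically many linear rounds
(`wp_doubling`). Orbits sharing one color share all, so the least color names the class of an orbit
(`wp_orbitClasses`).

To match two orbits, one finds a pair of points of equal color and walks along both cycles. If the
induced group is symmetric on at least three points, its centralizer is trivial, so colors within an
orbit are distinct and determine the bijection (`Sim.eq_of_symmetric`); on at most two points every
bijection commutes. -/

@[simp] theorem State.reg_setReg (σ : State) (r v r' : ℕ) :
    (σ.setReg r v).reg r' = if r' = r then v else σ.reg r' := by
  simp [State.setReg, Function.update_apply]

@[simp] theorem State.arr_setReg (σ : State) (r v : ℕ) : (σ.setReg r v).arr = σ.arr := rfl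

@[simp] theorem State.reg_setArr (σ : State) (a i v : ℕ) : (σ.setArr a i v).reg = σ.reg := rfl

@[simp] theorem State.arr_setArr (σ : State) (a i v a' : ℕ) :
    (σ.setArr a i v).arr a' = if a' = a then Function.update (σ.arr a) i v else σ.arr a' := by
  by_cases h : a' = a <;> simp [State.setArr, h]

/-- Does the program contain an assignment to register `r`? -/
def Prog.writesReg : Prog → ℕ → Bool
  | .skip, _ => false
  | .const r' _, r => r == r'
  | .move r' _, r => r == r'
  | .add r' _ _, r => r == r'
  | .sub r' _ _, r => r == r'
  | .load r' _ _, r => r == r'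
  | .store _ _ _, _ => false
  | .seq P Q, r => P.writesReg r || Q.writesReg r
  | .ifLt _ _ P Q, r => P.writesReg r || Q.writesReg r
  | .whileLt _ _ P, r => P.writesReg r

/-- Does the program contain an assignment to a cell of array `a`? -/
def Prog.writesArr : Prog → ℕ → Bool
  | .store a' _ _, a => a == a'
  | .seq P Q, a => P.writesArr a || Q.writesArr a
  | .ifLt _ _ P Q, a => P.writesArr a || Q.writesArr a
  | .whileLt _ _ P, a => P.writesArr a
  | _, _ => false

/-- The states agree on all registers and arrays that `P` does not assign to. -/
structure Frame (P : Prog) (σ σ' : State) : Prop where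
  reg : ∀ r, P.writesReg r = false → σ'.reg r = σ.reg r
  arr : ∀ a, P.writesArr a = false → σ'.arr a = σ.arr a

theorem Frame.refl (P : Prog) (σ : State) : Frame P σ σ := ⟨fun _ _ => rfl, fun _ _ => rfl⟩

theorem Frame.trans {P : Prog} {σ σ' σ'' : State} (h : Frame P σ σ') (h' : Frame P σ' σ'') :
    Frame P σ σ'' :=
  ⟨fun r hr => (h'.reg r hr).trans (h.reg r hr), fun a ha => (h'.arr a ha).trans (h.arr a ha)⟩

/-- This spares loop invariants all statements about untouched memory: for a concrete program
`writesReg` and `writesArr` evaluate, so the side conditions hold by `rfl`. -/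
theorem Exec.frame {W : ℕ} {P : Prog} {σ σ' : State} {t : ℕ} (h : Exec W P σ t σ') :
    Frame P σ σ' := by
  induction h with
  | skip | whileFalse => exact Frame.refl _ _
  | const | move | add | sub | load | store =>
    constructor <;> intro r hr <;> simp_all [Prog.writesReg, Prog.writesArr]
  | seq _ _ h1 h2 =>
    constructor <;> intro r hr <;>
      simp only [Prog.writesReg, Prog.writesArr, Bool.or_eq_false_iff] at hr
    · rw [h2.reg r hr.2, h1.reg r hr.1]
    · rw [h2.arr r hr.2, h1.arr r hr.1]
  | ifTrue _ _ h1 =>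
    constructor <;> intro r hr <;>
      simp only [Prog.writesReg, Prog.writesArr, Bool.or_eq_false_iff] at hr
    · exact h1.reg r hr.1
    · exact h1.arr r hr.1
  | ifFalse _ _ h1 =>
    constructor <;> intro r hr <;>
      simp only [Prog.writesReg, Prog.writesArr, Bool.or_eq_false_iff] at hr
    · exact h1.reg r hr.2
    · exact h1.arr r hr.2
  | whileTrue _ _ _ h1 h2 =>
    constructor <;> intro r hr
    · rw [h2.reg r hr, h1.reg r hr]
    · rw [h2.arr r hr, h1.arr r hr]

/-- Started in state `σ` at time `t`, the program `P` halts in a state and at a time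
satisfying `Q`. -/
def wp (W : ℕ) (P : Prog) (Q : State → ℕ → Prop) (σ : State) (t : ℕ) : Prop :=
  ∃ t' σ', Exec W P σ t' σ' ∧ Q σ' (t + t')

section wp
variable {W : ℕ} {P P' : Prog} {Q : State → ℕ → Prop} {σ : State} {t : ℕ}

theorem wp.mono {Q' : State → ℕ → Prop} (h : wp W P Q σ t) (hQ : ∀ σ' t', Q σ' t' → Q' σ' t') :
    wp W P Q' σ t := by
  obtain ⟨t', σ', h1, h2⟩ := h
  exact ⟨t', σ', h1, hQ _ _ h2⟩

theorem wp.frame (h : wp W P (fun σ' t' => Frame P σ σ' → Q σ' t') σ t) : wp W P Q σ t := by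
  obtain ⟨t', σ', h1, h2⟩ := h
  exact ⟨t', σ', h1, h2 h1.frame⟩

@[simp] theorem wp_skip : wp W .skip Q σ t ↔ Q σ (t + 1) :=
  ⟨fun ⟨_, _, h1, h2⟩ => by cases h1; exact h2, fun h => ⟨_, _, .skip σ, h⟩⟩

@[simp] theorem wp_const {r c : ℕ} : wp W (.const r c) Q σ t ↔ c ≤ W ∧ Q (σ.setReg r c) (t + 1) :=
  ⟨fun ⟨_, _, h1, h2⟩ => by cases h1 with | const _ _ _ h => exact ⟨h, h2⟩,
    fun h => ⟨_, _, .const σ r c h.1, h.2⟩⟩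

@[simp] theorem wp_move {r p : ℕ} : wp W (.move r p) Q σ t ↔ Q (σ.setReg r (σ.reg p)) (t + 1) :=
  ⟨fun ⟨_, _, h1, h2⟩ => by cases h1; exact h2, fun h => ⟨_, _, .move σ r p, h⟩⟩

@[simp] theorem wp_add {r p q : ℕ} : wp W (.add r p q) Q σ t ↔
    σ.reg p + σ.reg q ≤ W ∧ Q (σ.setReg r (σ.reg p + σ.reg q)) (t + 1) :=
  ⟨fun ⟨_, _, h1, h2⟩ => by cases h1 with | add _ _ _ _ h => exact ⟨h, h2⟩,
    fun h => ⟨_, _, .add σ r p q h.1, h.2⟩⟩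

@[simp] theorem wp_sub {r p q : ℕ} : wp W (.sub r p q) Q σ t ↔
    Q (σ.setReg r (σ.reg p - σ.reg q)) (t + 1) :=
  ⟨fun ⟨_, _, h1, h2⟩ => by cases h1; exact h2, fun h => ⟨_, _, .sub σ r p q, h⟩⟩

@[simp] theorem wp_load {r a p : ℕ} : wp W (.load r a p) Q σ t ↔
    Q (σ.setReg r (σ.arr a (σ.reg p))) (t + 1) :=
  ⟨fun ⟨_, _, h1, h2⟩ => by cases h1; exact h2, fun h => ⟨_, _, .load σ r a p, h⟩⟩

@[simp] theorem wp_store {a p q : ℕ} : wp W (.store a p q) Q σ t ↔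
    Q (σ.setArr a (σ.reg p) (σ.reg q)) (t + 1) :=
  ⟨fun ⟨_, _, h1, h2⟩ => by cases h1; exact h2, fun h => ⟨_, _, .store σ a p q, h⟩⟩

@[simp] theorem wp_seq : wp W (.seq P P') Q σ t ↔ wp W P (wp W P' Q) σ t := by
  constructor
  · rintro ⟨_, _, h1, h2⟩
    cases h1 with
    | seq hP hQ => exact ⟨_, _, hP, _, _, hQ, by rwa [add_assoc]⟩
  · rintro ⟨_, _, h1, _, _, h2, h3⟩
    exact ⟨_, _, .seq h1 h2, by rwa [← add_assoc]⟩

@[simp] theorem wp_ifLt {p q : ℕ} : wp W (.ifLt p q P P') Q σ t ↔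
    (σ.reg p < σ.reg q → wp W P Q σ (t + 1)) ∧ (σ.reg q ≤ σ.reg p → wp W P' Q σ (t + 1)) := by
  constructor
  · rintro ⟨t', σ', h1, h2⟩
    cases h1 with
    | ifTrue h hP =>
      exact ⟨fun _ => ⟨_, _, hP, by rwa [add_assoc, add_comm 1]⟩, fun h' => absurd h h'.not_gt⟩
    | ifFalse h hP =>
      exact ⟨fun h' => absurd h' h, fun _ => ⟨_, _, hP, by rwa [add_assoc, add_comm 1]⟩⟩
  · rintro ⟨h1, h2⟩
    by_cases h : σ.reg p < σ.reg q
    · obtain ⟨t', σ', h3, h4⟩ := h1 h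
      exact ⟨_, _, .ifTrue h h3, by rwa [add_comm t', ← add_assoc]⟩
    · obtain ⟨t', σ', h3, h4⟩ := h2 (not_lt.1 h)
      exact ⟨_, _, .ifFalse h h3, by rwa [add_comm t', ← add_assoc]⟩

/-- Loops: the invariant `I` bounds the elapsed time, so the loop terminates. -/
theorem wp_while {p q : ℕ} (I : State → ℕ → Prop) (T : ℕ) (h0 : I σ t)
    (hT : ∀ σ' t', Frame P σ σ' → I σ' t' → t' ≤ T)
    (hbody : ∀ σ' t', Frame P σ σ' → I σ' t' → σ'.reg p < σ'.reg q → wp W P I σ' (t' + 1))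
    (hexit : ∀ σ' t', Frame P σ σ' → I σ' t' → σ'.reg q ≤ σ'.reg p → Q σ' (t' + 1)) :
    wp W (.whileLt p q P) Q σ t := by
  -- The induction is on the remaining time `k`. The test alone costs a step in each round, so `k`
  -- decreases, and at `k = 0` a further round would end after `T`.
  suffices H : ∀ k σ' t', T ≤ t' + k → Frame P σ σ' → I σ' t' → wp W (.whileLt p q P) Q σ' t' from
    H T σ t (by omega) (Frame.refl _ _) h0
  intro k
  induction k with
  | zero =>
    intro σ' t' hk hF hI
    by_cases h : σ'.reg p < σ'.reg q
    · obtain ⟨t1, σ1, h1, h2⟩ := hbody _ _ hF hI h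
      have := hT _ _ (hF.trans h1.frame) h2
      omega
    · exact ⟨_, _, .whileFalse h, hexit _ _ hF hI (not_lt.1 h)⟩
  | succ k ih =>
    intro σ' t' hk hF hI
    by_cases h : σ'.reg p < σ'.reg q
    · obtain ⟨t1, σ1, h1, h2⟩ := hbody _ _ hF hI h
      obtain ⟨t2, σ2, h3, h4⟩ := ih σ1 (t' + 1 + t1) (by omega) (hF.trans h1.frame) h2
      exact ⟨_, _, .whileTrue h h1 h3, by convert h4 using 1; omega⟩
    · exact ⟨_, _, .whileFalse h, hexit _ _ hF hI (not_lt.1 h)⟩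

/-- A sequence of programs. -/
def block : List Prog → Prog
  | [] => .skip
  | [P] => P
  | P :: P' :: L => .seq P (block (P' :: L))

@[simp] theorem wp_block_singleton : wp W (block [P]) Q σ t ↔ wp W P Q σ t := Iff.rfl

@[simp] theorem wp_block_cons {L : List Prog} :
    wp W (block (P :: P' :: L)) Q σ t ↔ wp W P (wp W (block (P' :: L)) Q) σ t := wp_seq

/-- `for i < n do P`, starting from the current value of `i`; register 4 holds the number one. -/
def forLt (i n : ℕ) (P : Prog) : Prog := .whileLt i n (.seq P (.add i i 4))

/-- The time is an argument of the invariant, which leaves room for amortized costs. The body must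
establish the invariant for the state after the increment, since the increment belongs to the loop.
-/
theorem wp_forLt {i n b : ℕ} (I : ℕ → State → ℕ → Prop) (hone : σ.reg 4 = 1) (hb : σ.reg n = b)
    (hbW : b ≤ W) (hi : P.writesReg i = false) (hn : P.writesReg n = false)
    (h4 : P.writesReg 4 = false) (hin : n ≠ i) (hi4 : i ≠ 4) (ha : σ.reg i ≤ b)
    (h0 : I (σ.reg i) σ t)
    (hbody : ∀ k σ' t', Frame (forLt i n P) σ σ' → σ.reg i ≤ k → k < b → σ'.reg i = k →
      I k σ' t' → wp W P (fun σ'' t'' => I (k + 1) (σ''.setReg i (k + 1)) (t'' + 1)) σ' (t' + 1))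
    (hexit : ∀ σ' t', Frame (forLt i n P) σ σ' → σ'.reg i = b → I b σ' t' → Q σ' (t' + 1)) :
    wp W (forLt i n P) Q σ t := by
  have hFn : ∀ σ', Frame (forLt i n P) σ σ' → σ'.reg n = b := fun σ' h => by
    rw [h.reg n (by simp [forLt, Prog.writesReg, hn, hin]), hb]
  have hF4 : ∀ σ', Frame (forLt i n P) σ σ' → σ'.reg 4 = 1 := fun σ' h => by
    rw [h.reg 4 (by simp [forLt, Prog.writesReg, h4]; omega), hone]
  suffices H : ∀ l k σ' t', k + l = b → Frame (forLt i n P) σ σ' → σ.reg i ≤ k → σ'.reg i = k →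
      I k σ' t' → wp W (forLt i n P) Q σ' t' from
    H (b - σ.reg i) (σ.reg i) σ t (by omega) (Frame.refl _ _) le_rfl rfl h0
  intro l
  induction l with
  | zero =>
    intro k σ' t' hk hF hak hik hI
    obtain rfl : k = b := hk
    exact ⟨_, _, .whileFalse (by rw [hik, hFn _ hF]; omega), hexit _ _ hF hik hI⟩
  | succ l ih =>
    intro k σ' t' hk hF hak hik hI
    obtain ⟨t1, σ1, h1, h2⟩ := hbody k σ' t' hF hak (by omega) hik hI
    have e1 : σ1.reg i = k := by rw [h1.frame.reg i hi, hik]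
    have e4 : σ1.reg 4 = 1 := by rw [h1.frame.reg 4 h4, hF4 _ hF]
    have ex := Exec.seq h1 (Exec.add (W := W) σ1 i i 4 (by omega))
    rw [e1, e4] at ex
    obtain ⟨t2, σ2, h3, h4⟩ := ih (k + 1) (σ1.setReg i (k + 1)) (t' + 1 + t1 + 1) (by omega)
      (hF.trans ⟨ex.frame.reg, ex.frame.arr⟩) (by omega) (by simp) h2
    exact ⟨_, _, .whileTrue (by rw [hik, hFn _ hF]; omega) ex h3, by convert h4 using 1; omega⟩

/-- Counting loops whose body has a constant running time. -/
theorem wp_forLt_const {i n b : ℕ} (I : ℕ → State → Prop) (C : ℕ) (hone : σ.reg 4 = 1)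
    (hb : σ.reg n = b)
    (hbW : b ≤ W) (hi : P.writesReg i = false) (hn : P.writesReg n = false)
    (h4 : P.writesReg 4 = false) (hin : n ≠ i) (hi4 : i ≠ 4) (ha : σ.reg i ≤ b)
    (h0 : I (σ.reg i) σ)
    (hbody : ∀ k σ' t', Frame (forLt i n P) σ σ' → σ.reg i ≤ k → k < b → σ'.reg i = k →
      I k σ' → wp W P (fun σ'' t'' => I (k + 1) (σ''.setReg i (k + 1)) ∧ t'' ≤ t' + C) σ' t')
    (hexit : ∀ σ' t', Frame (forLt i n P) σ σ' → σ'.reg i = b → I b σ' →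
      t' ≤ t + (C + 2) * (b - σ.reg i) + 1 → Q σ' t') :
    wp W (forLt i n P) Q σ t := by
  refine wp_forLt (fun k σ' t' => I k σ' ∧ t' ≤ t + (C + 2) * (k - σ.reg i)) hone hb hbW hi hn h4
    hin hi4 ha ⟨h0, by simp⟩ ?_ ?_
  · rintro k σ' t' hF h1 h2 h3 ⟨h4, h5⟩
    refine (hbody k σ' (t' + 1) hF h1 h2 h3 h4).mono ?_
    rintro σ'' t'' ⟨h6, h7⟩
    refine ⟨h6, ?_⟩
    rw [Nat.succ_sub h1, Nat.mul_succ]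
    omega
  · rintro σ' t' hF h1 ⟨h2, h3⟩
    exact hexit _ _ hF h1 h2 (by omega)

end wp

end OrbitEquivalence

namespace OrbitEquivalence

open Function (minimalPeriod)

/-! ### Powers of a permutation along a cycle -/

section cycles
variable {Ω : Type*} {d : Equiv.Perm Ω} {x y : Ω} {j k : ℕ}

theorem pow_apply_eq_self_iff : (d ^ k) x = x ↔ minimalPeriod d x ∣ k := by
  rw [← Function.isPeriodicPt_iff_minimalPeriod_dvd, Function.IsPeriodicPt, Function.IsFixedPt,
    Equiv.Perm.iterate_eq_pow]

theorem pow_apply_eq_pow_apply_iff :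
    (d ^ j) x = (d ^ k) x ↔ j ≡ k [MOD minimalPeriod d x] := by
  have key : ∀ j k : ℕ, j ≤ k → ((d ^ j) x = (d ^ k) x ↔ j ≡ k [MOD minimalPeriod d x]) := by
    intro j k h
    rw [Nat.modEq_iff_dvd' h, ← pow_apply_eq_self_iff]
    obtain ⟨l, rfl⟩ := Nat.exists_eq_add_of_le h
    rw [Nat.add_sub_cancel_left, pow_add, Equiv.Perm.mul_apply, (d ^ j).apply_eq_iff_eq]
    exact eq_comm
  rcases le_total j k with h | h
  · exact key j k h
  · rw [eq_comm, key k j h]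
    exact ⟨Nat.ModEq.symm, Nat.ModEq.symm⟩

theorem eq_of_pow_apply_eq (hj : j < minimalPeriod d x) (hk : k < minimalPeriod d x)
    (h : (d ^ j) x = (d ^ k) x) : j = k :=
  Nat.ModEq.eq_of_lt_of_lt (pow_apply_eq_pow_apply_iff.1 h) hj hk

theorem sameCycle_pow_apply (d : Equiv.Perm Ω) (x : Ω) (k : ℕ) : d.SameCycle x ((d ^ k) x) :=
  ⟨k, by simp⟩

theorem minimalPeriod_eq_one_iff : minimalPeriod d x = 1 ↔ d x = x :=
  Function.minimalPeriod_eq_one_iff_isFixedPt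

variable [Finite Ω]

theorem mem_periodicPts (d : Equiv.Perm Ω) (x : Ω) : x ∈ Function.periodicPts d :=
  ⟨orderOf d, orderOf_pos d, by
    rw [Function.IsPeriodicPt, Function.IsFixedPt, Equiv.Perm.iterate_eq_pow, pow_orderOf_eq_one,
      Equiv.Perm.one_apply]⟩

theorem minimalPeriod_pos (d : Equiv.Perm Ω) (x : Ω) : 0 < minimalPeriod d x :=
  Function.minimalPeriod_pos_of_mem_periodicPts (mem_periodicPts d x)

theorem minimalPeriod_pow_apply (d : Equiv.Perm Ω) (x : Ω) (k : ℕ) :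
    minimalPeriod d ((d ^ k) x) = minimalPeriod d x := by
  rw [← Equiv.Perm.iterate_eq_pow]
  exact Function.minimalPeriod_apply_iterate (mem_periodicPts d x) k

theorem SameCycle.exists_pow_lt (h : d.SameCycle x y) :
    ∃ k < minimalPeriod d x, (d ^ k) x = y := by
  obtain ⟨k, hk⟩ := h.exists_nat_pow_eq
  refine ⟨k % minimalPeriod d x, Nat.mod_lt _ (minimalPeriod_pos d x), ?_⟩
  rw [← hk, pow_apply_eq_pow_apply_iff]
  exact Nat.mod_modEq _ _

end cycles

section cycleDist
variable {n : ℕ} {d : Equiv.Perm (Fin n)} {x y : Fin n} {k : ℕ}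

theorem cycleDist_eq (hk : k < minimalPeriod d x) (h : (d ^ k) x = y) : cycleDist d x y = k := by
  refine le_antisymm (Nat.sInf_le h) ?_
  have h1 : (d ^ cycleDist d x y) x = y := Nat.sInf_mem (s := {k : ℕ | (d ^ k) x = y}) ⟨k, h⟩
  have h2 : cycleDist d x y ≤ k := Nat.sInf_le h
  exact (eq_of_pow_apply_eq (h2.trans_lt hk) hk (h1.trans h.symm)).ge

theorem cycleDist_spec (h : d.SameCycle x y) :
    cycleDist d x y < minimalPeriod d x ∧ (d ^ cycleDist d x y) x = y := by
  obtain ⟨k, hk, h⟩ := SameCycle.exists_pow_lt h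
  rw [cycleDist_eq hk h]
  exact ⟨hk, h⟩

theorem minimalPeriod_le (d : Equiv.Perm (Fin n)) (x : Fin n) : minimalPeriod d x ≤ n := by
  have h : Function.Injective fun k : Fin (minimalPeriod d x) => (d ^ (k : ℕ)) x :=
    fun j k h => Fin.ext (eq_of_pow_apply_eq j.2 k.2 h)
  simpa using Fintype.card_le_of_injective _ h

end cycleDist

/-! ### Similarity of points and color refinement -/

section sim
variable {n m : ℕ} {s : Fin m → Equiv.Perm (Fin n)} {d : Equiv.Perm (Fin n)} {x y z : Fin n}

/-- The map `d ^ j x ↦ d ^ j y` is an isomorphism of the cycles of `d` through `x` and `y`, as far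
as the action of the generators is concerned. -/
def Sim (s : Fin m → Equiv.Perm (Fin n)) (d : Equiv.Perm (Fin n)) (x y : Fin n) : Prop :=
  minimalPeriod d x = minimalPeriod d y ∧
    ∀ i j k, s i ((d ^ j) x) = (d ^ k) x ↔ s i ((d ^ j) y) = (d ^ k) y

theorem Sim.refl (x : Fin n) : Sim s d x x := ⟨rfl, fun _ _ _ => Iff.rfl⟩

theorem Sim.symm (h : Sim s d x y) : Sim s d y x :=
  ⟨h.1.symm, fun i j k => (h.2 i j k).symm⟩

theorem Sim.trans (h : Sim s d x y) (h' : Sim s d y z) : Sim s d x z :=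
  ⟨h.1.trans h'.1, fun i j k => (h.2 i j k).trans (h'.2 i j k)⟩

theorem Sim.pow_eq_iff (h : Sim s d x y) {j k : ℕ} :
    (d ^ j) x = (d ^ k) x ↔ (d ^ j) y = (d ^ k) y := by
  rw [pow_apply_eq_pow_apply_iff, pow_apply_eq_pow_apply_iff, h.1]

theorem Sim.pow (h : Sim s d x y) (l : ℕ) : Sim s d ((d ^ l) x) ((d ^ l) y) := by
  refine ⟨by rw [minimalPeriod_pow_apply, minimalPeriod_pow_apply, h.1], fun i j k => ?_⟩
  simp only [← Equiv.Perm.mul_apply, ← pow_add]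
  exact h.2 i _ _

/-- The generators act within the cycles of `d`. -/
def ActsOnCycles (s : Fin m → Equiv.Perm (Fin n)) (d : Equiv.Perm (Fin n)) : Prop :=
  ∀ i x, d.SameCycle x (s i x)

theorem apply_mem_orbit (s : Fin m → Equiv.Perm (Fin n)) (i : Fin m) (x : Fin n) :
    s i x ∈ MulAction.orbit (group s) x :=
  ⟨⟨s i, Subgroup.subset_closure ⟨i, rfl⟩⟩, rfl⟩

theorem IsCanonicalOrder.actsOnCycles {c : Equiv.Perm (Fin n)} (h : IsCanonicalOrder s c d) :
    ActsOnCycles s d := fun i x => (h.cycles _ _).1 (apply_mem_orbit s i x)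

/-- By induction on `t`, one exponent `l` describes both `s i ^ t` at `x` and `s i ^ t` at `y`. With
`k = 0` this shows that similar points lie on cycles of `s i` of equal length, as the colors of the
copies require. -/
theorem Sim.pow_gen_iff (h : Sim s d x y) (hd : ActsOnCycles s d) (i : Fin m) (t k : ℕ) :
    (s i ^ t) x = (d ^ k) x ↔ (s i ^ t) y = (d ^ k) y := by
  have key : ∃ l, (s i ^ t) x = (d ^ l) x ∧ (s i ^ t) y = (d ^ l) y := by
    induction t with
    | zero => exact ⟨0, by simp⟩
    | succ t ih =>
      obtain ⟨l, h1, h2⟩ := ih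
      obtain ⟨k, -, hk⟩ := SameCycle.exists_pow_lt (hd i ((d ^ l) x))
      rw [← Equiv.Perm.mul_apply, ← pow_add] at hk
      refine ⟨k + l, ?_, ?_⟩
      · rw [pow_succ', Equiv.Perm.mul_apply, h1, hk]
      · rw [pow_succ', Equiv.Perm.mul_apply, h2, (h.2 i l (k + l)).1 hk.symm]
  obtain ⟨l, h1, h2⟩ := key
  rw [h1, h2, h.pow_eq_iff]

/-- Similar vertices of the enhanced cycle type graph. -/
def vertexSim (s : Fin m → Equiv.Perm (Fin n)) (d : Equiv.Perm (Fin n)) :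
    EVertex s d → EVertex s d → Prop
  | .inl x, .inl y => Sim s d x y
  | .inr (.inl ⟨i, x⟩), .inr (.inl ⟨j, y⟩) => i = j ∧ Sim s d x y
  | .inr (.inr x), .inr (.inr y) => Sim s d x y
  | _, _ => False

/-- Similarity as an equivalence relation. -/
def vertexSetoid (s : Fin m → Equiv.Perm (Fin n)) (d : Equiv.Perm (Fin n)) :
    Setoid (EVertex s d) where
  r := vertexSim s d
  iseqv := by
    refine ⟨?_, ?_, ?_⟩
    · rintro (x | ⟨i, x⟩ | x)
      exacts [Sim.refl _, ⟨rfl, Sim.refl _⟩, Sim.refl _]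
    · rintro (x | ⟨i, x⟩ | x) (y | ⟨j, y⟩ | y) h
      all_goals first | exact h.elim | exact Sim.symm h | exact ⟨h.1.symm, h.2.symm⟩
    · rintro (x | ⟨i, x⟩ | x) (y | ⟨j, y⟩ | y) (z | ⟨k, z⟩ | z) h h'
      all_goals first | exact h.elim | exact h'.elim | exact Sim.trans h h' |
        exact ⟨h.1.trans h'.1, h.2.trans h'.2⟩

end sim

/-! ### Bisimulations -/

section bisimulation
variable {V L K : Type*} {H : LabelledGraph V L K} {r : Setoid V}

/-- With at most one neighbor per label in each class, the counts to be compared are 0 or 1, and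
equitability becomes a transfer condition in both directions. -/
theorem LabelledGraph.isEquitableRefinement_of_subsingleton
    (hcol : ∀ u v, r u v → H.color u = H.color v)
    (hout : ∀ u v l u', r u v → H.edge l u u' → ∃ v', r u' v' ∧ H.edge l v v')
    (hin : ∀ u v l u', r u v → H.edge l u' u → ∃ v', r u' v' ∧ H.edge l v' v)
    (sout : ∀ u l v w, r v w → H.edge l u v → H.edge l u w → v = w)
    (sin : ∀ u l v w, r v w → H.edge l v u → H.edge l w u → v = w) :
    H.IsEquitableRefinement r := by
  have key : ∀ A B : Set V, A.Subsingleton → B.Subsingleton → (A.Nonempty ↔ B.Nonempty) →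
      A.ncard = B.ncard := by
    intro A B hA hB h
    rcases hA.eq_empty_or_singleton with rfl | ⟨a, rfl⟩ <;>
      rcases hB.eq_empty_or_singleton with rfl | ⟨b, rfl⟩ <;> simp_all
  refine fun u v h => ⟨hcol u v h, fun l w => ⟨key _ _ ?_ ?_ ⟨?_, ?_⟩, key _ _ ?_ ?_ ⟨?_, ?_⟩⟩⟩
  · exact fun a ha b hb => sout u l a b (r.trans (r.symm ha.1) hb.1) ha.2 hb.2
  · exact fun a ha b hb => sout v l a b (r.trans (r.symm ha.1) hb.1) ha.2 hb.2
  · rintro ⟨a, ha⟩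
    obtain ⟨b, hb, hb'⟩ := hout u v l a h ha.2
    exact ⟨b, r.trans ha.1 hb, hb'⟩
  · rintro ⟨a, ha⟩
    obtain ⟨b, hb, hb'⟩ := hout v u l a (r.symm h) ha.2
    exact ⟨b, r.trans ha.1 hb, hb'⟩
  · exact fun a ha b hb => sin u l a b (r.trans (r.symm ha.1) hb.1) ha.2 hb.2
  · exact fun a ha b hb => sin v l a b (r.trans (r.symm ha.1) hb.1) ha.2 hb.2
  · rintro ⟨a, ha⟩
    obtain ⟨b, hb, hb'⟩ := hin u v l a h ha.2
    exact ⟨b, r.trans ha.1 hb, hb'⟩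
  · rintro ⟨a, ha⟩
    obtain ⟨b, hb, hb'⟩ := hin v u l a (r.symm h) ha.2
    exact ⟨b, r.trans ha.1 hb, hb'⟩

/-- Equal counts are positive together. Finiteness matters, as `ncard` vanishes on infinite sets. -/
theorem LabelledGraph.IsEquitableRefinement.exists_out [Finite V] (hr : H.IsEquitableRefinement r)
    {u v u' : V} {l : L} (h : r u v) (he : H.edge l u u') : ∃ v', r u' v' ∧ H.edge l v v' := by
  have h1 := ((hr u v h).2 l u').1
  have h2 : 0 < {x | r u' x ∧ H.edge l u x}.ncard :=
    (Set.ncard_pos (Set.toFinite _)).2 ⟨u', r.refl _, he⟩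
  rw [h1] at h2
  exact (Set.ncard_pos (Set.toFinite _)).1 h2

end bisimulation

/-! ### Color refinement of the enhanced cycle type graph is similarity -/

section refinement
variable {n m : ℕ} {s : Fin m → Equiv.Perm (Fin n)} {d : Equiv.Perm (Fin n)} {x y z : Fin n}

theorem vertexSetoid_isEquitableRefinement (hd : ActsOnCycles s d) :
    (enhancedCycleTypeGraph s d).IsEquitableRefinement (vertexSetoid s d) := by
  have moved : ∀ {x y} i, Sim s d x y → s i x ≠ x → s i y ≠ y := fun i h h' => by
    have := h.2 i 0 0
    simp only [pow_zero, Equiv.Perm.one_apply] at this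
    rwa [ne_eq, ← this]
  have moved' : ∀ {x y}, Sim s d x y → d x ≠ x → d y ≠ y := fun h h' => by
    rw [ne_eq, ← minimalPeriod_eq_one_iff] at h' ⊢
    rwa [← h.1]
  have gen : ∀ {x y} i k, Sim s d x y → s i x = (d ^ k) x → s i y = (d ^ k) y :=
    fun i k h h' => (h.2 i 0 k).1 h'
  have dist : ∀ {x y} i, Sim s d x y → cycleDist d x (s i x) = cycleDist d y (s i y) := by
    intro x y i h
    unfold cycleDist
    congr 1
    ext k
    have := h.2 i 0 k
    simp only [pow_zero, Equiv.Perm.one_apply] at this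
    simp only [Set.mem_ofPred_eq, eq_comm, this]
  apply LabelledGraph.isEquitableRefinement_of_subsingleton
  · rintro (x | ⟨i, x⟩ | x) (y | ⟨j, y⟩ | y) h
    all_goals try exact False.elim h
    · rfl
    · obtain ⟨rfl, h⟩ := h
      show some (some i, minimalPeriod (s i) x) = some (some i, minimalPeriod (s i) y)
      suffices minimalPeriod (s i) x = minimalPeriod (s i) y by rw [this]
      have h0 := fun t => h.pow_gen_iff hd i t 0
      simp only [pow_zero, Equiv.Perm.one_apply, pow_apply_eq_self_iff] at h0
      exact Nat.dvd_antisymm ((h0 _).2 dvd_rfl) ((h0 _).1 dvd_rfl)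
    · show some (none, minimalPeriod d x) = some (none, minimalPeriod d y)
      rw [h.1]
  · rintro (x | ⟨i, x⟩ | x) (y | ⟨j, y⟩ | y) (_ | l) (x' | ⟨i', x'⟩ | x') h he
    all_goals try first | exact False.elim h | exact False.elim he
    · obtain rfl : x = x' := he
      exact ⟨.inr (.inl ⟨i', y, moved i' h x'.2⟩), ⟨rfl, h⟩, rfl⟩
    · obtain rfl : x = x' := he
      exact ⟨.inr (.inr ⟨y, moved' h x'.2⟩), h, rfl⟩
    · obtain rfl : x' = x := he
      exact ⟨.inl y, h.2, rfl⟩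
    · obtain ⟨rfl, h⟩ := h
      obtain ⟨rfl, he, rfl⟩ := he
      refine ⟨.inr (.inl ⟨i, s i y, fun e => y.2 ((s i).injective e)⟩), ⟨rfl, ?_⟩, rfl, rfl, ?_⟩
      · obtain ⟨k, -, hk⟩ := SameCycle.exists_pow_lt (hd i x)
        show Sim s d x' (s i y)
        rw [he, ← hk, gen i k h hk.symm]
        exact h.pow k
      · rw [he, dist i h]
    · obtain rfl : x' = x := he
      exact ⟨.inl y, h, rfl⟩
    · obtain ⟨he, rfl⟩ := he
      refine ⟨.inr (.inr ⟨d y, fun e => y.2 (d.injective e)⟩), ?_, rfl, rfl⟩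
      show Sim s d x' (d y)
      rw [he]
      exact Sim.pow h 1
  · rintro (x | ⟨i, x⟩ | x) (y | ⟨j, y⟩ | y) (_ | l) (x' | ⟨i', x'⟩ | x') h he
    all_goals try first | exact False.elim h | exact False.elim he
    · obtain rfl : x = x' := he
      exact ⟨.inr (.inl ⟨i', y, moved i' h x'.2⟩), ⟨rfl, h⟩, rfl⟩
    · obtain rfl : x = x' := he
      exact ⟨.inr (.inr ⟨y, moved' h x'.2⟩), h, rfl⟩
    · obtain rfl : x' = x := he
      exact ⟨.inl y, h.2, rfl⟩
    · obtain ⟨rfl, h⟩ := h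
      obtain ⟨rfl, he, rfl⟩ := he
      -- The source `x'` of the incoming edge is `d ^ k x` for some `k`. The edge into the copy of
      -- `y` then starts at the copy of `d ^ k y`.
      obtain ⟨k, -, hk⟩ := SameCycle.exists_pow_lt ((hd i' x').symm.trans (.refl _ _))
      rw [← he] at hk
      have h1 : s i' ((d ^ k) y) = y := by
        have := h.2 i' k 0
        simp only [pow_zero, Equiv.Perm.one_apply] at this
        rw [← this, hk, he]
      have h2 : Sim s d x' ((d ^ k) y) := by rw [← hk]; exact h.pow k
      refine ⟨.inr (.inl ⟨i', (d ^ k) y, moved i' h2 x'.2⟩), ⟨rfl, h2⟩, rfl, h1.symm, ?_⟩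
      show cycleDist d x' x = cycleDist d ((d ^ k) y) y
      rw [he, dist i' h2, h1]
    · obtain rfl : x' = x := he
      exact ⟨.inl y, h, rfl⟩
    · obtain ⟨he, rfl⟩ := he
      have h1 : d.SameCycle x x' := by rw [he]; exact (sameCycle_pow_apply d x' 1).symm
      obtain ⟨k, -, hk⟩ := SameCycle.exists_pow_lt h1
      have h2 : Sim s d x' ((d ^ k) y) := by rw [← hk]; exact Sim.pow h k
      refine ⟨.inr (.inr ⟨(d ^ k) y, moved' h2 x'.2⟩), h2, ?_, rfl⟩
      show (y : Fin n) = d ((d ^ k) y)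
      have h3 := Sim.pow_eq_iff h (j := 0) (k := k + 1)
      rw [pow_succ', Equiv.Perm.mul_apply, Equiv.Perm.mul_apply, hk] at h3
      exact h3.1 he
  -- A point can have many copies, but similar copies belong to the same permutation, so each class
  -- contains at most one of them.
  · rintro (x | ⟨i, x⟩ | x) (_ | l) (y | ⟨j, y, hy⟩ | ⟨y, hy⟩) (z | ⟨k, z, hz⟩ | ⟨z, hz⟩) h he he'
    all_goals try first | exact False.elim h | exact False.elim he
    · obtain ⟨rfl, -⟩ := h
      obtain rfl : x = y := he
      obtain rfl : x = z := he'
      rfl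
    · obtain rfl : x = y := he
      obtain rfl : x = z := he'
      rfl
    · obtain rfl : y = x := he
      obtain rfl : z = x := he'
      rfl
    · obtain ⟨rfl, h1, -⟩ := he
      obtain ⟨rfl, h2, -⟩ := he'
      obtain rfl : y = z := h1.trans h2.symm
      rfl
    · obtain rfl : y = x := he
      obtain rfl : z = x := he'
      rfl
    · obtain rfl : y = z := he.1.trans he'.1.symm
      rfl
  · rintro (x | ⟨i, x⟩ | x) (_ | l) (y | ⟨j, y, hy⟩ | ⟨y, hy⟩) (z | ⟨k, z, hz⟩ | ⟨z, hz⟩) h he he'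
    all_goals try first | exact False.elim h | exact False.elim he
    · obtain ⟨rfl, -⟩ := h
      obtain rfl : x = y := he
      obtain rfl : x = z := he'
      rfl
    · obtain rfl : x = y := he
      obtain rfl : x = z := he'
      rfl
    · obtain rfl : y = x := he
      obtain rfl : z = x := he'
      rfl
    · obtain ⟨rfl, h1, -⟩ := he
      obtain ⟨rfl, h2, -⟩ := he'
      obtain rfl : y = z := (s _).injective (h1.symm.trans h2)
      rfl
    · obtain rfl : y = x := he
      obtain rfl : z = x := he'
      rfl
    · obtain rfl : y = z := d.injective (he.1.symm.trans he'.1)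
      rfl

/-- The color of a copy names its permutation, so `gen` and `ord` match the copies of `x` with the
corresponding copies of `y`. Passing through the copies for `d` and the edge labelled 1 gives
`next`, and by induction all pairs `d ^ j x`, `d ^ j y` are identified. -/
theorem LabelledGraph.IsEquitableRefinement.sim (hd : ActsOnCycles s d) {r : Setoid (EVertex s d)}
    (hr : (enhancedCycleTypeGraph s d).IsEquitableRefinement r) {x y : Fin n}
    (h : r (.inl x) (.inl y)) : Sim s d x y := by
  have gen : ∀ {x y : Fin n} {i}, r (.inl x) (.inl y) → (hx : s i x ≠ x) →
      ∃ hy : s i y ≠ y, r (.inr (.inl ⟨i, x, hx⟩)) (.inr (.inl ⟨i, y, hy⟩)) := by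
    intro x y i h hx
    obtain ⟨v, h1, h2⟩ := hr.exists_out (l := none) (u' := .inr (.inl ⟨i, x, hx⟩)) h rfl
    rcases v with z | ⟨j, z, hz⟩ | ⟨z, hz⟩
    · exact h2.elim
    · obtain rfl : y = z := h2
      have h3 : some (some i, minimalPeriod (s i) x) = some (some j, minimalPeriod (s j) y) :=
        (hr _ _ h1).1
      obtain rfl : i = j := by simpa using (congrArg (Option.map Prod.fst) h3)
      exact ⟨hz, h1⟩
    · have h3 : some (some i, minimalPeriod (s i) x) = some (none, minimalPeriod d z) :=
        (hr _ _ h1).1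
      simp at h3
  have ord : ∀ {x y : Fin n}, r (.inl x) (.inl y) → (hx : d x ≠ x) →
      ∃ hy : d y ≠ y, r (.inr (.inr ⟨x, hx⟩)) (.inr (.inr ⟨y, hy⟩)) ∧
        minimalPeriod d x = minimalPeriod d y := by
    intro x y h hx
    obtain ⟨v, h1, h2⟩ := hr.exists_out (l := none) (u' := .inr (.inr ⟨x, hx⟩)) h rfl
    rcases v with z | ⟨j, z, hz⟩ | ⟨z, hz⟩
    · exact h2.elim
    · have h3 : some (none, minimalPeriod d x) = some (some j, minimalPeriod (s j) z) :=
        (hr _ _ h1).1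
      simp at h3
    · obtain rfl : y = z := h2
      have h3 : some ((none : Option (Fin m)), minimalPeriod d x) =
        some (none, minimalPeriod d y) := (hr _ _ h1).1
      exact ⟨hz, h1, by simpa using h3⟩
  have per : minimalPeriod d x = minimalPeriod d y := by
    by_cases hx : d x = x
    · by_cases hy : d y = y
      · rw [minimalPeriod_eq_one_iff.2 hx, minimalPeriod_eq_one_iff.2 hy]
      · exact absurd hx (ord (r.symm h) hy).1
    · exact (ord h hx).2.2
  have next : ∀ {x y : Fin n}, r (.inl x) (.inl y) → r (.inl (d x)) (.inl (d y)) := by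
    intro x y h
    by_cases hx : d x = x
    · by_cases hy : d y = y
      · rwa [hx, hy]
      · exact absurd hx (ord (r.symm h) hy).1
    · obtain ⟨hy, h1, -⟩ := ord h hx
      obtain ⟨v, h2, h3⟩ := hr.exists_out (l := some 1)
        (u' := .inr (.inr ⟨d x, fun e => hx (d.injective e)⟩)) h1 ⟨rfl, rfl⟩
      rcases v with z | ⟨j, z, hz⟩ | ⟨z, hz⟩
      · exact h3.elim
      · exact h3.elim
      · obtain rfl : z = d y := h3.1
        obtain ⟨v, h4, h5⟩ := hr.exists_out (l := none) (u' := .inl (d x)) h2 rfl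
        rcases v with z | ⟨j, z, hz'⟩ | ⟨z, hz'⟩
        · obtain rfl : z = d y := h5
          exact h4
        · exact h5.elim
        · exact h5.elim
  have nexts : ∀ j : ℕ, r (.inl ((d ^ j) x)) (.inl ((d ^ j) y)) := by
    intro j
    induction j with
    | zero => exact h
    | succ j ih => rw [pow_succ']; exact next ih
  have powiff : ∀ j k : ℕ, (d ^ j) x = (d ^ k) x ↔ (d ^ j) y = (d ^ k) y := fun j k => by
    rw [pow_apply_eq_pow_apply_iff, pow_apply_eq_pow_apply_iff, per]
  refine ⟨per, fun i j k => ?_⟩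
  by_cases hx : s i ((d ^ j) x) = (d ^ j) x
  · by_cases hy : s i ((d ^ j) y) = (d ^ j) y
    · rw [hx, hy, powiff]
    · exact absurd hx (gen (r.symm (nexts j)) hy).1
  · obtain ⟨hy, h1⟩ := gen (nexts j) hx
    -- The gadget edges at both points carry the same label, so `s i` moves `d ^ j x` and `d ^ j y`
    -- equally far along `d`.
    obtain ⟨v, h2, h3⟩ := hr.exists_out (l := some (cycleDist d ((d ^ j) x) (s i ((d ^ j) x))))
      (u' := .inr (.inl ⟨i, s i ((d ^ j) x), fun e => hx ((s i).injective e)⟩)) h1 ⟨rfl, rfl, rfl⟩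
    rcases v with z | ⟨j', z, hz⟩ | ⟨z, hz⟩
    · exact h3.elim
    · obtain ⟨rfl, h4, h5⟩ := h3
      obtain rfl : z = s i ((d ^ j) y) := h4
      have e1 := (cycleDist_spec (hd i ((d ^ j) x))).2
      have e2 := (cycleDist_spec (hd i ((d ^ j) y))).2
      have h5 : cycleDist d ((d ^ j) x) (s i ((d ^ j) x)) =
        cycleDist d ((d ^ j) y) (s i ((d ^ j) y)) := h5
      rw [← h5] at e2
      generalize cycleDist d ((d ^ j) x) (s i ((d ^ j) x)) = q at e1 e2
      rw [← e1, ← e2, ← Equiv.Perm.mul_apply, ← Equiv.Perm.mul_apply, ← pow_add, powiff]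
    · exact h3.elim

/-- For maximality, two identified copies have the same color, hence the same permutation, and the
undirected edges lead back to identified points, where `LabelledGraph.IsEquitableRefinement.sim`
applies. -/
theorem vertexSetoid_isColorRefinement (hd : ActsOnCycles s d) :
    (enhancedCycleTypeGraph s d).IsColorRefinement (vertexSetoid s d) := by
  refine ⟨vertexSetoid_isEquitableRefinement hd, fun r hr u v h => ?_⟩
  have hcol := (hr u v h).1
  rcases u with x | ⟨i, x, hx⟩ | ⟨x, hx⟩ <;> rcases v with y | ⟨j, y, hy⟩ | ⟨y, hy⟩
  any_goals simp [enhancedCycleTypeGraph, enhancedColor] at hcol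
  · exact hr.sim hd h
  · obtain ⟨v, h1, h2⟩ := hr.exists_out (l := none) (u' := .inl x) h rfl
    rcases v with z | ⟨k, z, hz'⟩ | ⟨z, hz'⟩
    · obtain rfl : z = y := h2
      exact ⟨hcol.1, hr.sim hd h1⟩
    · exact h2.elim
    · exact h2.elim
  · obtain ⟨v, h1, h2⟩ := hr.exists_out (l := none) (u' := .inl x) h rfl
    rcases v with z | ⟨k, z, hz'⟩ | ⟨z, hz'⟩
    · obtain rfl : z = y := h2
      exact hr.sim hd h1
    · exact h2.elim
    · exact h2.elim

/-- Color refinement separates exactly the points that are not similar. -/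
theorem isRefinedColoring_iff (hd : ActsOnCycles s d) {π : Fin n → Fin n} :
    IsRefinedColoring s d π ↔ ∀ x y, π x = π y ↔ Sim s d x y := by
  constructor
  · rintro ⟨r, ⟨h1, h2⟩, h3⟩ x y
    rw [h3]
    exact ⟨fun h => h1.sim hd h,
      fun h => h2 _ (vertexSetoid_isEquitableRefinement hd) (x := .inl x) (y := .inl y) h⟩
  · exact fun h => ⟨_, vertexSetoid_isColorRefinement hd, h⟩

end refinement

end OrbitEquivalence

namespace OrbitEquivalence

open Function (minimalPeriod)

/-! ### Commuting bijections and similar points -/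

section commuting
variable {n m : ℕ} {s : Fin m → Equiv.Perm (Fin n)} {c d g : Equiv.Perm (Fin n)} {x y z : Fin n}

theorem orbit_nonempty_inter (h : z ∈ MulAction.orbit (group s) x)
    (h' : z ∈ MulAction.orbit (group s) y) :
    MulAction.orbit (group s) x = MulAction.orbit (group s) y :=
  (MulAction.orbit_eq_iff.2 h).symm.trans (MulAction.orbit_eq_iff.2 h')

theorem mem_orbit_trans (h : y ∈ MulAction.orbit (group s) x)
    (h' : z ∈ MulAction.orbit (group s) y) : z ∈ MulAction.orbit (group s) x := by
  rwa [← MulAction.orbit_eq_iff.2 h]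

theorem gen_mem_orbit_iff (i : Fin m) :
    s i y ∈ MulAction.orbit (group s) x ↔ y ∈ MulAction.orbit (group s) x :=
  ⟨fun h => mem_orbit_trans h (MulAction.mem_orbit_symm.1 (apply_mem_orbit s i y)),
    fun h => mem_orbit_trans h (apply_mem_orbit s i y)⟩

/-- Each orbit is a cycle of `d`. -/
def CyclesAreOrbits (s : Fin m → Equiv.Perm (Fin n)) (d : Equiv.Perm (Fin n)) : Prop :=
  ∀ x y, y ∈ MulAction.orbit (group s) x ↔ d.SameCycle x y

/-- Every point of the orbit is some `d ^ j x`, so similarity says that `b` is injective and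
commutes with the generators. Since the orbit is stable, commutation passes to products and
inverses. -/
theorem Sim.isCommutingBijection (hd : CyclesAreOrbits s d) (h : Sim s d x y) {b : Fin n → Fin n}
    (hb : ∀ j : ℕ, b ((d ^ j) x) = (d ^ j) y) :
    IsCommutingBijection (group s) (MulAction.orbit (group s) x) (MulAction.orbit (group s) y)
      b := by
  have mem : ∀ {x z}, z ∈ MulAction.orbit (group s) x ↔ ∃ j : ℕ, (d ^ j) x = z := by
    intro x z
    rw [hd]
    exact ⟨fun h => h.exists_nat_pow_eq, fun ⟨j, hj⟩ => hj ▸ sameCycle_pow_apply d x j⟩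
  have gen : ∀ i, ∀ δ ∈ MulAction.orbit (group s) x, s i (b δ) = b (s i δ) := by
    intro i δ hδ
    obtain ⟨j, rfl⟩ := mem.1 hδ
    obtain ⟨k, hk⟩ := mem.1 ((gen_mem_orbit_iff i).2 hδ)
    rw [hb, ← hk, hb]
    exact (h.2 i j k).1 hk.symm
  refine ⟨⟨?_, ?_, ?_⟩, ?_⟩
  · intro z hz
    obtain ⟨j, rfl⟩ := mem.1 hz
    exact mem.2 ⟨j, (hb j).symm⟩
  · intro z hz w hw hzw
    obtain ⟨j, rfl⟩ := mem.1 hz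
    obtain ⟨k, rfl⟩ := mem.1 hw
    rw [hb, hb] at hzw
    exact h.pow_eq_iff.2 hzw
  · intro z hz
    obtain ⟨j, rfl⟩ := mem.1 hz
    exact ⟨_, mem.2 ⟨j, rfl⟩, hb j⟩
  · intro φ hφ
    have hmap : ∀ ψ ∈ group s, ∀ δ ∈ MulAction.orbit (group s) x,
        ψ δ ∈ MulAction.orbit (group s) x := fun ψ hψ δ hδ =>
      mem_orbit_trans hδ ⟨⟨ψ, hψ⟩, rfl⟩
    refine Subgroup.closure_induction (p := fun φ _ => ∀ δ ∈ MulAction.orbit (group s) x,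
      φ (b δ) = b (φ δ)) ?_ ?_ ?_ ?_ hφ
    · rintro _ ⟨i, rfl⟩
      exact gen i
    · intro δ _; rfl
    · intro φ ψ hφ hψ h1 h2 δ hδ
      rw [Equiv.Perm.mul_apply, h2 δ hδ, h1 _ (hmap ψ hψ δ hδ), Equiv.Perm.mul_apply]
    · intro φ hφ h1 δ hδ
      rw [Equiv.Perm.inv_eq_iff_eq, h1 _ (hmap φ⁻¹ (inv_mem hφ) δ hδ)]
      simp

theorem Sim.exists_map (h : Sim s d x y) : ∃ b : Fin n → Fin n, ∀ j : ℕ,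
    b ((d ^ j) x) = (d ^ j) y := by
  refine ⟨fun z => (d ^ cycleDist d x z) y, fun j => ?_⟩
  rw [← h.pow_eq_iff]
  exact (cycleDist_spec (sameCycle_pow_apply d x j)).2

theorem Sim.orbitEquiv (hd : CyclesAreOrbits s d) (h : Sim s d x y) :
    OrbitEquiv (group s) (MulAction.orbit (group s) x) (MulAction.orbit (group s) y) := by
  obtain ⟨b, hb⟩ := h.exists_map
  exact ⟨b, h.isCommutingBijection hd hb⟩

theorem sim_of_commute {φ : Equiv.Perm (Fin n)} (hs : ∀ i z, φ (s i z) = s i (φ z))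
    (hφ : ∀ z, φ (d z) = d (φ z)) (x : Fin n) : Sim s d x (φ x) := by
  have hpow : ∀ (j : ℕ) z, φ ((d ^ j) z) = (d ^ j) (φ z) := by
    intro j
    induction j with
    | zero => intro z; rfl
    | succ j ih => intro z; rw [pow_succ, Equiv.Perm.mul_apply, ih, hφ, Equiv.Perm.mul_apply]
  refine ⟨?_, fun i j k => ?_⟩
  · have h0 : ∀ k, (d ^ k) x = x ↔ (d ^ k) (φ x) = φ x := fun k => by
      rw [← hpow, φ.apply_eq_iff_eq]
    simp only [pow_apply_eq_self_iff] at h0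
    exact Nat.dvd_antisymm ((h0 _).2 dvd_rfl) ((h0 _).1 dvd_rfl)
  · rw [← hpow, ← hpow, ← hs, φ.apply_eq_iff_eq]

theorem IsInvariant.commute (h : IsInvariant s d) {φ : Equiv.Perm (Fin n)}
    (hφ : ∀ i z, φ (s i z) = s i (φ z)) (z : Fin n) : φ (d z) = d (φ z) := by
  have h1 : φ * d * φ⁻¹ = d := h φ fun i => by
    rw [mul_inv_eq_iff_eq_mul]
    exact Equiv.ext fun z => hφ i z
  rw [mul_inv_eq_iff_eq_mul] at h1
  exact Equiv.congr_fun h1 z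

/-- Invariance concerns permutations of all points, so the bijection has to be extended: by its
inverse on the second orbit and the identity elsewhere. If the two orbits coincide, `b` alone is
used there. -/
theorem exists_perm_of_isCommutingBijection {b : Fin n → Fin n}
    (hb : IsCommutingBijection (group s) (MulAction.orbit (group s) x)
      (MulAction.orbit (group s) y) b) :
    ∃ φ : Equiv.Perm (Fin n), (∀ i z, φ (s i z) = s i (φ z)) ∧
      ∀ z ∈ MulAction.orbit (group s) x, φ z = b z := by
  classical
  obtain ⟨hb, hcomm⟩ := hb
  set A := MulAction.orbit (group s) x with hA
  set B := MulAction.orbit (group s) y with hB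
  have hne : ∀ {z}, z ∈ A → z ∈ B → A = B := orbit_nonempty_inter
  have hgen : ∀ i z, z ∈ A → s i (b z) = b (s i z) :=
    fun i z hz => hcomm (s i) (Subgroup.subset_closure ⟨i, rfl⟩) z hz
  have hsA : ∀ i {z}, s i z ∈ A ↔ z ∈ A := fun i _ => gen_mem_orbit_iff i
  have hsB : ∀ i {z}, s i z ∈ B ↔ z ∈ B := fun i _ => gen_mem_orbit_iff i
  have hinv : ∀ w ∈ B, ∃ z ∈ A, b z = w := fun w hw => hb.surjOn hw
  choose! r hrA hr using hinv
  let f : Fin n → Fin n := fun z => if z ∈ A then b z else if z ∈ B then r z else z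
  have hf : Function.Injective f := by
    intro z w h
    by_cases h1 : z ∈ A <;> by_cases h2 : w ∈ A <;> by_cases h3 : z ∈ B <;> by_cases h4 : w ∈ B <;>
      simp only [f, h1, h2, h3, h4, if_true, if_false] at h
    -- A value common to two different branches either lies in both orbits, which makes them equal,
    -- or directly contradicts the location of one of the two arguments.
    all_goals try first
      | exact hb.injOn h1 h2 h
      | exact h
      | exact absurd (hne (hrA _ h4) (h ▸ hb.mapsTo h1)) (fun e => h2 (e ▸ h4))
      | exact absurd (hne (hrA _ h3) (h ▸ hb.mapsTo h2)) (fun e => h1 (e ▸ h3))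
      | exact absurd (h ▸ hb.mapsTo h1 : w ∈ B) h4
      | exact absurd (h ▸ hb.mapsTo h2 : z ∈ B) h3
    · rw [← hr z h3, h, hr w h4]
    · exact absurd (h ▸ hrA z h3 : w ∈ A) h2
    · exact absurd (h ▸ hrA w h4 : z ∈ A) h1
  refine ⟨Equiv.ofBijective f (Finite.injective_iff_bijective.1 hf), fun i z => ?_, fun z hz => ?_⟩
  · simp only [Equiv.ofBijective_apply, f, hsA, hsB]
    split_ifs with h1 h2
    · exact (hgen i z h1).symm
    · apply hb.injOn (hrA _ ((hsB i).2 h2)) ((hsA i).2 (hrA _ h2))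
      rw [hr _ ((hsB i).2 h2), ← hgen i _ (hrA _ h2), hr _ h2]
    · rfl
  · simp [f, hz]

theorem IsCommutingBijection.sim (hd : IsInvariant s d) {b : Fin n → Fin n}
    (hb : IsCommutingBijection (group s) (MulAction.orbit (group s) x)
      (MulAction.orbit (group s) y) b) (hz : z ∈ MulAction.orbit (group s) x) :
    Sim s d z (b z) := by
  obtain ⟨φ, h1, h2⟩ := exists_perm_of_isCommutingBijection hb
  rw [← h2 z hz]
  exact sim_of_commute h1 (hd.commute h1) z

/-- The forward direction rests on the invariance of `d`, the backward direction on its cycles being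
the orbits. -/
theorem orbitEquiv_iff (hd : CyclesAreOrbits s d) (hinv : IsInvariant s d) {π : Fin n → Fin n}
    (hπ : ∀ x y, π x = π y ↔ Sim s d x y) (x y : Fin n) :
    OrbitEquiv (group s) (MulAction.orbit (group s) x) (MulAction.orbit (group s) y) ↔
      ∃ x' ∈ MulAction.orbit (group s) x, ∃ y' ∈ MulAction.orbit (group s) y, π x' = π y' := by
  constructor
  · rintro ⟨b, hb⟩
    have hx := MulAction.mem_orbit_self (M := group s) x
    exact ⟨x, hx, b x, hb.1.mapsTo hx, (hπ _ _).2 (hb.sim hinv hx)⟩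
  · rintro ⟨x', hx', y', hy', h⟩
    rw [← MulAction.orbit_eq_iff.2 hx', ← MulAction.orbit_eq_iff.2 hy']
    exact ((hπ _ _).1 h).orbitEquiv hd

/-! ### The overlap of permutations -/

theorem perm_inv_apply_self {Ω : Type*} (φ : Equiv.Perm Ω) (z : Ω) : φ⁻¹ (φ z) = z :=
  φ.symm_apply_apply z

theorem perm_apply_inv_self {Ω : Type*} (φ : Equiv.Perm Ω) (z : Ω) : φ (φ⁻¹ z) = z :=
  φ.apply_symm_apply z

theorem IsOverlap.apply_eq {d' : Equiv.Perm (Fin n)} (h : IsOverlap c g d)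
    (h' : IsOverlap c g d') : d = d' := by
  ext1 y
  by_cases hy : ∃ x ∈ c.support, g.SameCycle x y
  · obtain ⟨x, hx, hxy⟩ := hy
    by_cases hg : g y ∈ c.support
    -- The least such `k` belongs to the last point of the support at or before `y`: a later one
    -- would reach `y` in fewer steps. This is the situation in which `back` prescribes the
    -- successor.
    · have hex : ∃ k : ℕ, ∃ x ∈ c.support, (g ^ k) x = y := by
        obtain ⟨k, hk⟩ := hxy.exists_nat_pow_eq
        exact ⟨k, x, hx, hk⟩
      classical
      obtain ⟨x', hx', hk⟩ := Nat.find_spec hex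
      have hno : ∀ j, 1 ≤ j → j ≤ Nat.find hex → (g ^ j) x' ∉ c.support := by
        intro j h1 h2 h3
        refine Nat.find_min hex (m := Nat.find hex - j) (by omega) ⟨_, h3, ?_⟩
        rw [← Equiv.Perm.mul_apply, ← pow_add, Nat.sub_add_cancel h2, hk]
      have hg' : (g ^ (Nat.find hex + 1)) x' ∈ c.support := by
        rw [pow_succ', Equiv.Perm.mul_apply, hk]
        exact hg
      have e1 := h.back x' hx' _ hno hg'
      rw [← h'.back x' hx' _ hno hg', hk] at e1
      exact e1
    · rw [h.read x hx y hxy hg, h'.read x hx y hxy hg]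
  · push Not at hy
    rw [h.other y hy, h'.other y hy]

/-- The clauses speak only of supports, cycles and powers, and conjugation carries all of these
along. -/
theorem IsOverlap.conj (h : IsOverlap c g d) (φ : Equiv.Perm (Fin n)) :
    IsOverlap (φ * c * φ⁻¹) (φ * g * φ⁻¹) (φ * d * φ⁻¹) := by
  have hsupp : ∀ x, x ∈ (φ * c * φ⁻¹).support ↔ φ⁻¹ x ∈ c.support := fun x => by
    simp only [Equiv.Perm.mem_support, Equiv.Perm.mul_apply, ne_eq]
    rw [← Equiv.Perm.eq_inv_iff_eq]
  refine ⟨fun x hx y hxy hg => ?_, fun x hx k hk hg => ?_, fun y hy => ?_⟩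
  · rw [hsupp] at hx hg
    rw [Equiv.Perm.sameCycle_conj] at hxy
    simp only [Equiv.Perm.mul_apply, perm_inv_apply_self] at hg ⊢
    rw [h.read _ hx _ hxy hg]
  · rw [hsupp] at hx hg
    simp only [hsupp, conj_pow, Equiv.Perm.mul_apply, perm_inv_apply_self] at hk hg ⊢
    rw [h.back _ hx k hk hg]
  · simp only [Equiv.Perm.mul_apply]
    rw [h.other (φ⁻¹ y), perm_apply_inv_self]
    intro x hx hxy
    refine hy (φ x) (by rw [hsupp]; simpa using hx) ?_
    rw [Equiv.Perm.sameCycle_conj]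
    simpa using hxy

/-- Conjugation by a permutation fixing the current order and `s i` turns an overlap of the two into
another overlap of the same two, and there is only one. -/
theorem IsInvariant.of_reachable (hc : IsInvariant s c)
    (h : Relation.ReflTransGen (fun e e' => ∃ i, IsOverlap e (s i) e') c d) : IsInvariant s d := by
  induction h with
  | refl => exact hc
  | tail _ h ih =>
    obtain ⟨i, hi⟩ := h
    intro φ hφ
    have := hi.conj φ
    rw [ih φ hφ, hφ i] at this
    exact this.apply_eq hi

theorem IsCanonicalOrder.isInvariant (h : IsCanonicalOrder s c d) (hc : IsInvariant s c) :
    IsInvariant s d := hc.of_reachable h.reachable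

/-! ### Inserting points into cycles -/

/-- Each cycle of `d` lies in an orbit, and each orbit has at most one nontrivial cycle. -/
structure HasUniqueCycles (s : Fin m → Equiv.Perm (Fin n)) (d : Equiv.Perm (Fin n)) : Prop where
  mem_orbit : ∀ x, d x ∈ MulAction.orbit (group s) x
  unique_cycle : ∀ x, ∀ y ∈ MulAction.orbit (group s) x, d x ≠ x → d y ≠ y → d.SameCycle x y

theorem mul_swap_apply (d : Equiv.Perm (Fin n)) (x y z : Fin n) :
    (d * Equiv.swap x y) z = if z = x then d y else if z = y then d x else d z := by
  rw [Equiv.Perm.mul_apply, Equiv.swap_apply_def]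
  split_ifs <;> rfl

theorem mul_swap_apply_ne_iff (hx : d x ≠ x) (hy : d y = y) :
    (d * Equiv.swap x y) z ≠ z ↔ d z ≠ z ∨ z = y := by
  have hxy : x ≠ y := by rintro rfl; exact hx hy
  rw [mul_swap_apply]
  split_ifs with h1 h2
  · subst h1; rw [hy]; exact ⟨fun _ => Or.inl hx, fun _ => hxy.symm⟩
  · subst h2
    refine ⟨fun _ => Or.inr rfl, fun _ e => hxy (d.injective (e.trans hy.symm))⟩
  · simp [h2]

/-- The product with the transposition inserts the fixed point `y` between `x` and `d x`. A step of
`d` from `x` becomes two steps, so points on a common cycle stay together, and `y` joins the cycle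
of `x`. -/
theorem HasUniqueCycles.mul_swap (hd : HasUniqueCycles s d) (hx : d x ≠ x) (hy : d y = y)
    (hxy : y ∈ MulAction.orbit (group s) x) : HasUniqueCycles s (d * Equiv.swap x y) := by
  have hne : x ≠ y := by rintro rfl; exact hx hy
  have e1 : (d * Equiv.swap x y) x = y := by rw [mul_swap_apply, if_pos rfl, hy]
  have e2 : (d * Equiv.swap x y) y = d x := by
    rw [mul_swap_apply, if_neg hne.symm, if_pos rfl]
  have step : ∀ z, (d * Equiv.swap x y).SameCycle z (d z) := by
    intro z
    by_cases h1 : z = x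
    · subst h1
      exact ⟨2, by rw [zpow_two, Equiv.Perm.mul_apply, e1, e2]⟩
    by_cases h2 : z = y
    · subst h2; rw [hy]
    · refine ⟨1, ?_⟩
      rw [zpow_one, mul_swap_apply, if_neg h1, if_neg h2]
  have same : ∀ z w, d.SameCycle z w → (d * Equiv.swap x y).SameCycle z w := by
    intro z w h
    obtain ⟨k, rfl⟩ := h.exists_nat_pow_eq
    induction k with
    | zero => exact .refl _ _
    | succ k ih =>
      rw [pow_succ', Equiv.Perm.mul_apply]
      exact (ih (sameCycle_pow_apply _ _ _)).trans (step _)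
  have hyx : (d * Equiv.swap x y).SameCycle x y := ⟨1, by rw [zpow_one, e1]⟩
  refine ⟨fun z => ?_, fun z w hw h1 h2 => ?_⟩
  · rw [mul_swap_apply]
    split_ifs with h1 h2
    · subst h1; rwa [hy]
    · subst h2; exact mem_orbit_trans (MulAction.mem_orbit_symm.1 hxy) (hd.mem_orbit x)
    · exact hd.mem_orbit z
  · rw [mul_swap_apply_ne_iff hx hy] at h1 h2
    have aux : ∀ z, d z ≠ z ∨ z = y → ∃ z', d z' ≠ z' ∧ z' ∈ MulAction.orbit (group s) z ∧
        (d * Equiv.swap x y).SameCycle z z' := by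
      rintro z (h | rfl)
      · exact ⟨z, h, MulAction.mem_orbit_self z, .refl _ _⟩
      · exact ⟨x, hx, MulAction.mem_orbit_symm.1 hxy, hyx.symm⟩
    obtain ⟨z', h3, h4, h5⟩ := aux z h1
    obtain ⟨w', h6, h7, h8⟩ := aux w h2
    refine h5.trans ((same _ _ (hd.unique_cycle z' w' ?_ h3 h6)).trans h8.symm)
    exact mem_orbit_trans (MulAction.mem_orbit_symm.1 h4) (mem_orbit_trans hw h7)

theorem IsInvariantUniqueCycles.hasUniqueCycles (h : IsInvariantUniqueCycles s c) :
    HasUniqueCycles s c := ⟨h.mem_orbit, h.unique_cycle⟩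

/-- The points moved by `d` are closed under the generators, hence under the group, and they include
a point of each nontrivial orbit because `c` moves one. So every nontrivial orbit consists of moved
points, which lie on a single cycle. -/
theorem HasUniqueCycles.cyclesAreOrbits (hc : IsInvariantUniqueCycles s c)
    (hd : HasUniqueCycles s d) (hcd : ∀ x, c x ≠ x → d x ≠ x)
    (hs : ∀ i x, d x ≠ x → d (s i x) ≠ s i x) : CyclesAreOrbits s d := by
  have hmoved : ∀ φ ∈ group s, ∀ x, d x ≠ x ↔ d (φ x) ≠ φ x := by
    intro φ hφ
    refine Subgroup.closure_induction (p := fun φ _ => ∀ x, d x ≠ x ↔ d (φ x) ≠ φ x)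
      ?_ ?_ ?_ ?_ hφ
    · rintro _ ⟨i, rfl⟩ x
      refine ⟨hs i x, fun h => ?_⟩
      have hpow : ∀ k : ℕ, d ((s i ^ k) (s i x)) ≠ (s i ^ k) (s i x) := by
        intro k
        induction k with
        | zero => exact h
        | succ k ih => rw [pow_succ', Equiv.Perm.mul_apply]; exact hs i _ ih
      -- By finite order the inverse of `s i` is a power of it, so closure under `s i` gives closure
      -- under the inverse.
      have h2 := hpow (orderOf (s i) - 1)
      have h3 : (s i ^ (orderOf (s i) - 1)) (s i x) = x := by
        rw [← Equiv.Perm.mul_apply, ← pow_succ, Nat.sub_add_cancel (orderOf_pos _),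
          pow_orderOf_eq_one, Equiv.Perm.one_apply]
      rwa [h3] at h2
    · intro x; rfl
    · intro φ ψ _ _ h1 h2 x
      rw [h2 x, h1 (ψ x), Equiv.Perm.mul_apply]
    · intro φ _ h1 x
      rw [h1 (φ⁻¹ x), perm_apply_inv_self]
  intro x y
  constructor
  · intro hy
    by_cases hxy : x = y
    · rw [hxy]
    · obtain ⟨z, hz, hz'⟩ := hc.exists_cycle x
        ⟨x, MulAction.mem_orbit_self x, y, hy, hxy⟩
      have hall : ∀ w ∈ MulAction.orbit (group s) x, d w ≠ w := by
        intro w hw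
        obtain ⟨⟨φ, hφ⟩, rfl⟩ := mem_orbit_trans (MulAction.mem_orbit_symm.1 hz) hw
        exact (hmoved φ hφ z).1 (hcd z hz')
      exact hd.unique_cycle x y hy (hall x (MulAction.mem_orbit_self x)) (hall y hy)
  · intro h
    obtain ⟨k, rfl⟩ := h.exists_nat_pow_eq
    clear h
    induction k with
    | zero => exact MulAction.mem_orbit_self x
    | succ k ih =>
      rw [pow_succ', Equiv.Perm.mul_apply]
      exact mem_orbit_trans ih (hd.mem_orbit _)

end commuting

end OrbitEquivalence

namespace OrbitEquivalence

/-! ### Lists of moved points -/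

/-- Pigeonhole: a list with as many cells as objects that mentions every object contains no
repetition and nothing else. The input formats rely on this. -/
theorem bijective_of_covers {α : Type*} {S : Finset α} {f : ℕ → ℕ} {v : α → ℕ}
    (hv : Function.Injective v) (h : ∀ x ∈ S, ∃ k < S.card, f k = v x) :
    (∀ k < S.card, ∃ x ∈ S, f k = v x) ∧
      ∀ k < S.card, ∀ k' < S.card, f k = f k' → k = k' := by
  classical
  choose! g hg hfg using h
  have hinj : Set.InjOn g S := fun x hx y hy hxy => hv (by rw [← hfg x hx, ← hfg y hy, hxy])
  have himg : S.image g = Finset.range S.card := by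
    apply Finset.eq_of_subset_of_card_le
    · intro k hk
      obtain ⟨x, hx, rfl⟩ := Finset.mem_image.1 hk
      exact Finset.mem_range.2 (hg x hx)
    · rw [Finset.card_image_of_injOn hinj, Finset.card_range]
  have hsurj : ∀ k < S.card, ∃ x ∈ S, g x = k := fun k hk => by
    rw [← Finset.mem_range, ← himg] at hk
    exact Finset.mem_image.1 hk
  refine ⟨fun k hk => ?_, fun k hk k' hk' hkk => ?_⟩
  · obtain ⟨x, hx, rfl⟩ := hsurj k hk
    exact ⟨x, hx, hfg x hx⟩
  · obtain ⟨x, hx, rfl⟩ := hsurj k hk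
    obtain ⟨y, hy, rfl⟩ := hsurj k' hk'
    rw [hfg x hx, hfg y hy] at hkk
    rw [hv hkk]

/-- An enumeration of all pairs of a generator and a point moved by it, generator by generator. -/
structure Listing {n m : ℕ} (s : Fin m → Equiv.Perm (Fin n)) (E : ℕ) where
  gen : Fin E → Fin m
  pt : Fin E → Fin n
  /-- the entry for the image of the point under the generator -/
  nxt : Fin E → Fin E
  off : ℕ → ℕ
  moved : ∀ e, s (gen e) (pt e) ≠ pt e
  inj : ∀ e e', gen e = gen e' → pt e = pt e' → e = e'
  surj : ∀ i x, s i x ≠ x → ∃ e, gen e = i ∧ pt e = x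
  gen_nxt : ∀ e, gen (nxt e) = gen e
  pt_nxt : ∀ e, pt (nxt e) = s (gen e) (pt e)
  off_zero : off 0 = 0
  off_last : off m = E
  off_le : ∀ i < m, off i ≤ off (i + 1)
  gen_iff : ∀ (e : Fin E) (i : Fin m), gen e = i ↔ off i ≤ e ∧ (e : ℕ) < off (i + 1)

/-- The offsets, points and images of the listing are stored in arrays 3, 4 and 5. -/
structure Listing.Stored {n m E : ℕ} {s : Fin m → Equiv.Perm (Fin n)} (L : Listing s E)
    (σ : State) : Prop where
  off : ∀ i ≤ m, σ.arr 3 i = L.off i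
  pt : ∀ e : Fin E, σ.arr 4 e = L.pt e
  img : ∀ e : Fin E, σ.arr 5 e = L.pt (L.nxt e)

theorem exists_interval {off : ℕ → ℕ} (h0 : off 0 = 0) (e : ℕ) :
    ∀ k, e < off k → ∃ i < k, off i ≤ e ∧ e < off (i + 1) := by
  intro k
  induction k with
  | zero => intro h; omega
  | succ k ih =>
    intro h
    by_cases hk : e < off k
    · obtain ⟨i, hi, h'⟩ := ih hk
      exact ⟨i, hi.trans (Nat.lt_succ_self k), h'⟩
    · exact ⟨k, Nat.lt_succ_self k, not_lt.1 hk, h⟩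

theorem EncodesInput.exists_listing {n m : ℕ} {G : ColoredGraph n}
    {s : Fin m → Equiv.Perm (Fin n)} {c : Equiv.Perm (Fin n)} {σ : State}
    (h : EncodesInput G s c σ) : ∃ L : Listing s (enc s), L.Stored σ := by
  have hinj : Function.Injective fun x : Fin n => (x : ℕ) := Fin.val_injective
  have hlist := fun i => bijective_of_covers (S := (s i).support)
    (f := fun k => σ.arr 4 (σ.arr 3 i + k)) hinj
    (fun x hx => let ⟨k, hk, h1, _⟩ := h.gens i x hx; ⟨k, hk, h1⟩)
  have hsucc : ∀ (i : ℕ) (hi : i < m), σ.arr 3 (i + 1) = σ.arr 3 i + (s ⟨i, hi⟩).support.card :=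
    fun i hi => h.off_succ ⟨i, hi⟩
  have hmono : ∀ i j, i ≤ j → j ≤ m → σ.arr 3 i ≤ σ.arr 3 j := by
    intro i j hij
    induction hij with
    | refl => intro _; exact le_rfl
    | step hij ih =>
      intro hj
      have := hsucc _ (Nat.lt_of_succ_le hj)
      have := ih (by omega)
      simp only [Nat.succ_eq_add_one] at *
      omega
  have hlast : σ.arr 3 m = enc s := by
    have : ∀ k ≤ m, ∑ i ∈ Finset.range k, (σ.arr 3 (i + 1) - σ.arr 3 i) = σ.arr 3 k := by
      intro k
      induction k with
      | zero => intro _; simp [h.off_zero]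
      | succ k ih =>
        intro hk
        rw [Finset.sum_range_succ, ih (by omega)]
        have := hsucc k hk
        omega
    rw [← this m le_rfl, Finset.sum_range, enc]
    refine Finset.sum_congr rfl fun i _ => ?_
    rw [h.off_succ i]
    omega
  have hentry : ∀ e : Fin (enc s), ∃ (i : Fin m) (x : Fin n), x ∈ (s i).support ∧
      σ.arr 4 e = x ∧ σ.arr 5 e = s i x ∧ σ.arr 3 i ≤ e ∧ (e : ℕ) < σ.arr 3 (i + 1) := by
    intro e
    obtain ⟨i, hi, h1, h2⟩ := exists_interval h.off_zero e m (by rw [hlast]; exact e.2)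
    have h3 := hsucc i hi
    obtain ⟨x, hx, hx'⟩ := (hlist ⟨i, hi⟩).1 (e - σ.arr 3 i) (by omega)
    obtain ⟨k, hk, h4, h5⟩ := h.gens ⟨i, hi⟩ x hx
    -- The format only promises the image of `x` in some cell `k`; as the cells of a segment hold
    -- distinct points, this is the cell `e` under consideration.
    have hke := (hlist ⟨i, hi⟩).2 k hk (e - σ.arr 3 i) (by omega) (by rw [hx', ← h4])
    have : σ.arr 3 i + k = e := by omega
    simp only [this] at h4 h5
    exact ⟨⟨i, hi⟩, x, hx, h4, h5, h1, h2⟩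
  choose gen pt hsupp hpt himg hlo hhi using hentry
  have hgen : ∀ (e : Fin (enc s)) (i : Fin m), gen e = i ↔
      σ.arr 3 i ≤ e ∧ (e : ℕ) < σ.arr 3 (i + 1) := by
    intro e i
    constructor
    · rintro rfl
      exact ⟨hlo e, hhi e⟩
    · rintro ⟨h1, h2⟩
      have h3 := hlo e
      have h4 := hhi e
      have h5 := (gen e).2
      have h6 := i.2
      rcases lt_trichotomy (gen e : ℕ) i with hlt | heq | hgt
      · have := hmono _ _ (Nat.succ_le_of_lt hlt) (by omega)
        simp only [Nat.succ_eq_add_one] at this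
        omega
      · exact Fin.ext heq
      · have := hmono _ _ (Nat.succ_le_of_lt hgt) (by omega)
        simp only [Nat.succ_eq_add_one] at this
        omega
  have hpinj : ∀ e e', gen e = gen e' → pt e = pt e' → e = e' := by
    intro e e' h1 h2
    have h3 := (hgen e (gen e)).1 rfl
    have h4 := (hgen e' (gen e)).1 h1.symm
    have h5 := h.off_succ (gen e)
    have h6 := (hlist (gen e)).2 (e - σ.arr 3 (gen e)) (by omega) (e' - σ.arr 3 (gen e)) (by omega)
      (by rw [Nat.add_sub_cancel' h3.1, Nat.add_sub_cancel' h4.1, hpt, hpt, h2])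
    exact Fin.ext (by omega)
  have hpsurj : ∀ i x, s i x ≠ x → ∃ e, gen e = i ∧ pt e = x := by
    intro i x hx
    obtain ⟨k, hk, h1, -⟩ := h.gens i x (Equiv.Perm.mem_support.2 hx)
    have h2 := h.off_succ i
    have h3 : σ.arr 3 i + k < enc s := by
      have := hmono (i + 1) m i.2 le_rfl
      omega
    refine ⟨⟨σ.arr 3 i + k, h3⟩, (hgen _ i).2 ⟨by simp, by simp only; omega⟩, ?_⟩
    rw [Fin.ext_iff, ← h1, ← hpt]
  have hnext : ∀ e, ∃ e', gen e' = gen e ∧ pt e' = s (gen e) (pt e) := fun e =>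
    hpsurj _ _ fun h => Equiv.Perm.mem_support.1 (hsupp e) ((s (gen e)).injective h)
  choose nxt hn1 hn2 using hnext
  exact ⟨⟨gen, pt, nxt, fun i => σ.arr 3 i, fun e => Equiv.Perm.mem_support.1 (hsupp e), hpinj,
    hpsurj, hn1, hn2, h.off_zero, hlast, fun i hi => hmono _ _ (Nat.le_succ i) hi, hgen⟩,
    ⟨fun _ _ => rfl, hpt, fun e => (himg e).trans (congrArg Fin.val (hn2 e).symm)⟩⟩

/-- Only the identity has empty support, and it occurs at most once. Loops over all generators are
thereby paid for by the encoding size. -/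
theorem card_gens_le {n m : ℕ} {s : Fin m → Equiv.Perm (Fin n)} (hs : Function.Injective s) :
    m ≤ enc s + 1 := by
  classical
  have h1 : (Finset.univ.filter fun i => s i = 1).card ≤ 1 := by
    rw [Finset.card_le_one]
    intro i hi j hj
    simp only [Finset.mem_filter, Finset.mem_univ, true_and] at hi hj
    exact hs (hi.trans hj.symm)
  have h2 : (Finset.univ.filter fun i => ¬ s i = 1).card ≤ enc s := by
    rw [Finset.card_eq_sum_ones, enc]
    refine (Finset.sum_le_sum fun i hi => ?_).trans (Finset.sum_le_sum_of_subset (Finset.subset_univ _))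
    simp only [Finset.mem_filter, Finset.mem_univ, true_and] at hi
    rwa [Nat.one_le_iff_ne_zero, ne_eq, Finset.card_eq_zero, Equiv.Perm.support_eq_empty_iff]
  have h3 := Finset.card_filter_add_card_filter_not (s := Finset.univ) fun i : Fin m => s i = 1
  rw [Finset.card_univ, Fintype.card_fin] at h3
  omega

namespace Listing
variable {n m E : ℕ} {s : Fin m → Equiv.Perm (Fin n)} (L : Listing s E)

theorem nxt_injective : Function.Injective L.nxt := fun e e' h => by
  have h1 := L.gen_nxt e
  rw [h, L.gen_nxt] at h1
  refine L.inj e e' h1.symm ((s (L.gen e)).injective ?_)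
  rw [← L.pt_nxt, h, L.pt_nxt, h1]

theorem off_mono {i j : ℕ} (hij : i ≤ j) (hj : j ≤ m) : L.off i ≤ L.off j := by
  induction hij with
  | refl => exact le_rfl
  | step hij ih => exact (ih (by omega)).trans (L.off_le _ hj)

theorem off_le_card {i : ℕ} (hi : i ≤ m) : L.off i ≤ E := (L.off_mono hi le_rfl).trans_eq L.off_last

theorem pt_nxt_ne (e : Fin E) : L.pt (L.nxt e) ≠ L.pt e := by
  rw [L.pt_nxt]; exact L.moved e

end Listing

end OrbitEquivalence

namespace OrbitEquivalence

/-! ### Preprocessing of the input -/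

/-- The constants used by all parts of the algorithm. -/
structure Context {n m E : ℕ} {s : Fin m → Equiv.Perm (Fin n)} (L : Listing s E)
    (σ : State) : Prop where
  reg0 : σ.reg 0 = n
  reg2 : σ.reg 2 = m
  reg3 : σ.reg 3 = 0
  reg4 : σ.reg 4 = 1
  reg5 : σ.reg 5 = E
  reg6 : σ.reg 6 = n + E + 2
  mul : ∀ a < n + E + 2, σ.arr 13 a = a * (n + E + 2)
  stored : L.Stored σ

/-- The program does not change the constants. -/
def Prog.keepsContext (P : Prog) : Bool :=
  !P.writesReg 0 && !P.writesReg 2 && !P.writesReg 3 && !P.writesReg 4 && !P.writesReg 5 &&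
    !P.writesReg 6 && !P.writesArr 13 && !P.writesArr 3 && !P.writesArr 4 && !P.writesArr 5

section
variable {n m E : ℕ} {s : Fin m → Equiv.Perm (Fin n)} {L : Listing s E}

theorem Context.of_frame {σ σ' : State} {P : Prog} (h : Context L σ) (hF : Frame P σ σ')
    (hP : P.keepsContext = true := by rfl) : Context L σ' := by
  simp only [Prog.keepsContext, Bool.and_eq_true, Bool.not_eq_true'] at hP
  obtain ⟨⟨⟨⟨⟨⟨⟨⟨⟨h0, h2⟩, h3⟩, h4⟩, h5⟩, h6⟩, a13⟩, a3⟩, a4⟩, a5⟩ := hP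
  constructor
  · rw [hF.reg 0 h0, h.reg0]
  · rw [hF.reg 2 h2, h.reg2]
  · rw [hF.reg 3 h3, h.reg3]
  · rw [hF.reg 4 h4, h.reg4]
  · rw [hF.reg 5 h5, h.reg5]
  · rw [hF.reg 6 h6, h.reg6]
  · rw [hF.arr 13 a13]; exact h.mul
  · exact ⟨by rw [hF.arr 3 a3]; exact h.stored.off, by rw [hF.arr 4 a4]; exact h.stored.pt,
      by rw [hF.arr 5 a5]; exact h.stored.img⟩

/-- Computes the constants. -/
def setup : Prog :=
  block [.const 4 1, .load 5 3 2, .add 6 0 5, .add 6 6 4, .add 6 6 4, .const 10 0, .const 11 0,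
    forLt 10 6 (block [.store 13 10 11, .add 11 11 6])]

/-- The machine cannot multiply, so a table of multiples of `n + E + 2` is built by repeated
addition. It serves later to encode a pair of numbers below `n + E + 2` as one key. The last
addition reaches the square of `n + E + 2`, which must fit in a word. -/
theorem wp_setup {W : ℕ} (hW : (n + E + 2) * (n + E + 2) ≤ W) {σ : State} {t : ℕ}
    {Q : State → ℕ → Prop} (h0 : σ.reg 0 = n) (h2 : σ.reg 2 = m) (h3 : σ.reg 3 = 0)
    (hL : L.Stored σ)
    (hQ : ∀ σ' t', Frame setup σ σ' → Context L σ' → t' ≤ t + 4 * (n + E) + 20 → Q σ' t') :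
    wp W setup Q σ t := by
  apply wp.frame
  have hB : n + E + 2 ≤ W := (Nat.le_mul_self _).trans hW
  have hE : σ.arr 3 m = E := by rw [hL.off m le_rfl, L.off_last]
  simp only [setup, wp_block_cons, wp_block_singleton, wp_const, wp_load, wp_add, State.reg_setReg,
    State.arr_setReg]
  simp [h0, h2, hE]
  refine ⟨by omega, by omega, by omega, by omega, ?_⟩
  refine wp_forLt_const (b := n + E + 2) (fun k σ' => σ'.reg 11 = k * (n + E + 2) ∧
    ∀ a < k, σ'.arr 13 a = a * (n + E + 2)) 2 (by simp) (by simp) (by omega) rfl rfl rfl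
    (by decide) (by decide) (by simp) (by simp) ?_ ?_
  · intro k σ' t' hF _ hk hik ⟨h11, h13⟩
    have e6 : σ'.reg 6 = n + E + 2 := by rw [hF.reg 6 rfl]; simp
    simp [hik, h11, e6]
    refine ⟨?_, by ring, fun a ha => ?_⟩
    · calc _ = (k + 1) * (n + E + 2) := by ring
        _ ≤ (n + E + 2) * (n + E + 2) := Nat.mul_le_mul_right _ hk
        _ ≤ W := hW
    · rcases ha.lt_or_eq with ha | rfl
      · rw [Function.update_of_ne ha.ne, h13 a ha]
      · simp
  · intro σ' t' hF h10 ⟨_, h13⟩ ht hF'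
    have hr : ∀ r, r ≠ 10 → r ≠ 11 → σ'.reg r = _ := fun r h h' =>
      hF.reg r (by simp [forLt, block, Prog.writesReg, h, h'])
    have ha : ∀ a, a ≠ 13 → σ'.arr a = σ.arr a := fun a h =>
      hF.arr a (by simp [forLt, block, Prog.writesArr, h])
    refine hQ _ _ hF' ⟨?_, ?_, ?_, ?_, ?_, ?_, h13, ?_⟩ ?_
    · rw [hr]; all_goals simp [h0]
    · rw [hr]; all_goals simp [h2]
    · rw [hr]; all_goals simp [h3]
    · rw [hr]; all_goals simp
    · rw [hr]; all_goals simp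
    · rw [hr]; all_goals simp
    · exact ⟨by rw [ha 3 (by decide)]; exact hL.off, by rw [ha 4 (by decide)]; exact hL.pt,
        by rw [ha 5 (by decide)]; exact hL.img⟩
    · simp at ht
      omega

/-- Computes the generators and the images of the entries in arrays 14 and 15. -/
def linkEntries : Prog :=
  block [.const 10 0,
    forLt 10 2 (block [.load 11 3 10, .add 12 10 4, .load 13 3 12, .move 14 11,
      forLt 14 13 (block [.load 15 4 14, .store 16 15 14, .store 14 14 10]), .move 14 11,
      forLt 14 13 (block [.load 15 5 14, .load 16 16 15, .store 15 14 16])])]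

/-- Arrays 14 and 15 contain the generators and the images of the entries. -/
structure Linked (L : Listing s E) (σ : State) : Prop where
  gen : ∀ e : Fin E, σ.arr 14 e = L.gen e
  nxt : ∀ e : Fin E, σ.arr 15 e = L.nxt e

/-- Array 16 maps points to their entries for the present generator. Remnants of earlier generators
do no harm: the image of a moved point is moved by the same generator, so the cell looked up has
just been rewritten. -/
theorem wp_linkEntries {W : ℕ} (hW : n + E + m + 2 ≤ W) {σ : State} {t : ℕ}
    {Q : State → ℕ → Prop} (hC : Context L σ)
    (hQ : ∀ σ' t', Frame linkEntries σ σ' → Linked L σ' → t' ≤ t + 14 * m + 10 * E + 3 → Q σ' t') :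
    wp W linkEntries Q σ t := by
  apply wp.frame
  simp only [linkEntries, wp_block_cons, wp_block_singleton, wp_const]
  refine ⟨by omega, ?_⟩
  refine wp_forLt (b := m) (fun k σ' t' => (∀ e : Fin E, (e : ℕ) < L.off k →
    σ'.arr 14 e = L.gen e ∧ σ'.arr 15 e = L.nxt e) ∧ t' ≤ t + 14 * k + 10 * L.off k + 1)
    (by simp [hC.reg4]) (by simp [hC.reg2]) (by omega) rfl rfl rfl
    (by decide) (by decide) (by simp) (by simp [L.off_zero]) ?_ ?_
  · intro k σ1 t1 hF _ hk hik ⟨h1, ht1⟩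
    have hC1 : Context L σ1 := (hC.of_frame (P := linkEntries) (σ' := σ.setReg 10 0)
      ⟨fun r hr => by
        have : r ≠ 10 := by rintro rfl; cases hr
        simp [this], fun _ _ => rfl⟩).of_frame hF
    have hok := L.off_le k hk
    have hoE := L.off_le_card (i := k + 1) hk
    simp [hik, hC1.reg4, hC1.stored.off k hk.le, hC1.stored.off (k + 1) hk]
    refine ⟨by omega, ?_⟩
    refine wp_forLt_const (b := L.off (k + 1)) (fun j σ2 =>
      (∀ e : Fin E, (e : ℕ) < j → σ2.arr 14 e = L.gen e) ∧ ∀ e : Fin E, (e : ℕ) < j →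
        L.off k ≤ e → σ2.arr 16 (L.pt e) = e) 3
      (by simp [hC1.reg4]) (by simp) (by omega) rfl rfl rfl
      (by decide) (by decide) (by simpa using hok) ?_ ?_ ?_
    · simp
      exact ⟨fun e he => (h1 e he).1, fun e h2 h3 => absurd h2 (not_lt.2 h3)⟩
    · intro j σ2 t2 hF2 hj1 hj hij ⟨h2, h3⟩
      simp at hj1
      have e10 : σ2.reg 10 = k := by rw [hF2.reg 10 rfl]; simp [hik]
      have e4 : σ2.arr 4 = σ1.arr 4 := by rw [hF2.arr 4 rfl]; simp
      have hjE : j < E := by omega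
      have hpt := hC1.stored.pt ⟨j, hjE⟩
      have hgen : L.gen ⟨j, hjE⟩ = ⟨k, hk⟩ := (L.gen_iff _ _).2 ⟨hj1, hj⟩
      simp at hpt
      simp [hij, e4, e10, hpt]
      refine ⟨fun e he => ?_, fun e he hke => ?_⟩
      · by_cases hej : (e : ℕ) = j
        · obtain rfl : e = ⟨j, hjE⟩ := Fin.ext hej
          simp [hgen]
        · rw [Function.update_of_ne hej, h2 e (by omega)]
      · by_cases hej : (e : ℕ) = j
        · obtain rfl : e = ⟨j, hjE⟩ := Fin.ext hej
          simp
        · rw [Function.update_of_ne, h3 e (by omega) hke]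
          intro h
          have hgen' : L.gen e = ⟨k, hk⟩ := (L.gen_iff _ _).2 ⟨hke, by simp only; omega⟩
          exact hej (congrArg Fin.val (L.inj e ⟨j, hjE⟩ (hgen'.trans hgen.symm) (Fin.ext h)))
    · intro σ2 t2 hF2 h14 ⟨h2, h3⟩ ht2
      have e11 : σ2.reg 11 = L.off k := by rw [hF2.reg 11 rfl]; simp
      have e13 : σ2.reg 13 = L.off (k + 1) := by rw [hF2.reg 13 rfl]; simp
      have e4 : σ2.reg 4 = 1 := by rw [hF2.reg 4 rfl]; simp [hC1.reg4]
      have e5 : σ2.arr 5 = σ1.arr 5 := by rw [hF2.arr 5 rfl]; simp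
      have e15 : σ2.arr 15 = σ1.arr 15 := by rw [hF2.arr 15 rfl]; simp
      simp [e11]
      refine wp_forLt_const (b := L.off (k + 1)) (fun j σ3 =>
        (∀ e : Fin E, (e : ℕ) < j → σ3.arr 15 e = L.nxt e)) 3
        (by simp [e4]) (by simp [e13]) (by omega) rfl rfl rfl
        (by decide) (by decide) (by simpa using hok) ?_ ?_ ?_
      · simp [e15]
        exact fun e he => (h1 e he).2
      · intro j σ3 t3 hF3 hj1 hj hij h4
        simp at hj1
        have e5' : σ3.arr 5 = σ1.arr 5 := by rw [hF3.arr 5 rfl]; simp [e5]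
        have e16 : σ3.arr 16 = σ2.arr 16 := by rw [hF3.arr 16 rfl]; simp
        have hjE : j < E := by omega
        have himg := hC1.stored.img ⟨j, hjE⟩
        have hgen : L.gen (L.nxt ⟨j, hjE⟩) = ⟨k, hk⟩ := by
          rw [L.gen_nxt]
          exact (L.gen_iff _ _).2 ⟨hj1, hj⟩
        have hr := (L.gen_iff _ _).1 hgen
        simp at himg
        simp [hij, e5', e16, himg, h3 _ hr.2 hr.1]
        intro e he
        by_cases hej : (e : ℕ) = j
        · obtain rfl : e = ⟨j, hjE⟩ := Fin.ext hej
          simp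
        · rw [Function.update_of_ne hej, h4 e (by omega)]
      · intro σ3 t3 hF3 h14 h4 ht3
        have e14 : σ3.arr 14 = σ2.arr 14 := by rw [hF3.arr 14 rfl]; simp
        simp at ht2 ht3
        simp [e14]
        exact ⟨fun e he => ⟨h2 e he, h4 e he⟩, by omega⟩
  · intro σ1 t1 hF h10 ⟨h1, ht1⟩ hF'
    rw [L.off_last] at h1 ht1
    exact hQ _ _ hF' ⟨fun e => (h1 e e.2).1, fun e => (h1 e e.2).2⟩ (by omega)

/-- Links the entries for each point: array 17 contains the last entry, array 18 the previous one,
both increased by one. -/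
def chainEntries : Prog :=
  block [.const 10 0,
    forLt 10 5 (block [.load 11 4 10, .load 12 17 11, .store 18 10 12, .add 13 10 4,
      .store 17 11 13])]

/-- `h` is one more than the last entry before `b` for the point `x`, or zero if there is none. -/
def IsLastEntry (L : Listing s E) (x : Fin n) (b h : ℕ) : Prop :=
  (∀ e : Fin E, (e : ℕ) < b → L.pt e = x → (e : ℕ) < h) ∧
    (h ≠ 0 → ∃ e : Fin E, (e : ℕ) < b ∧ (e : ℕ) + 1 = h ∧ L.pt e = x)

/-- Arrays 17 and 18 contain the chains of entries. -/
structure Chained (L : Listing s E) (σ : State) : Prop where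
  head : ∀ x : Fin n, IsLastEntry L x E (σ.arr 17 x)
  prev : ∀ e : Fin E, IsLastEntry L (L.pt e) e (σ.arr 18 e)

theorem wp_chainEntries {W : ℕ} (hW : n + E + m + 2 ≤ W) {σ : State} {t : ℕ}
    {Q : State → ℕ → Prop} (hC : Context L σ) (h17 : ∀ k, σ.arr 17 k = 0)
    (hQ : ∀ σ' t', Frame chainEntries σ σ' → Chained L σ' → t' ≤ t + 7 * E + 3 → Q σ' t') :
    wp W chainEntries Q σ t := by
  apply wp.frame
  simp only [chainEntries, wp_block_cons, wp_block_singleton, wp_const]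
  refine ⟨by omega, ?_⟩
  refine wp_forLt_const (b := E) (fun k σ' => (∀ x : Fin n, IsLastEntry L x k (σ'.arr 17 x)) ∧
    ∀ e : Fin E, (e : ℕ) < k → IsLastEntry L (L.pt e) e (σ'.arr 18 e)) 5
    (by simp [hC.reg4]) (by simp [hC.reg5]) (by omega) rfl rfl rfl
    (by decide) (by decide) (by simp) ?_ ?_ ?_
  · simp [IsLastEntry, h17]
  · intro k σ1 t1 hF _ hk hik ⟨h1, h2⟩
    have e4 : σ1.reg 4 = 1 := by rw [hF.reg 4 rfl]; simp [hC.reg4]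
    have hpt := hC.stored.pt ⟨k, hk⟩
    simp at hpt
    have e4' : σ1.arr 4 = σ.arr 4 := by rw [hF.arr 4 rfl]; simp
    simp [hik, e4, e4', hpt]
    refine ⟨by omega, fun x => ?_, fun e he => ?_⟩
    · by_cases hx : x = L.pt ⟨k, hk⟩
      · subst hx
        simp only [Function.update_self]
        exact ⟨fun e he _ => he, fun _ => ⟨⟨k, hk⟩, by simp, rfl, rfl⟩⟩
      · rw [Function.update_of_ne (fun h => hx (Fin.ext h))]
        refine ⟨fun e he hex => (h1 x).1 e ?_ hex, fun h0 => ?_⟩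
        · rcases Nat.lt_succ_iff_lt_or_eq.1 he with he | he
          · exact he
          · obtain rfl : e = ⟨k, hk⟩ := Fin.ext he
            exact absurd hex.symm hx
        · obtain ⟨e, h3, h4⟩ := (h1 x).2 h0
          exact ⟨e, by omega, h4⟩
    · by_cases hek : (e : ℕ) = k
      · obtain rfl : e = ⟨k, hk⟩ := Fin.ext hek
        simp only [Function.update_self]
        exact h1 _
      · rw [Function.update_of_ne hek]
        exact h2 e (by omega)
  · intro σ1 t1 hF h10 ⟨h1, h2⟩ ht hF'
    simp at ht
    exact hQ _ _ hF' ⟨h1, fun e => h2 e e.2⟩ (by omega)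

end

end OrbitEquivalence

namespace OrbitEquivalence

/-! ### Overlapping cycle by cycle -/

section
variable {n m E : ℕ} {s : Fin m → Equiv.Perm (Fin n)} {L : Listing s E}
  {c d₀ d g : Equiv.Perm (Fin n)} {x y z : Fin n}

/-- `l` is the last point moved by `d₀` at or before `z` on its cycle of `g`. -/
def IsLastMoved (d₀ g : Equiv.Perm (Fin n)) (l z : Fin n) : Prop :=
  d₀ l ≠ l ∧ ∃ k : ℕ, (g ^ k) l = z ∧ ∀ j, 1 ≤ j → j ≤ k → d₀ ((g ^ j) l) = (g ^ j) l

theorem IsLastMoved.refl (h : d₀ z ≠ z) : IsLastMoved d₀ g z z := ⟨h, 0, rfl, by omega⟩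

theorem IsLastMoved.next {l : Fin n} (h : IsLastMoved d₀ g l z) (hz : d₀ (g z) = g z) :
    IsLastMoved d₀ g l (g z) := by
  obtain ⟨h1, k, rfl, h2⟩ := h
  rw [← Equiv.Perm.mul_apply g, ← pow_succ'] at hz
  refine ⟨h1, k + 1, by rw [pow_succ', Equiv.Perm.mul_apply], fun j hj hjk => ?_⟩
  rcases hjk.lt_or_eq with hjk | rfl
  · exact h2 j hj (by omega)
  · exact hz

theorem IsLastMoved.sameCycle {l : Fin n} (h : IsLastMoved d₀ g l z) : g.SameCycle l z := by
  obtain ⟨-, k, rfl, -⟩ := h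
  exact sameCycle_pow_apply g l k

/-- Of two candidates at different distances from `z`, the farther one would meet the nearer one on
its way to `z`, at a point that is moved by `d₀`. -/
theorem IsLastMoved.unique {l l' : Fin n} (h : IsLastMoved d₀ g l z)
    (h' : IsLastMoved d₀ g l' z) : l = l' := by
  have key : ∀ {l l' : Fin n} {k k' : ℕ}, d₀ l ≠ l →
      (∀ j, 1 ≤ j → j ≤ k' → d₀ ((g ^ j) l') = (g ^ j) l') → (g ^ k) l = (g ^ k') l' → k' ≤ k := by
    intro l l' k k' h1 h2 h3
    by_contra hlt
    obtain ⟨j, rfl⟩ := Nat.exists_eq_add_of_lt (not_le.1 hlt)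
    rw [add_assoc, pow_add, Equiv.Perm.mul_apply, (g ^ k).apply_eq_iff_eq] at h3
    exact h1 (h3 ▸ h2 (j + 1) (by omega) (by omega))
  obtain ⟨h1, k, h2, h3⟩ := h
  obtain ⟨h1', k', h2', h3'⟩ := h'
  have h4 : (g ^ k) l = (g ^ k') l' := h2.trans h2'.symm
  obtain rfl := le_antisymm (key h1' h3 h4.symm) (key h1 h3' h4)
  exact (g ^ k).injective h4

/-- The successor of `z` in `d` is the one required by the overlap of `d₀` with `g`. -/
structure IsOverlapAt (d₀ g d : Equiv.Perm (Fin n)) (z : Fin n) : Prop where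
  meets : ∃ x, d₀ x ≠ x ∧ g.SameCycle x z
  read : d₀ (g z) = g z → d z = g z
  back : d₀ (g z) ≠ g z → ∃ l, IsLastMoved d₀ g l z ∧ d z = d₀ l

/-- A pointwise criterion, suited to a permutation that is modified one successor at a time. The
last moved point found for `z` is the one that `back` refers to, by uniqueness. -/
theorem isOverlap_of_isOverlapAt
    (h : ∀ z, (∃ x, d₀ x ≠ x ∧ g.SameCycle x z) → IsOverlapAt d₀ g d z)
    (h' : ∀ z, (¬ ∃ x, d₀ x ≠ x ∧ g.SameCycle x z) → d z = z) : IsOverlap d₀ g d := by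
  refine ⟨fun x hx y hxy hy => ?_, fun x hx k hk hk' => ?_, fun y hy => h' y ?_⟩
  · rw [Equiv.Perm.mem_support] at hx
    rw [Equiv.Perm.notMem_support] at hy
    exact (h y ⟨x, hx, hxy⟩).read hy
  · rw [Equiv.Perm.mem_support] at hx hk'
    rw [pow_succ', Equiv.Perm.mul_apply] at hk'
    obtain ⟨l, h1, h2⟩ := (h _ ⟨x, hx, sameCycle_pow_apply g x k⟩).back hk'
    have h3 : IsLastMoved d₀ g x ((g ^ k) x) :=
      ⟨hx, k, rfl, fun j h1 h2 => Equiv.Perm.notMem_support.1 (hk j h1 h2)⟩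
    rw [h2, h1.unique h3]
  · rintro ⟨x, hx, hxy⟩
    exact hy x (Equiv.Perm.mem_support.2 hx) hxy

/-- While `d₀` is overlapped with the `i`-th generator: the entries in `D` have been
treated, and the present permutation is `d`. -/
structure PartialOverlap (L : Listing s E) (i : Fin m) (d₀ d : Equiv.Perm (Fin n))
    (D : Finset (Fin E)) : Prop where
  fixed : ∀ z, s i z = z → d z = d₀ z
  done : ∀ e ∈ D, L.gen e = i → IsOverlapAt d₀ (s i) d (L.pt e)
  todo : ∀ e ∉ D, L.gen e = i → d (L.pt e) = d₀ (L.pt e)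

/-- On a cycle of `s i` with entries in `D`, all points are moved by `d₀`, so nothing is to be
inserted there. This is why a cycle, once treated, never has to be visited again in later overlaps.
-/
theorem PartialOverlap.init {D : Finset (Fin E)} {i : Fin m}
    (hD : ∀ e, L.nxt e ∈ D ↔ e ∈ D) (hd : ∀ e ∈ D, d₀ (L.pt e) ≠ L.pt e) :
    PartialOverlap L i d₀ d₀ D := by
  refine ⟨fun _ _ => rfl, fun e he hi => ⟨⟨_, hd e he, .refl _ _⟩, fun h => ?_, fun _ =>
    ⟨_, .refl (hd e he), rfl⟩⟩, fun _ _ _ => rfl⟩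
  subst hi
  rw [← L.pt_nxt] at h
  exact absurd h (hd _ ((hD e).2 he))

theorem mem_iff_of_sameCycle {D : Finset (Fin E)} (hD : ∀ e, L.nxt e ∈ D ↔ e ∈ D)
    {e e' : Fin E} (hg : L.gen e = L.gen e') (h : (s (L.gen e)).SameCycle (L.pt e) (L.pt e')) :
    e' ∈ D ↔ e ∈ D := by
  obtain ⟨k, hk⟩ := h.exists_nat_pow_eq
  clear h
  induction k generalizing e' with
  | zero => rw [L.inj e e' hg hk]
  | succ k ih =>
    have hpt : ∀ k, ∃ e'', L.gen e'' = L.gen e ∧ L.pt e'' = (s (L.gen e) ^ k) (L.pt e) := by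
      intro k
      induction k with
      | zero => exact ⟨e, rfl, rfl⟩
      | succ k ih =>
        obtain ⟨e1, h1, h2⟩ := ih
        exact ⟨L.nxt e1, by rw [L.gen_nxt, h1],
          by rw [L.pt_nxt, h1, h2, pow_succ', Equiv.Perm.mul_apply]⟩
    obtain ⟨e1, h1, h2⟩ := hpt k
    have h3 : e' = L.nxt e1 := by
      apply L.inj
      · rw [← hg, L.gen_nxt, h1]
      · rw [L.pt_nxt, h1, h2, ← hk, pow_succ', Equiv.Perm.mul_apply]
    rw [h3, hD, ih h1.symm h2.symm]

/-- Being closed under `nxt`, the set `D` is a union of cycles of entries. So it suffices that it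
contains the entries at points moved by `d₀`: every cycle of `s i` meeting the support is then
treated entirely. -/
theorem PartialOverlap.isOverlap {D : Finset (Fin E)} {i : Fin m}
    (h : PartialOverlap L i d₀ d D) (hD : ∀ e, L.nxt e ∈ D ↔ e ∈ D)
    (hall : ∀ e, L.gen e = i → d₀ (L.pt e) ≠ L.pt e → e ∈ D) : IsOverlap d₀ (s i) d := by
  apply isOverlap_of_isOverlapAt
  · rintro z ⟨x, hx, hxz⟩
    by_cases hz : s i z = z
    · obtain rfl := hxz.eq_of_right hz
      refine ⟨⟨_, hx, .refl _ _⟩, fun h1 => ?_, fun _ => ⟨x, .refl hx, h.fixed _ hz⟩⟩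
      rw [hz] at h1
      exact absurd h1 hx
    · have hx' : s i x ≠ x := fun h' => hz (hxz.apply_eq_self_iff.1 h')
      obtain ⟨e, rfl, rfl⟩ := L.surj i x hx'
      obtain ⟨e', h1, rfl⟩ := L.surj _ z hz
      exact h.done e' ((mem_iff_of_sameCycle hD h1.symm hxz).2 (hall e rfl hx)) h1
  · intro z hz
    have hz0 : d₀ z = z := by
      by_contra h'
      exact hz ⟨z, h', .refl _ _⟩
    by_cases hz' : s i z = z
    · rw [h.fixed z hz', hz0]
    · obtain ⟨e, h1, rfl⟩ := L.surj i z hz'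
      by_cases he : e ∈ D
      · exact absurd (h.done e he h1).meets hz
      · rw [h.todo e he h1, hz0]

/-- While a cycle of the `i`-th generator is traversed, starting at the entry `e₀`: the entries in
`D` have been treated, and `e` is the next one. -/
structure PartialWalk (L : Listing s E) (i : Fin m) (d₀ : Equiv.Perm (Fin n)) (e₀ : Fin E)
    (d : Equiv.Perm (Fin n)) (D : Finset (Fin E)) (e : Fin E) : Prop where
  gen : L.gen e = i
  start : d₀ (L.pt e₀) ≠ L.pt e₀
  fixed : ∀ z, s i z = z → d z = d₀ z
  done : ∀ f ∈ D, L.gen f = i → IsOverlapAt d₀ (s i) d (L.pt f)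
  todo : ∀ f ∉ D, L.gen f = i → f ≠ e → d (L.pt f) = d₀ (L.pt f)
  last : e ∉ D → ∃ l, IsLastMoved d₀ (s i) l (L.pt e) ∧ d (L.pt e) = d₀ l
  fwd : ∀ f ∈ D, L.nxt f ∈ D ∨ L.nxt f = e
  bwd : ∀ f, L.nxt f ∈ D → f ∈ D ∨ L.nxt f = e₀
  prev : (e = e₀ ∧ e₀ ∉ D) ∨ ∃ f ∈ D, L.nxt f = e
  eq_start : e ∈ D → e = e₀

variable {D : Finset (Fin E)} {i : Fin m} {e₀ e : Fin E}

theorem PartialOverlap.startWalk (h : PartialOverlap L i d₀ d D)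
    (hD : ∀ e, L.nxt e ∈ D ↔ e ∈ D) (hi : L.gen e₀ = i) (h₀ : d₀ (L.pt e₀) ≠ L.pt e₀)
    (he : e₀ ∉ D) : PartialWalk L i d₀ e₀ d D e₀ where
  gen := hi
  start := h₀
  fixed := h.fixed
  done := h.done
  todo f hf hi _ := h.todo f hf hi
  last _ := ⟨_, .refl h₀, h.todo e₀ he hi⟩
  fwd f hf := Or.inl ((hD f).2 hf)
  bwd f hf := Or.inl ((hD f).1 hf)
  prev := Or.inl ⟨rfl, he⟩
  eq_start h := absurd h he

/-- The walk can meet a treated entry only at its start `e₀`. There the exceptions allowed by `fwd`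
and `bwd` close up into a cycle. -/
theorem PartialWalk.closed (h : PartialWalk L i d₀ e₀ d D e) (he : e ∈ D) (f : Fin E) :
    L.nxt f ∈ D ↔ f ∈ D := by
  obtain rfl := h.eq_start he
  constructor
  · intro hf
    rcases h.bwd f hf with h1 | h1
    · exact h1
    · rcases h.prev with ⟨-, h2⟩ | ⟨f', h2, h3⟩
      · exact absurd he h2
      · rwa [L.nxt_injective (h1.trans h3.symm)]
  · intro hf
    rcases h.fwd f hf with h1 | h1
    · exact h1
    · rwa [h1]

theorem PartialWalk.partialOverlap (h : PartialWalk L i d₀ e₀ d D e) (he : e ∈ D) :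
    PartialOverlap L i d₀ d D :=
  ⟨h.fixed, h.done, fun f hf hi => h.todo f hf hi fun h' => hf (h' ▸ he)⟩

/-- The part of a step of the traversal that does not concern the permutation. -/
theorem PartialWalk.advance (h : PartialWalk L i d₀ e₀ d D e) (he : e ∉ D)
    {d' : Equiv.Perm (Fin n)} (hfix : ∀ z, s i z = z → d' z = d z)
    (hdone : ∀ f ∈ D, L.gen f = i → d' (L.pt f) = d (L.pt f))
    (hcur : IsOverlapAt d₀ (s i) d' (L.pt e))
    (htodo : ∀ f ∉ D, L.gen f = i → f ≠ e → f ≠ L.nxt e → d' (L.pt f) = d (L.pt f))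
    (hlast : L.nxt e ∉ D →
      ∃ l, IsLastMoved d₀ (s i) l (L.pt (L.nxt e)) ∧ d' (L.pt (L.nxt e)) = d₀ l) :
    PartialWalk L i d₀ e₀ d' (insert e D) (L.nxt e) where
  gen := (L.gen_nxt e).trans h.gen
  start := h.start
  fixed z hz := (hfix z hz).trans (h.fixed z hz)
  done f hf hi := by
    rcases Finset.mem_insert.1 hf with rfl | hf
    · exact hcur
    · obtain ⟨h1, h2, h3⟩ := h.done f hf hi
      exact ⟨h1, by rwa [hdone f hf hi], by rwa [hdone f hf hi]⟩
  todo f hf hi hne := by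
    rw [Finset.mem_insert, not_or] at hf
    rw [htodo f hf.2 hi hf.1 hne, h.todo f hf.2 hi hf.1]
  last hf := hlast fun h' => hf (Finset.mem_insert_of_mem h')
  fwd f hf := by
    rcases Finset.mem_insert.1 hf with rfl | hf
    · exact Or.inr rfl
    · rcases h.fwd f hf with h1 | h1
      · exact Or.inl (Finset.mem_insert_of_mem h1)
      · exact Or.inl (h1 ▸ Finset.mem_insert_self _ _)
  bwd f hf := by
    rcases Finset.mem_insert.1 hf with h1 | hf
    · rcases h.prev with ⟨h2, -⟩ | ⟨f', h2, h3⟩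
      · exact Or.inr (h1.trans h2)
      · rw [L.nxt_injective (h1.trans h3.symm)]
        exact Or.inl (Finset.mem_insert_of_mem h2)
    · rcases h.bwd f hf with h1 | h1
      · exact Or.inl (Finset.mem_insert_of_mem h1)
      · exact Or.inr h1
  prev := Or.inr ⟨e, Finset.mem_insert_self _ _, rfl⟩
  eq_start hf := by
    rcases Finset.mem_insert.1 hf with h1 | h1
    · exact absurd (congrArg L.pt h1) (L.pt_nxt_ne e)
    · exact (h.bwd e h1).resolve_left he

/-- The next point is moved by `d₀`: it is either the start or untreated, hence unchanged. So the
stretch read since the last moved point `l` ends here, and the present point already has the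
successor `d₀ l`. -/
theorem PartialWalk.skip (h : PartialWalk L i d₀ e₀ d D e) (he : e ∉ D)
    (hy : d (L.pt (L.nxt e)) ≠ L.pt (L.nxt e)) :
    PartialWalk L i d₀ e₀ d (insert e D) (L.nxt e) := by
  have hne : L.nxt e ≠ e := fun h' => L.pt_nxt_ne e (congrArg L.pt h')
  have hy0 : d₀ (L.pt (L.nxt e)) ≠ L.pt (L.nxt e) := by
    by_cases hD : L.nxt e ∈ D
    · rw [(h.bwd e hD).resolve_left he]
      exact h.start
    · rwa [← h.todo _ hD ((L.gen_nxt e).trans h.gen) hne]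
  obtain ⟨l, hl, hl'⟩ := h.last he
  refine h.advance he (fun _ _ => rfl) (fun _ _ _ => rfl) ⟨⟨l, hl.1, hl.sameCycle⟩, ?_, ?_⟩
    (fun _ _ _ _ _ => rfl) (fun hD => ⟨_, .refl hy0, h.todo _ hD ((L.gen_nxt e).trans h.gen) hne⟩)
  · intro h1
    rw [← h.gen, ← L.pt_nxt] at h1
    exact absurd h1 hy0
  · exact fun _ => ⟨l, hl, hl'⟩

/-- The next point is fixed by `d₀` as well and has to be read. The transposition makes it the
successor of the present point and hands the pending successor `d₀ l` on to it. -/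
theorem PartialWalk.insert (h : PartialWalk L i d₀ e₀ d D e) (he : e ∉ D)
    (hD : ∀ f ∈ D, d (L.pt f) ≠ L.pt f) (hx : d (L.pt e) ≠ L.pt e)
    (hy : d (L.pt (L.nxt e)) = L.pt (L.nxt e)) :
    PartialWalk L i d₀ e₀ (d * Equiv.swap (L.pt e) (L.pt (L.nxt e))) (insert e D) (L.nxt e) := by
  have hne : L.nxt e ≠ e := fun h' => L.pt_nxt_ne e (congrArg L.pt h')
  have hyD : L.nxt e ∉ D := fun h' => hD _ h' hy
  have hgn : L.gen (L.nxt e) = i := (L.gen_nxt e).trans h.gen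
  have hpn : L.pt (L.nxt e) = s i (L.pt e) := by rw [L.pt_nxt, h.gen]
  have hy0 : d₀ (L.pt (L.nxt e)) = L.pt (L.nxt e) := by rw [← h.todo _ hyD hgn hne, hy]
  have hsame : ∀ z, z ≠ L.pt e → z ≠ L.pt (L.nxt e) →
      (d * Equiv.swap (L.pt e) (L.pt (L.nxt e))) z = d z := fun z h1 h2 => by
    rw [mul_swap_apply, if_neg h1, if_neg h2]
  have hpt : ∀ f, L.gen f = i → f ≠ e → f ≠ L.nxt e →
      (d * Equiv.swap (L.pt e) (L.pt (L.nxt e))) (L.pt f) = d (L.pt f) := fun f hf h1 h2 =>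
    hsame _ (fun h' => h1 (L.inj _ _ (hf.trans h.gen.symm) h'))
      (fun h' => h2 (L.inj _ _ (hf.trans hgn.symm) h'))
  obtain ⟨l, hl, hl'⟩ := h.last he
  refine h.advance he (fun z hz => hsame z ?_ ?_) (fun f hf hi => hpt f hi ?_ ?_)
    ⟨⟨l, hl.1, hl.sameCycle⟩, fun _ => ?_, fun h1 => ?_⟩ (fun f _ hi h1 h2 => hpt f hi h1 h2)
    (fun _ => ⟨l, ?_, ?_⟩)
  · rintro rfl
    rw [← hpn] at hz
    exact L.pt_nxt_ne e hz
  · rintro rfl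
    have := L.moved (L.nxt e)
    rw [hgn] at this
    exact this hz
  · rintro rfl
    exact he hf
  · rintro rfl
    exact hyD hf
  · rw [mul_swap_apply, if_pos rfl, hy, hpn]
  · rw [← hpn] at h1
    exact absurd hy0 h1
  · rw [hpn]
    exact hl.next (by rw [← hpn, hy0])
  · rw [mul_swap_apply, if_neg (L.pt_nxt_ne e), if_pos rfl, hl']

/-! ### Queues of entries -/

/-- The entries of the `i`-th generator in the list. -/
def segment (L : Listing s E) (l : List (Fin E)) (i : Fin m) : List (Fin E) :=
  l.filter fun e => L.gen e = i

theorem segment_append (l l' : List (Fin E)) (i : Fin m) :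
    segment L (l ++ l') i = segment L l i ++ segment L l' i := List.filter_append ..

theorem mem_segment {l : List (Fin E)} {i : Fin m} : e ∈ segment L l i ↔ e ∈ l ∧ L.gen e = i := by
  simp [segment]

theorem sum_length_segment (l : List (Fin E)) : ∑ i, (segment L l i).length = l.length := by
  induction l with
  | nil => simp [segment]
  | cons e l ih =>
    have : ∀ i, (segment L (e :: l) i).length =
        (segment L l i).length + if L.gen e = i then 1 else 0 := fun i => by
      unfold segment
      by_cases h : L.gen e = i <;> simp [h]
    simp only [this, Finset.sum_add_distrib, ih, Finset.sum_ite_eq, Finset.mem_univ, if_true,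
      List.length_cons]

/-- The entries of a generator are distinct numbers in its interval of offsets, so this interval has
room for its segment in array 20. -/
theorem off_add_length_segment_le {l : List (Fin E)} (hl : l.Nodup) (i : Fin m) :
    L.off i + (segment L l i).length ≤ L.off (i + 1) := by
  have h1 : ((segment L l i).map Fin.val).Nodup :=
    (hl.filter _).map Fin.val_injective
  have h2 : ((segment L l i).map Fin.val).toFinset ⊆ Finset.Ico (L.off i) (L.off (i + 1)) := by
    intro k hk
    simp only [List.mem_toFinset, List.mem_map, mem_segment] at hk
    obtain ⟨e, ⟨-, he⟩, rfl⟩ := hk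
    exact Finset.mem_Ico.2 ((L.gen_iff e i).1 he)
  have h3 := Finset.card_le_card h2
  rw [List.toFinset_card_of_nodup h1, List.length_map, Nat.card_Ico] at h3
  have := L.off_le i i.2
  omega

/-- The entries of `l` are in the queue (array 23), and in the segments (array 20) of their
generators. -/
structure Queued (L : Listing s E) (l : List (Fin E)) (σ : State) : Prop where
  nodup : l.Nodup
  tail : σ.reg 21 = l.length
  queue : ∀ q (h : q < l.length), σ.arr 23 q = l[q]
  segEnd : ∀ i : Fin m, σ.arr 21 i = L.off i + (segment L l i).length
  seg : ∀ i k (h : k < (segment L l i).length), σ.arr 20 (L.off i + k) = (segment L l i)[k]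

theorem Queued.length_le {l : List (Fin E)} {σ : State} (h : Queued L l σ) : l.length ≤ E := by
  simpa using h.nodup.length_le_card

theorem Queued.push {l : List (Fin E)} {σ σ' : State} (h : Queued L l σ) (he : e ∉ l)
    (hreg : σ'.reg 21 = l.length + 1)
    (h23 : σ'.arr 23 = Function.update (σ.arr 23) l.length e)
    (h21 : σ'.arr 21 = Function.update (σ.arr 21) (L.gen e)
      (L.off (L.gen e) + (segment L l (L.gen e)).length + 1))
    (h20 : σ'.arr 20 = Function.update (σ.arr 20)
      (L.off (L.gen e) + (segment L l (L.gen e)).length) e) : Queued L (l ++ [e]) σ' := by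
  have hnd : (l ++ [e]).Nodup := by
    rw [List.nodup_append]
    refine ⟨h.nodup, by simp, ?_⟩
    rintro a ha b hb rfl
    simp only [List.mem_singleton] at hb
    exact he (hb ▸ ha)
  refine ⟨hnd, by simp [hreg], fun q hq => ?_, fun i => ?_, fun i k hk => ?_⟩
  · rw [h23]
    simp only [List.length_append, List.length_singleton] at hq
    by_cases hql : q = l.length
    · subst hql; simp
    · rw [Function.update_of_ne hql, h.queue q (by omega), List.getElem_append_left]
  · rw [h21, segment_append]
    by_cases hi : i = L.gen e
    · subst hi
      simp [segment, add_assoc]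
    · rw [Function.update_of_ne (fun h' => hi (Fin.ext h')), h.segEnd i]
      simp [segment, Ne.symm hi]
  · have hle := off_add_length_segment_le (L := L) hnd
    have hlen : (segment L (l ++ [e]) i).length = (segment L l i).length +
        if L.gen e = i then 1 else 0 := by
      rw [segment_append, List.length_append]
      by_cases h : L.gen e = i <;> simp [segment, h]
    -- Segments of different generators occupy disjoint intervals, so the write into array 20
    -- touches one cell of one segment.
    have hpos : L.off i + k = L.off (L.gen e) + (segment L l (L.gen e)).length ↔
        L.gen e = i ∧ k = (segment L l i).length := by
      constructor
      · intro h1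
        have h2 := hle i
        have h3 := hle (L.gen e)
        have h4 : (segment L (l ++ [e]) (L.gen e)).length =
            (segment L l (L.gen e)).length + 1 := by simp [segment]
        have hlt : L.off i + k < E := lt_of_lt_of_le (by omega) (L.off_le_card (i := i + 1) i.2)
        have h5 : L.gen ⟨L.off i + k, hlt⟩ = i :=
          (L.gen_iff _ _).2 ⟨by simp only; omega, by simp only; omega⟩
        have h6 : L.gen ⟨L.off i + k, hlt⟩ = L.gen e :=
          (L.gen_iff _ _).2 ⟨by simp only; omega, by simp only; omega⟩
        rw [h5] at h6
        refine ⟨h6.symm, ?_⟩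
        rw [← h6] at h1
        omega
      · rintro ⟨rfl, rfl⟩
        rfl
    have happ := segment_append (L := L) l [e] i
    rw [h20]
    by_cases hik : L.off i + k = L.off (L.gen e) + (segment L l (L.gen e)).length
    · obtain ⟨rfl, rfl⟩ := hpos.1 hik
      rw [Function.update_self]
      simp [segment]
    · rw [Function.update_of_ne hik]
      have hk' : k < (segment L l i).length := by
        rw [hpos] at hik
        rw [hlen] at hk
        split_ifs at hk <;> omega
      rw [h.seg i k hk']
      simp only [happ, List.getElem_append_left hk']

end

end OrbitEquivalence

namespace OrbitEquivalence

/-! ### The program for the canonical order -/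

/-- Appends all entries for the point in register 22 to the queue and the segments. -/
def activate : Prog :=
  block [.load 23 17 22, .whileLt 3 23 (block [.sub 24 23 4, .load 25 14 24, .load 26 21 25,
    .store 20 26 24, .add 26 26 4, .store 21 25 26, .store 23 21 24, .add 21 21 4,
    .load 23 18 24])]

/-- Traverses the cycle of a generator from the entry in register 30 on. -/
def walkCycle : Prog :=
  block [.load 31 4 30, .const 32 0, .whileLt 32 4 (block [.store 19 30 4, .load 33 15 30,
    .load 22 4 33, .load 34 8 22,
    .ifLt 34 22 .skip (.ifLt 22 34 .skip
      (block [.load 35 8 31, .store 8 22 35, .store 8 31 22, activate])),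
    .move 30 33, .move 31 22, .load 32 19 30])]

/-- Traverses the cycles of the pending entries of the generator in register 40. -/
def overlapGenerator : Prog :=
  block [.load 41 22 40, .load 42 21 40, .whileLt 41 42 (block [.load 30 20 41, .add 41 41 4,
    .store 22 40 41, .load 43 19 30, .ifLt 43 4 walkCycle .skip, .load 42 21 40])]

section
variable {n m E : ℕ} {s : Fin m → Equiv.Perm (Fin n)} {L : Listing s E}
  {c d₀ d : Equiv.Perm (Fin n)} {W : ℕ} {σ : State} {t : ℕ} {Q : State → ℕ → Prop}
  {l : List (Fin E)} {D : Finset (Fin E)} {i : Fin m}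

theorem Context.setReg (h : Context L σ) {r v : ℕ} (hr : 6 < r) : Context L (σ.setReg r v) := by
  refine ⟨?_, ?_, ?_, ?_, ?_, ?_, h.mul, ⟨h.stored.off, h.stored.pt, h.stored.img⟩⟩
  all_goals rw [State.reg_setReg, if_neg (by omega)]
  exacts [h.reg0, h.reg2, h.reg3, h.reg4, h.reg5, h.reg6]

/-- The chain of entries for `y` is followed downwards: the entries from `b` on are in `l'`, and
register 23 points to the last one before `b`. The time is charged to the entries appended. -/
theorem wp_activate (hW : n + E + m + 2 ≤ W) (hC : Context L σ) (hlink : Linked L σ)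
    (hchain : Chained L σ) (hq : Queued L l σ) {y : Fin n} (hy : σ.reg 22 = y)
    (hl : ∀ e ∈ l, L.pt e ≠ y)
    (hQ : ∀ σ' t' l', Frame activate σ σ' → Queued L (l ++ l') σ' → (∀ e, e ∈ l' ↔ L.pt e = y) →
      t' ≤ t + 10 * l'.length + 2 → Q σ' t') :
    wp W activate Q σ t := by
  apply wp.frame
  simp only [activate, wp_block_cons, wp_block_singleton, wp_load]
  have hlen : ∀ {σ' l'}, Queued L (l ++ l') σ' → l'.length ≤ E := fun h => by
    have := h.length_le
    rw [List.length_append] at this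
    omega
  refine wp_while (fun σ' t' => ∃ l' b, Queued L (l ++ l') σ' ∧ (∀ e ∈ l', L.pt e = y) ∧
    IsLastEntry L y b (σ'.reg 23) ∧ (∀ e, L.pt e = y → b ≤ e → e ∈ l') ∧ (∀ e ∈ l', b ≤ (e : ℕ)) ∧
    t' ≤ t + 1 + 10 * l'.length) (t + 1 + 10 * E) ?_ ?_ ?_ ?_
  · refine ⟨[], E, ?_, by simp, ?_, fun e _ he => absurd e.2 (not_lt.2 he), by simp, by simp⟩
    · rw [List.append_nil]
      exact ⟨hq.nodup, by simp [hq.tail], by simpa using hq.queue, by simpa using hq.segEnd,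
        by simpa using hq.seg⟩
    · simp [hy]
      exact hchain.head y
  · rintro σ' t' - ⟨l', b, h1, -, -, -, -, ht⟩
    have := hlen h1
    omega
  · rintro σ1 t1 hF ⟨l', b, h1, h2, h3, h4, h5, ht⟩ hlt
    have r3 : σ1.reg 3 = 0 := by rw [hF.reg 3 rfl]; simp [hC.reg3]
    have r4 : σ1.reg 4 = 1 := by rw [hF.reg 4 rfl]; simp [hC.reg4]
    have a14 : σ1.arr 14 = σ.arr 14 := by rw [hF.arr 14 rfl]; simp
    have a18 : σ1.arr 18 = σ.arr 18 := by rw [hF.arr 18 rfl]; simp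
    obtain ⟨f, hf1, hf2, hf3⟩ := h3.2 (by omega)
    have hfl : f ∉ l ++ l' := by
      rw [List.mem_append, not_or]
      exact ⟨fun h => hl f h hf3, fun h => absurd hf1 (not_lt.2 (h5 f h))⟩
    have hle := h1.length_le
    have hseg := off_add_length_segment_le (L := L) h1.nodup (L.gen f)
    have hoE := L.off_le_card (i := L.gen f + 1) (L.gen f).2
    simp [← hf2, r4, a14, a18, hlink.gen, h1.segEnd, h1.tail, -exists_and_left, -exists_and_right]
    simp at hle
    refine ⟨by omega, by omega, l' ++ [f], f, ?_, ?_, ?_, ?_, ?_, by simp; omega⟩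
    · rw [← List.append_assoc]
      apply h1.push hfl <;> simp
    · intro e he
      rcases List.mem_append.1 he with he | he
      · exact h2 e he
      · rw [List.mem_singleton.1 he, hf3]
    · rw [← hf3]
      exact hchain.prev f
    · intro e he hfe
      rw [List.mem_append, List.mem_singleton]
      by_cases hbe : b ≤ (e : ℕ)
      · exact Or.inl (h4 e he hbe)
      · have := h3.1 e (not_le.1 hbe) he
        exact Or.inr (Fin.ext (by omega))
    · intro e he
      rcases List.mem_append.1 he with he | he
      · exact hf1.le.trans (h5 e he)
      · rw [List.mem_singleton.1 he]
  · rintro σ1 t1 hF ⟨l', b, h1, h2, h3, h4, h5, ht⟩ hle hF'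
    have r3 : σ1.reg 3 = 0 := by rw [hF.reg 3 rfl]; simp [hC.reg3]
    refine hQ _ _ l' hF' h1 (fun e => ⟨h2 e, fun he => h4 e he ?_⟩) (by omega)
    by_contra hbe
    have := h3.1 e (not_le.1 hbe) he
    omega

/-- The state of the computation of the canonical order: the present permutation `d`, the
list `l` of entries for points moved by `d`, and the set `D` of entries on treated cycles. -/
structure OverlapState (L : Listing s E) (c d : Equiv.Perm (Fin n)) (l : List (Fin E))
    (D : Finset (Fin E)) (σ : State) : Prop where
  queued : Queued L l σ
  succ : Stores σ 8 d
  marks : ∀ e : Fin E, σ.arr 19 e = if e ∈ D then 1 else 0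
  mem_iff : ∀ e, e ∈ l ↔ d (L.pt e) ≠ L.pt e
  subset : ∀ e ∈ D, e ∈ l
  unique : HasUniqueCycles s d
  grows : ∀ x, c x ≠ x → d x ≠ x

theorem Queued.congr {σ' : State} (h : Queued L l σ) (h21 : σ'.reg 21 = σ.reg 21)
    (a20 : σ'.arr 20 = σ.arr 20) (a21 : σ'.arr 21 = σ.arr 21) (a23 : σ'.arr 23 = σ.arr 23) :
    Queued L l σ' :=
  ⟨h.nodup, by rw [h21, h.tail], by rw [a23]; exact h.queue, by rw [a21]; exact h.segEnd,
    by rw [a20]; exact h.seg⟩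

theorem OverlapState.congr {σ' : State} (h : OverlapState L c d l D σ)
    (h21 : σ'.reg 21 = σ.reg 21) (a8 : σ'.arr 8 = σ.arr 8) (a19 : σ'.arr 19 = σ.arr 19)
    (a20 : σ'.arr 20 = σ.arr 20) (a21 : σ'.arr 21 = σ.arr 21) (a23 : σ'.arr 23 = σ.arr 23) :
    OverlapState L c d l D σ' :=
  ⟨h.queued.congr h21 a20 a21 a23, fun x => by rw [a8]; exact h.succ x,
    by rw [a19]; exact h.marks, h.mem_iff, h.subset, h.unique, h.grows⟩

theorem OverlapState.length_le (h : OverlapState L c d l D σ) : l.length ≤ E := h.queued.length_le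

theorem card_le_card (D : Finset (Fin E)) : D.card ≤ E := by simpa using D.card_le_univ

theorem Linked.of_frame {P : Prog} {σ' : State} (h : Linked L σ) (hF : Frame P σ σ')
    (h14 : P.writesArr 14 = false := by rfl) (h15 : P.writesArr 15 = false := by rfl) :
    Linked L σ' := ⟨by rw [hF.arr 14 h14]; exact h.gen, by rw [hF.arr 15 h15]; exact h.nxt⟩

theorem Chained.of_frame {P : Prog} {σ' : State} (h : Chained L σ) (hF : Frame P σ σ')
    (h17 : P.writesArr 17 = false := by rfl) (h18 : P.writesArr 18 = false := by rfl) :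
    Chained L σ' := ⟨by rw [hF.arr 17 h17]; exact h.head, by rw [hF.arr 18 h18]; exact h.prev⟩

/-- Each newly queued and each newly marked entry pays 30 steps; the bound is written additively to
avoid subtraction. A point inserted during the walk lies on the cycle being walked, so its entry for
`s i` gets marked too. Hence entries of `s i` still pending afterwards belong to points moved by
`d₀`. -/
theorem wp_walkCycle (hW : n + E + m + 2 ≤ W) (hC : Context L σ) (hlink : Linked L σ)
    (hchain : Chained L σ) (hS : OverlapState L c d l D σ) (hP : PartialOverlap L i d₀ d D)
    (hD : ∀ e, L.nxt e ∈ D ↔ e ∈ D) {e₀ : Fin E} (hi : L.gen e₀ = i) (h30 : σ.reg 30 = e₀)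
    (he₀ : e₀ ∈ l) (he₀' : e₀ ∉ D) (hpend : ∀ e ∈ l, L.gen e = i → e ∉ D → d₀ (L.pt e) ≠ L.pt e)
    (hQ : ∀ σ' t' d' l' D', Frame walkCycle σ σ' → OverlapState L c d' (l ++ l') D' σ' →
      PartialOverlap L i d₀ d' D' → (∀ e, L.nxt e ∈ D' ↔ e ∈ D') → D ⊆ D' → e₀ ∈ D' →
      (∀ e ∈ l ++ l', L.gen e = i → e ∉ D' → d₀ (L.pt e) ≠ L.pt e) →
      t' + 30 * D.card ≤ t + 3 + 30 * (l'.length + D'.card) → Q σ' t') :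
    wp W walkCycle Q σ t := by
  apply wp.frame
  simp only [walkCycle, wp_block_cons, wp_block_singleton, wp_load, wp_const]
  refine ⟨by omega, ?_⟩
  have h00 := hpend e₀ he₀ hi he₀'
  have hpt0 := hC.stored.pt e₀
  refine wp_while (fun σ' t' => ∃ d' l' D' e, OverlapState L c d' (l ++ l') D' σ' ∧
    PartialWalk L i d₀ e₀ d' D' e ∧ D ⊆ D' ∧ e ∈ l ++ l' ∧ σ'.reg 30 = e ∧ σ'.reg 31 = L.pt e ∧
    σ'.reg 32 = (if e ∈ D' then 1 else 0) ∧ (e₀ ∈ D' ∨ e = e₀) ∧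
    (∀ f ∈ l ++ l', L.gen f = i → f ∉ D' → f = e ∨ d₀ (L.pt f) ≠ L.pt f) ∧
    t' + 30 * D.card ≤ t + 2 + 30 * (l'.length + D'.card)) (t + 2 + 60 * E) ?_ ?_ ?_ ?_
  · refine ⟨d, [], D, e₀, ?_, hP.startWalk hD hi h00 he₀', subset_rfl, by simpa using he₀,
      by simp [h30], by simp [h30, hpt0], by simp [he₀'], Or.inr rfl, ?_, by simp⟩
    · rw [List.append_nil]
      apply hS.congr <;> simp
    · intro f hf hfi hfD
      exact Or.inr (hpend f (by simpa using hf) hfi hfD)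
  · rintro σ' t' - ⟨d', l', D', e, h1, -, -, -, -, -, -, -, -, ht⟩
    have h2 := h1.length_le
    have h3 := card_le_card D'
    rw [List.length_append] at h2
    omega
  · rintro σ1 t1 hF ⟨d', l', D', e, h1, h2, h3, h4, h5, h6, h7, h8, h9, ht⟩ hlt
    have hC0 : Context L ((σ.setReg 31 (σ.arr 4 (σ.reg 30))).setReg 32 0) :=
      (hC.setReg (by omega)).setReg (by omega)
    have hC1 : Context L σ1 := hC0.of_frame hF
    have hlink1 : Linked L σ1 := (Linked.mk hlink.gen hlink.nxt :
      Linked L ((σ.setReg 31 (σ.arr 4 (σ.reg 30))).setReg 32 0)).of_frame hF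
    have hchain1 : Chained L σ1 := (Chained.mk hchain.head hchain.prev :
      Chained L ((σ.setReg 31 (σ.arr 4 (σ.reg 30))).setReg 32 0)).of_frame hF
    have heD : e ∉ D' := by
      intro h
      rw [if_pos h] at h7
      rw [h7, hC1.reg4] at hlt
      omega
    have hx := (h1.mem_iff e).1 h4
    have hcard : (insert e D').card = D'.card + 1 := Finset.card_insert_of_notMem heD
    have hmark : ∀ f : Fin E, Function.update (σ1.arr 19) e 1 f =
        if f ∈ insert e D' then 1 else 0 := by
      intro f
      by_cases hfe : f = e
      · subst hfe; simp
      · rw [Function.update_of_ne (fun h => hfe (Fin.ext h)), h1.marks f]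
        simp [hfe]
    have hDe : D ⊆ insert e D' := h3.trans (Finset.subset_insert _ _)
    have hor : e₀ ∈ insert e D' ∨ L.nxt e = e₀ := by
      rcases h8 with h | rfl
      · exact Or.inl (Finset.mem_insert_of_mem h)
      · exact Or.inl (Finset.mem_insert_self _ _)
    simp [hC1.reg4, h5, hlink1.nxt, hC1.stored.pt, h1.succ (L.pt (L.nxt e)), h6,
      -exists_and_left, -exists_and_right]
    -- Inequality is tested by two strict comparisons; both positive outcomes continue in this way
    -- and differ only in time.
    have hskip : d' (L.pt (L.nxt e)) ≠ L.pt (L.nxt e) →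
        (∃ d'' l'' D'' e', OverlapState L c d'' (l ++ l'') D''
          (((((((((σ1.setArr 19 e 1).setReg 33 (L.nxt e)).setReg 22 (L.pt (L.nxt e))).setReg 34
            (d' (L.pt (L.nxt e))))).setReg 30 (L.nxt e)).setReg 31 (L.pt (L.nxt e))).setReg 32
            (Function.update (σ1.arr 19) e 1 (L.nxt e)))) ∧
        PartialWalk L i d₀ e₀ d'' D'' e' ∧ D ⊆ D'' ∧ (e' ∈ l ∨ e' ∈ l'') ∧
        (L.nxt e : ℕ) = e' ∧ (L.pt (L.nxt e) : ℕ) = L.pt e' ∧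
        Function.update (σ1.arr 19) e 1 (L.nxt e) = (if e' ∈ D'' then 1 else 0) ∧
        (e₀ ∈ D'' ∨ e' = e₀) ∧
        (∀ f, f ∈ l ∨ f ∈ l'' → L.gen f = i → f ∉ D'' → f = e' ∨ ¬ d₀ (L.pt f) = L.pt f) ∧
        t1 + 17 + 30 * D.card ≤ t + 2 + 30 * (l''.length + D''.card)) := by
      intro hne
      refine ⟨d', l', insert e D', L.nxt e, ⟨?_, ?_, ?_, h1.mem_iff, ?_, h1.unique, h1.grows⟩,
        h2.skip heD hne, hDe, by simpa using (h1.mem_iff _).2 hne, rfl, rfl, hmark _, hor, ?_, ?_⟩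
      · apply h1.queued.congr <;> simp
      · intro x; simpa using h1.succ x
      · simpa using hmark
      · intro f hf
        rcases Finset.mem_insert.1 hf with rfl | hf
        · exact h4
        · exact h1.subset f hf
      · intro f hf hfi hfD
        rw [Finset.mem_insert, not_or] at hfD
        exact Or.inr ((h9 f (by simpa using hf) hfi hfD.2).resolve_left hfD.1)
      · rw [hcard]; omega
    refine ⟨fun hlt => ?_, fun hle => ⟨fun hlt => ?_, fun hle' => ?_⟩⟩
    · obtain ⟨d'', l'', D'', e', g1, g2, g3, g4, g5, g6, g7, g8, g9, g10⟩ := hskip hlt.ne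
      exact ⟨d'', l'', D'', e', g1, g2, g3, g4, g5, g6, g7, g8, g9, by omega⟩
    · obtain ⟨d'', l'', D'', e', g1, g2, g3, g4, g5, g6, g7, g8, g9, g10⟩ := hskip hlt.ne'
      exact ⟨d'', l'', D'', e', g1, g2, g3, g4, g5, g6, g7, g8, g9, by omega⟩
    · have hy : d' (L.pt (L.nxt e)) = L.pt (L.nxt e) := le_antisymm hle' hle
      have hxy : L.pt (L.nxt e) ∈ MulAction.orbit (group s) (L.pt e) := by
        rw [L.pt_nxt]; exact apply_mem_orbit s _ _
      have hyl : ∀ f ∈ l ++ l', L.pt f ≠ L.pt (L.nxt e) := fun f hf h => by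
        have := (h1.mem_iff f).1 hf
        rw [h] at this
        exact this hy
      refine wp_activate (l := l ++ l') (y := L.pt (L.nxt e)) hW ?_ ?_ ?_ ?_ (by simp) hyl ?_
      · exact ⟨by simp [hC1.reg0], by simp [hC1.reg2], by simp [hC1.reg3], by simp [hC1.reg4],
          by simp [hC1.reg5], by simp [hC1.reg6], by simpa using hC1.mul,
          ⟨by simpa using hC1.stored.off, by simpa using hC1.stored.pt,
            by simpa using hC1.stored.img⟩⟩
      · exact ⟨by simpa using hlink1.gen, by simpa using hlink1.nxt⟩
      · exact ⟨by simpa using hchain1.head, by simpa using hchain1.prev⟩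
      · apply h1.queued.congr <;> simp
      · intro σ2 t2 l'' hF2 hq hl'' ht2
        have a19 : σ2.arr 19 = Function.update (σ1.arr 19) e 1 := by rw [hF2.arr 19 rfl]; simp
        have a8 : σ2.arr 8 = _ := hF2.arr 8 rfl
        have r33 : σ2.reg 33 = L.nxt e := by rw [hF2.reg 33 rfl]; simp
        have r22 : σ2.reg 22 = L.pt (L.nxt e) := by rw [hF2.reg 22 rfl]; simp
        have hmem : ∀ f, f ∈ l ++ (l' ++ l'') ↔
            (d' * Equiv.swap (L.pt e) (L.pt (L.nxt e))) (L.pt f) ≠ L.pt f := by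
          intro f
          rw [mul_swap_apply_ne_iff hx hy, ← h1.mem_iff, ← List.append_assoc, List.mem_append,
            hl'']
        simp [r33, r22, a19, -exists_and_left, -exists_and_right]
        refine ⟨d' * Equiv.swap (L.pt e) (L.pt (L.nxt e)), l' ++ l'', insert e D', L.nxt e,
          ⟨?_, ?_, ?_, hmem, ?_, h1.unique.mul_swap hx hy hxy, ?_⟩,
          h2.insert heD (fun f hf => (h1.mem_iff f).1 (h1.subset f hf)) hx hy, hDe, ?_, rfl, rfl,
          hmark _, hor, ?_, ?_⟩
        · rw [← List.append_assoc]
          apply hq.congr <;> simp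
        · intro x
          have hne : (L.pt e : ℕ) ≠ L.pt (L.nxt e) := fun h => L.pt_nxt_ne e (Fin.ext h.symm)
          rw [mul_swap_apply]
          simp [a8]
          by_cases hxe : x = L.pt e
          · subst hxe
            simp [hy]
          by_cases hxn : x = L.pt (L.nxt e)
          · subst hxn
            rw [Function.update_of_ne hne.symm]
            simp [L.pt_nxt_ne e, h1.succ (L.pt e)]
          · rw [Function.update_of_ne (fun h => hxe (Fin.ext h)),
              Function.update_of_ne (fun h => hxn (Fin.ext h)), h1.succ x, if_neg hxe, if_neg hxn]
        · simpa [a19] using hmark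
        · intro f hf
          rw [← List.append_assoc]
          refine List.mem_append_left _ ?_
          rcases Finset.mem_insert.1 hf with rfl | hf
          · exact h4
          · exact h1.subset f hf
        · intro x hx'
          rw [mul_swap_apply_ne_iff hx hy]
          exact Or.inl (h1.grows x hx')
        · exact Or.inr (List.mem_append_right _ ((hl'' _).2 rfl))
        · intro f hf hfi hfD
          rw [Finset.mem_insert, not_or] at hfD
          rw [List.mem_append, ← or_assoc, ← List.mem_append] at hf
          rcases hf with hf | hf
          · exact Or.inr ((h9 f hf hfi hfD.2).resolve_left hfD.1)
          -- A newly queued entry belongs to the inserted point. If its generator is `s i`, it is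
          -- the entry visited next.
          · refine Or.inl (L.inj _ _ ?_ ((hl'' f).1 hf))
            rw [hfi, L.gen_nxt, h2.gen]
        · rw [hcard, List.length_append]
          omega
  · rintro σ1 t1 hF ⟨d', l', D', e, h1, h2, h3, h4, h5, h6, h7, h8, h9, ht⟩ hle hF'
    have r4 : σ1.reg 4 = 1 := by rw [hF.reg 4 rfl]; simp [hC.reg4]
    have heD : e ∈ D' := by
      by_contra h
      rw [if_neg h] at h7
      omega
    refine hQ _ _ d' l' D' hF' h1 (h2.partialOverlap heD) (h2.closed heD) h3 (h2.eq_start heD ▸ heD)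
      (fun f hf hfi hfD => (h9 f hf hfi hfD).resolve_left fun h => hfD (h ▸ heD)) (by omega)

end

end OrbitEquivalence

/-! ### Overlapping generator by generator until no entry is pending -/

namespace OrbitEquivalence

section
variable {n m E : ℕ} {s : Fin m → Equiv.Perm (Fin n)} {L : Listing s E}
  {c d₀ d : Equiv.Perm (Fin n)} {W : ℕ} {σ : State} {t : ℕ} {Q : State → ℕ → Prop}
  {l : List (Fin E)} {D : Finset (Fin E)} {i : Fin m} {pr : Fin m → ℕ}

/-- The first `pr i` entries of the segment of each generator have been treated. -/
structure Processed (L : Listing s E) (l : List (Fin E)) (D : Finset (Fin E)) (pr : Fin m → ℕ)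
    (σ : State) : Prop where
  ptr : ∀ i : Fin m, σ.arr 22 i = L.off i + pr i
  le : ∀ i, pr i ≤ (segment L l i).length
  done : ∀ i k (h : k < (segment L l i).length), k < pr i → (segment L l i)[k] ∈ D

theorem Processed.sum_le (h : Processed L l D pr σ) : ∑ i, pr i ≤ l.length := by
  rw [← sum_length_segment (L := L) l]
  exact Finset.sum_le_sum fun i _ => h.le i

theorem Processed.mono {l' : List (Fin E)} {D' : Finset (Fin E)} {σ' : State}
    (h : Processed L l D pr σ) (hD : D ⊆ D') (h22 : σ'.arr 22 = σ.arr 22) :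
    Processed L (l ++ l') D' pr σ' := by
  refine ⟨by rw [h22]; exact h.ptr, fun i => ?_, fun i k hk hkp => ?_⟩
  · rw [segment_append, List.length_append]
    exact (h.le i).trans (Nat.le_add_right _ _)
  · have hk' := hkp.trans_le (h.le i)
    simp only [segment_append, List.getElem_append_left hk']
    exact hD (h.done i k hk' hkp)

theorem sum_succ (pr : Fin m → ℕ) (i : Fin m) :
    ∑ j, (pr j + if j = i then 1 else 0) = ∑ j, pr j + 1 := by
  simp [Finset.sum_add_distrib]

/-- The argument `d` of the overlap stays that of the beginning, so all the walks together form a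
single overlap with `s i`. The end of the segment is reread in each round, hence entries arriving
meanwhile are covered as well. Advancing the pointer of a segment pays 20 steps; queued, marked and
passed entries number at most `E` each, which gives `80 * E`. -/
theorem wp_overlapGenerator (hW : n + E + m + 2 ≤ W) (hC : Context L σ) (hlink : Linked L σ)
    (hchain : Chained L σ) (hS : OverlapState L c d l D σ)
    (hD : ∀ e, L.nxt e ∈ D ↔ e ∈ D) (hP : Processed L l D pr σ) (h40 : σ.reg 40 = i)
    (hQ : ∀ σ' t' d' l' D' pr', Frame overlapGenerator σ σ' →
      OverlapState L c d' (l ++ l') D' σ' →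
      (∀ e, L.nxt e ∈ D' ↔ e ∈ D') → Processed L (l ++ l') D' pr' σ' → D ⊆ D' →
      (∀ e ∈ l ++ l', L.gen e = i → e ∈ D') → IsOverlap d (s i) d' →
      t' + 30 * D.card + 20 * ∑ j, pr j ≤
        t + 3 + 30 * (l'.length + D'.card) + 20 * ∑ j, pr' j → Q σ' t') :
    wp W overlapGenerator Q σ t := by
  apply wp.frame
  simp only [overlapGenerator, wp_block_cons, wp_block_singleton, wp_load]
  refine wp_while (fun σ' t' => ∃ d' l' D' pr', OverlapState L c d' (l ++ l') D' σ' ∧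
    (∀ e, L.nxt e ∈ D' ↔ e ∈ D') ∧ PartialOverlap L i d d' D' ∧
    Processed L (l ++ l') D' pr' σ' ∧ D ⊆ D' ∧
    (∀ e ∈ l ++ l', L.gen e = i → e ∉ D' → d (L.pt e) ≠ L.pt e) ∧
    σ'.reg 41 = L.off i + pr' i ∧ σ'.reg 42 = L.off i + (segment L (l ++ l') i).length ∧
    t' + 30 * D.card + 20 * ∑ j, pr j ≤
      t + 2 + 30 * (l'.length + D'.card) + 20 * ∑ j, pr' j) (t + 2 + 80 * E) ?_ ?_ ?_ ?_
  · refine ⟨d, [], D, pr, ?_, hD, .init hD fun e he => (hS.mem_iff e).1 (hS.subset e he), ?_,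
      subset_rfl, ?_, ?_, ?_, ?_⟩
    · rw [List.append_nil]
      apply hS.congr <;> simp
    · exact hP.mono subset_rfl (by simp)
    · intro e he _ _
      exact (hS.mem_iff e).1 (by simpa using he)
    · simp [h40, hP.ptr]
    · simp [h40, hS.queued.segEnd]
    · simp
  · rintro σ1 t1 - ⟨d', l', D', pr', h1, -, -, h2, -, -, -, -, ht⟩
    have h3 := h1.length_le
    have h4 := card_le_card D'
    have h5 := h2.sum_le
    rw [List.length_append] at h3 h5
    omega
  · rintro σ1 t1 hF ⟨d', l', D', pr', h1, h2, h3, h4, h5, h6, h7, h8, ht⟩ hlt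
    have hC1 : Context L σ1 := Context.of_frame
      (σ := (σ.setReg 41 (σ.arr 22 (σ.reg 40))).setReg 42 (σ.arr 21 (σ.reg 40)))
      ((hC.setReg (by omega)).setReg (by omega)) hF
    have hlink1 : Linked L σ1 := Linked.of_frame
      (σ := (σ.setReg 41 (σ.arr 22 (σ.reg 40))).setReg 42 (σ.arr 21 (σ.reg 40)))
      ⟨hlink.gen, hlink.nxt⟩ hF
    have hchain1 : Chained L σ1 := Chained.of_frame
      (σ := (σ.setReg 41 (σ.arr 22 (σ.reg 40))).setReg 42 (σ.arr 21 (σ.reg 40)))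
      ⟨hchain.head, hchain.prev⟩ hF
    have r40 : σ1.reg 40 = i := by rw [hF.reg 40 rfl]; simp [h40]
    have hk : pr' i < (segment L (l ++ l') i).length := by omega
    obtain ⟨e, he⟩ : ∃ e, e = (segment L (l ++ l') i)[pr' i] := ⟨_, rfl⟩
    have hseg := h1.queued.seg i (pr' i) hk
    rw [← he] at hseg
    have hmem : e ∈ segment L (l ++ l') i := by rw [he]; exact List.getElem_mem _
    rw [mem_segment] at hmem
    have hoff := off_add_length_segment_le (L := L) h1.queued.nodup i
    have hoE := L.off_le_card (i := i + 1) i.2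
    have hptr : ∀ D'' : Finset (Fin E), D' ⊆ D'' → e ∈ D'' → ∀ σ2 : State,
        σ2.arr 22 = Function.update (σ1.arr 22) i (L.off i + pr' i + 1) →
        Processed L (l ++ l') D'' (fun j => pr' j + if j = i then 1 else 0) σ2 := by
      intro D'' hD'' heD'' σ2 h22
      refine ⟨fun j => ?_, fun j => ?_, fun j k hk' hkj => ?_⟩
      · rw [h22]
        by_cases hj : j = i
        · subst hj; simp [add_assoc]
        · rw [Function.update_of_ne (fun h => hj (Fin.ext h)), h4.ptr j]
          simp [hj]
      · by_cases hj : j = i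
        · subst hj; simp; omega
        · simp [hj, h4.le j]
      · by_cases hj : j = i
        · subst hj
          simp at hkj
          rcases hkj.lt_or_eq with hkj | rfl
          · exact hD'' (h4.done j k hk' (by omega))
          · rw [← he]; exact heD''
        · simp [hj] at hkj
          exact hD'' (h4.done j k hk' hkj)
    simp [h7, hC1.reg4, r40, hseg, h1.marks, -exists_and_left, -exists_and_right]
    refine ⟨by omega, fun heD => ?_, fun heD => ?_⟩
    · refine wp_walkCycle (c := c) (l := l ++ l') (D := D') hW ?_ ?_ ?_ (d := d') ?_ h3 h2 hmem.2
        (by simp) hmem.1 heD h6 ?_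
      · exact ⟨by simp [hC1.reg0], by simp [hC1.reg2], by simp [hC1.reg3], by simp [hC1.reg4],
          by simp [hC1.reg5], by simp [hC1.reg6], by simpa using hC1.mul,
          ⟨by simpa using hC1.stored.off, by simpa using hC1.stored.pt,
            by simpa using hC1.stored.img⟩⟩
      · exact ⟨by simpa using hlink1.gen, by simpa using hlink1.nxt⟩
      · exact ⟨by simpa using hchain1.head, by simpa using hchain1.prev⟩
      · apply h1.congr <;> simp
      · intro σ2 t2 d'' l'' D'' hF2 g1 g2 g3 g4 g5 g6 ht2
        have r40' : σ2.reg 40 = i := by rw [hF2.reg 40 rfl]; simp [r40]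
        have r41' : σ2.reg 41 = L.off i + pr' i + 1 := by rw [hF2.reg 41 rfl]; simp
        have a22 : σ2.arr 22 = Function.update (σ1.arr 22) i (L.off i + pr' i + 1) := by
          rw [hF2.arr 22 rfl]; simp
        rw [List.append_assoc] at g1 g6
        simp [r40', r41', g1.queued.segEnd, -exists_and_left, -exists_and_right]
        refine ⟨d'', l' ++ l'', D'', fun j => pr' j + if j = i then 1 else 0, ?_, g3, g2, ?_,
          h5.trans g4, by simpa using g6, by simp [add_assoc], by simp, ?_⟩
        · apply g1.congr <;> simp
        · rw [← List.append_assoc]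
          exact (hptr D'' g4 g5 σ2 a22).mono subset_rfl (by simp)
        · rw [sum_succ, List.length_append]
          omega
    · replace heD : e ∈ D' := by
        by_contra h
        simp [h] at heD
      refine ⟨d', l', D', fun j => pr' j + if j = i then 1 else 0, ?_, h2, h3, ?_, h5,
        by simpa using h6, by simp [add_assoc], by simp [h1.queued.segEnd], ?_⟩
      · apply h1.congr <;> simp
      · have := (hptr D' subset_rfl heD ((σ1.setArr 22 i (L.off i + pr' i + 1))) (by simp)).mono
          (l' := []) (σ' := ((((σ1.setReg 30 e).setReg 41 (L.off i + pr' i + 1)).setArr 22 i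
            (L.off i + pr' i + 1)).setReg 43 1).setReg 42 (σ1.arr 21 i)) subset_rfl (by simp)
        rw [List.append_nil] at this
        exact ⟨by simpa using this.ptr, this.le, this.done⟩
      · rw [sum_succ]
        omega
  · rintro σ1 t1 hF ⟨d', l', D', pr', h1, h2, h3, h4, h5, h6, h7, h8, ht⟩ hle hF'
    have hall : ∀ e ∈ l ++ l', L.gen e = i → e ∈ D' := by
      intro e he hi
      obtain ⟨k, hk, rfl⟩ := List.getElem_of_mem (mem_segment (L := L).2 ⟨he, hi⟩)
      exact h4.done i k hk (by omega)
    exact hQ _ _ d' l' D' pr' hF' h1 h2 h4 h5 hall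
      (h3.isOverlap h2 fun e hi he =>
        hall e (List.mem_append_left _ ((hS.mem_iff e).2 he)) hi) (by omega)

/-- Overlaps with generators as long as there are pending entries. -/
def overlapLoop : Prog :=
  .whileLt 20 21 (block [.load 44 23 20, .load 40 14 44, .add 20 20 4, overlapGenerator])

/-- The generator of an unmarked queued entry still occurs in the queue at or behind the head, since
a call at the head marks all queued entries of its generator. So at the end all are marked, and the
moved points are closed under the generators. A call with nothing pending is paid for by the advance
of the head, which brings the total to `100 * E`. -/
theorem wp_overlapLoop (hW : n + E + m + 2 ≤ W) (hc : IsInvariantUniqueCycles s c)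
    (hC : Context L σ) (hlink : Linked L σ)
    (hchain : Chained L σ) (hS : OverlapState L c c l ∅ σ)
    (hP : Processed L l ∅ (fun _ => 0) σ) (h20 : σ.reg 20 = 0)
    (hQ : ∀ σ' t' (d : Equiv.Perm (Fin n)), Frame overlapLoop σ σ' → Stores σ' 8 d →
      IsCanonicalOrder s c d →
      t' ≤ t + 100 * E + 1 → Q σ' t') :
    wp W overlapLoop Q σ t := by
  apply wp.frame
  refine wp_while (fun σ' t' => ∃ d l D pr hd, OverlapState L c d l D σ' ∧
    (∀ e, L.nxt e ∈ D ↔ e ∈ D) ∧ Processed L l D pr σ' ∧ σ'.reg 20 = hd ∧ hd ≤ l.length ∧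
    Relation.ReflTransGen (fun e e' => ∃ i, IsOverlap e (s i) e') c d ∧
    (∀ e ∈ l, e ∉ D → ∃ q, ∃ h : q < l.length, hd ≤ q ∧ L.gen l[q] = L.gen e) ∧
    t' ≤ t + 30 * (l.length + D.card) + 20 * ∑ j, pr j + 20 * hd) (t + 100 * E) ?_ ?_ ?_ ?_
  · refine ⟨c, l, ∅, fun _ => 0, 0, hS, by simp, hP, h20, by simp, .refl, ?_, by omega⟩
    intro e he _
    obtain ⟨q, hq, rfl⟩ := List.getElem_of_mem he
    exact ⟨q, hq, by simp, rfl⟩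
  · rintro σ1 t1 - ⟨d, l, D, pr, hd, h1, -, h2, -, h3, -, -, ht⟩
    have h4 := h1.length_le
    have h5 := card_le_card D
    have h6 := h2.sum_le
    omega
  · rintro σ1 t1 hF ⟨d, l, D, pr, hd, h1, h2, h3, h4, h5, h6, h7, ht⟩ hlt
    have hC1 : Context L σ1 := hC.of_frame hF
    have hlink1 : Linked L σ1 := hlink.of_frame hF
    have hchain1 : Chained L σ1 := hchain.of_frame hF
    have hlt' : hd < l.length := by rw [← h1.queued.tail, ← h4]; exact hlt
    have hlE := h1.length_le
    simp [h4, h1.queued.queue hd hlt', hlink1.gen, hC1.reg4, -exists_and_left, -exists_and_right]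
    refine ⟨by omega, ?_⟩
    refine wp_overlapGenerator (c := c) (i := L.gen l[hd]) (l := l) (D := D) (d := d) (pr := pr)
      hW ?_ ?_ ?_ ?_ h2 ?_ (by simp) ?_
    · exact ((hC1.setReg (by omega)).setReg (by omega)).setReg (by omega)
    · exact ⟨hlink1.gen, hlink1.nxt⟩
    · exact ⟨hchain1.head, hchain1.prev⟩
    · apply h1.congr <;> simp
    · exact ⟨by simpa using h3.ptr, h3.le, h3.done⟩
    · intro σ2 t2 d' l' D' pr' hF2 g1 g2 g3 g4 g5 g6 ht2
      have r20 : σ2.reg 20 = hd + 1 := by rw [hF2.reg 20 rfl]; simp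
      refine ⟨d', l ++ l', D', pr', g1, g2, g3, by rw [List.length_append]; omega,
        h6.tail ⟨_, g6⟩, ?_, ?_⟩
      · intro e he heD
        have hne : L.gen e ≠ L.gen l[hd] := fun h => heD (g5 e he h)
        by_cases hel : e ∈ l
        · obtain ⟨q, hq, hq1, hq2⟩ := h7 e hel fun h => heD (g4 h)
          refine ⟨q, by rw [List.length_append]; omega, ?_, ?_⟩
          · rw [r20]
            refine Nat.succ_le_of_lt (hq1.lt_of_ne ?_)
            rintro rfl
            exact hne hq2.symm
          · rw [List.getElem_append_left hq, hq2]
        · have hel' : e ∈ l' := (List.mem_append.1 he).resolve_left hel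
          obtain ⟨q, hq, rfl⟩ := List.getElem_of_mem hel'
          refine ⟨l.length + q, by rw [List.length_append]; omega, by omega, ?_⟩
          simp
      · rw [List.length_append]
        omega
  · rintro σ1 t1 hF ⟨d, l, D, pr, hd, h1, h2, h3, h4, h5, h6, h7, ht⟩ hle hF'
    have hlE := h1.length_le
    have hDE := card_le_card D
    have hsum := h3.sum_le
    rw [h4, h1.queued.tail] at hle
    have hall : ∀ e ∈ l, e ∈ D := by
      intro e he
      by_contra heD
      obtain ⟨q, hq, hq1, -⟩ := h7 e he heD
      omega
    refine hQ _ _ d hF' h1.succ ⟨h6, h1.unique.cyclesAreOrbits hc h1.grows ?_⟩ (by omega)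
    intro i x hx
    by_cases hix : s i x = x
    · rwa [hix]
    · obtain ⟨e, rfl, rfl⟩ := L.surj i x hix
      rw [← L.pt_nxt, ← h1.mem_iff]
      exact h1.subset _ ((h2 e).2 (hall e ((h1.mem_iff e).2 hx)))

/-- Initializes the computation of the canonical order with the unique cycles. -/
def initOverlap : Prog :=
  block [.const 10 0, forLt 10 2 (block [.load 11 3 10, .store 21 10 11, .store 22 10 11]),
    .const 20 0, .const 21 0, .const 10 0, forLt 10 0 (block [.load 11 6 10, .store 8 10 11]),
    .const 22 0, forLt 22 0 (block [.load 11 8 22,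
      .ifLt 11 22 activate (.ifLt 22 11 activate .skip)])]

theorem Stores.update {σ : State} {a : ℕ} {f : Fin n → Fin n} {σ' : State} {k : ℕ} (hk : k < n)
    (h : ∀ x : Fin n, (x : ℕ) < k → σ.arr a x = f x)
    (h' : σ'.arr a = Function.update (σ.arr a) k (f ⟨k, hk⟩)) :
    ∀ x : Fin n, (x : ℕ) < k + 1 → σ'.arr a x = f x := by
  intro x hx
  rw [h']
  by_cases hxk : (x : ℕ) = k
  · obtain rfl : x = ⟨k, hk⟩ := Fin.ext hxk
    simp
  · rw [Function.update_of_ne hxk, h x (by omega)]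

theorem wp_initOverlap (hW : n + E + m + 2 ≤ W) (hc : IsInvariantUniqueCycles s c)
    (hC : Context L σ) (hlink : Linked L σ)
    (hchain : Chained L σ) (h6 : Stores σ 6 c) (h19 : ∀ k, σ.arr 19 k = 0)
    (hQ : ∀ σ' t' l, Frame initOverlap σ σ' → OverlapState L c c l ∅ σ' →
      Processed L l ∅ (fun _ => 0) σ' → σ'.reg 20 = 0 →
      t' ≤ t + 5 * m + 20 * n + 10 * E + 20 → Q σ' t') :
    wp W initOverlap Q σ t := by
  apply wp.frame
  simp only [initOverlap, wp_block_cons, wp_const]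
  refine ⟨by omega, ?_⟩
  refine wp_forLt_const (b := m) (fun k σ' => ∀ i : Fin m, (i : ℕ) < k →
    σ'.arr 21 i = L.off i ∧ σ'.arr 22 i = L.off i) 3 (by simp [hC.reg4]) (by simp [hC.reg2])
    (by omega) rfl rfl rfl (by decide) (by decide) (by simp) (by simp) ?_ ?_
  · intro k σ1 t1 hF _ hk hik h1
    have hC1 : Context L σ1 := Context.of_frame (σ := σ.setReg 10 0) (hC.setReg (by omega)) hF
    simp [hik, hC1.stored.off k hk.le]
    intro i hi
    by_cases hik : (i : ℕ) = k
    · simp [hik]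
    · rw [Function.update_of_ne hik, Function.update_of_ne hik]
      exact h1 i (by omega)
  intro σ1 t1 hF1 _ h1 ht1
  have hC1 : Context L σ1 := Context.of_frame (σ := σ.setReg 10 0) (hC.setReg (by omega)) hF1
  simp only [wp_block_cons, wp_const]
  refine ⟨by omega, by omega, by omega, ?_⟩
  refine wp_forLt_const (b := n) (fun k σ' => ∀ x : Fin n, (x : ℕ) < k →
    σ'.arr 8 x = c x) 2 (by simp [hC1.reg4]) (by simp [hC1.reg0])
    (by omega) rfl rfl rfl (by decide) (by decide) (by simp) (by simp) ?_ ?_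
  · intro k σ2 t2 hF _ hk hik h2
    have a6 : σ2.arr 6 = σ.arr 6 := by
      rw [hF.arr 6 rfl]; simp; rw [hF1.arr 6 rfl]; simp
    have h6k := h6 ⟨k, hk⟩
    simp at h6k
    simp [hik, a6, h6k]
    intro x hx
    simpa using Stores.update (σ' := σ2.setArr 8 k (c ⟨k, hk⟩)) hk h2 (by simp) x
      (Nat.lt_succ_of_le hx)
  intro σ2 t2 hF2 _ h2 ht2
  have hC2 : Context L σ2 := Context.of_frame (σ := ((σ1.setReg 20 0).setReg 21 0).setReg 10 0)
    (((hC1.setReg (by omega)).setReg (by omega)).setReg (by omega)) hF2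
  have hlink2 : Linked L σ2 := Linked.of_frame (σ := ((σ1.setReg 20 0).setReg 21 0).setReg 10 0)
    (Linked.mk (Linked.of_frame (σ := σ.setReg 10 0) ⟨hlink.gen, hlink.nxt⟩ hF1).gen
      (Linked.of_frame (σ := σ.setReg 10 0) ⟨hlink.gen, hlink.nxt⟩ hF1).nxt) hF2
  have hchain2 : Chained L σ2 := Chained.of_frame
    (σ := ((σ1.setReg 20 0).setReg 21 0).setReg 10 0)
    (Chained.mk (Chained.of_frame (σ := σ.setReg 10 0) ⟨hchain.head, hchain.prev⟩ hF1).head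
      (Chained.of_frame (σ := σ.setReg 10 0) ⟨hchain.head, hchain.prev⟩ hF1).prev) hF2
  have r20 : σ2.reg 20 = 0 := by rw [hF2.reg 20 rfl]; simp
  have r21 : σ2.reg 21 = 0 := by rw [hF2.reg 21 rfl]; simp
  have a19 : ∀ k, σ2.arr 19 k = 0 := by
    rw [hF2.arr 19 rfl]; simp; rw [hF1.arr 19 rfl]; simpa using h19
  have a21 : ∀ i : Fin m, σ2.arr 21 i = L.off i := fun i => by
    rw [hF2.arr 21 rfl]; exact (h1 i i.2).1
  have a22 : ∀ i : Fin m, σ2.arr 22 i = L.off i := fun i => by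
    rw [hF2.arr 22 rfl]; exact (h1 i i.2).2
  simp only [wp_block_cons, wp_block_singleton, wp_const]
  refine ⟨by omega, ?_⟩
  refine wp_forLt (b := n) (fun k σ' t' => ∃ l, Queued L l σ' ∧
    (∀ e, e ∈ l ↔ c (L.pt e) ≠ L.pt e ∧ (L.pt e : ℕ) < k) ∧
    t' ≤ t2 + 1 + 8 * k + 10 * l.length) (by simp [hC2.reg4]) (by simp [hC2.reg0])
    (by omega) rfl rfl rfl (by decide) (by decide) (by simp) ?_ ?_ ?_
  · refine ⟨[], ⟨by simp, by simp [r21], by simp, fun i => ?_, by simp [segment]⟩, by simp,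
      by simp⟩
    simp [segment, a21 i]
  · rintro k σ3 t3 hF _ hk hik ⟨l, h3, h4, ht3⟩
    have hC3 : Context L σ3 := Context.of_frame (σ := σ2.setReg 22 0)
      (hC2.setReg (by omega)) hF
    have hlink3 : Linked L σ3 := Linked.of_frame (σ := σ2.setReg 22 0)
      ⟨hlink2.gen, hlink2.nxt⟩ hF
    have hchain3 : Chained L σ3 := Chained.of_frame (σ := σ2.setReg 22 0)
      ⟨hchain2.head, hchain2.prev⟩ hF
    have a8 : σ3.arr 8 k = c ⟨k, hk⟩ := by
      rw [hF.arr 8 rfl]; exact h2 ⟨k, hk⟩ hk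
    -- Shared by the two comparisons that detect a point moved by `c`.
    have hact : c ⟨k, hk⟩ ≠ ⟨k, hk⟩ → ∀ t4, t4 ≤ t3 + 4 →
        wp W activate (fun σ'' t'' => ∃ l, Queued L l (σ''.setReg 22 (k + 1)) ∧
          (∀ e, e ∈ l ↔ c (L.pt e) ≠ L.pt e ∧ (L.pt e : ℕ) < k + 1) ∧
          t'' + 1 ≤ t2 + 1 + 8 * (k + 1) + 10 * l.length)
          (σ3.setReg 11 (c ⟨k, hk⟩)) t4 := by
      intro hck t4 ht4
      refine wp_activate (l := l) (y := ⟨k, hk⟩) hW (hC3.setReg (by omega))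
        ⟨hlink3.gen, hlink3.nxt⟩ ⟨hchain3.head, hchain3.prev⟩ (h3.congr ?_ ?_ ?_ ?_)
        (by simp [hik]) ?_ ?_
      any_goals simp
      · intro e he hek
        have := ((h4 e).1 he).2
        rw [hek] at this
        simp at this
      · intro σ4 t5 l' hF4 h5 h6 ht5
        refine ⟨l ++ l', ?_, ?_, ?_⟩
        · apply h5.congr <;> simp
        · intro e
          simp only [List.mem_append, h4, h6]
          constructor
          · rintro (⟨g1, g2⟩ | g)
            · exact ⟨g1, by omega⟩
            · exact ⟨by rw [g]; exact hck, by rw [g]⟩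
          · rintro ⟨g1, g2⟩
            by_cases hek : (L.pt e : ℕ) = k
            · exact Or.inr (Fin.ext hek)
            · exact Or.inl ⟨g1, by omega⟩
        · rw [List.length_append]
          omega
    simp only [wp_block_cons, wp_block_singleton, wp_load, wp_ifLt, wp_skip, State.reg_setReg, hik,
      a8, if_true]
    simp only [show (22 : ℕ) ≠ 11 from by decide, if_false]
    refine ⟨fun hlt => hact (fun h => hlt.ne (congrArg Fin.val h)) _ (by omega), fun hle =>
      ⟨fun hlt => hact (fun h => hlt.ne' (congrArg Fin.val h)) _ (by omega), fun hle' => ?_⟩⟩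
    have hck : c ⟨k, hk⟩ = ⟨k, hk⟩ := Fin.ext (le_antisymm hle' hle)
    refine ⟨l, ?_, ?_, ?_⟩
    · apply h3.congr <;> simp
    · intro e
      rw [h4]
      refine and_congr_right fun g1 => ⟨fun g => by omega, fun g => ?_⟩
      refine (Nat.le_of_lt_succ g).lt_of_ne fun hek => g1 ?_
      have : L.pt e = ⟨k, hk⟩ := Fin.ext hek
      rw [this, hck]
    · omega
  · rintro σ3 t3 hF _ ⟨l, h3, h4, ht3⟩ hF'
    have hl := h3.length_le
    simp at ht1 ht2
    refine hQ _ _ l hF' ⟨h3, ?_, ?_, fun e => by simp [h4], by simp, hc.hasUniqueCycles,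
      fun _ h => h⟩ ⟨?_, by simp, by simp⟩ ?_ (by omega)
    · intro x; rw [hF.arr 8 rfl]; exact h2 x x.2
    · intro e; rw [hF.arr 19 rfl]; simp [a19]
    · intro i; rw [hF.arr 22 rfl]; simp [a22]
    · rw [hF.reg 20 rfl]; simp [r20]

end

end OrbitEquivalence

namespace OrbitEquivalence

/-! ### Positions on the canonical cycles -/

section
variable {n m E : ℕ} {s : Fin m → Equiv.Perm (Fin n)} {L : Listing s E}
  {d : Equiv.Perm (Fin n)} {W : ℕ} {σ : State} {t : ℕ} {Q : State → ℕ → Prop}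

/-- The points of the set `V` know their position on their cycle of `d`. -/
structure PositionedOn (d : Equiv.Perm (Fin n)) (V : Finset (Fin n)) (σ : State) : Prop where
  marks : ∀ z : Fin n, σ.arr 24 z = if z ∈ V then 1 else 0
  closed : ∀ z, d z ∈ V ↔ z ∈ V
  root : ∀ z ∈ V, ∃ r ∈ V, σ.arr 25 z = (r : Fin n) ∧ (d ^ σ.arr 26 z) r = z ∧
    σ.arr 26 z < Function.minimalPeriod d r ∧ σ.arr 27 r = Function.minimalPeriod d r
  root_apply : ∀ z ∈ V, σ.arr 25 (d z) = σ.arr 25 z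

/-- Walks along the cycle through the point in register 30. -/
def walkOrbit : Prog :=
  block [.move 31 30, .const 32 0, .load 33 24 31,
    .ifLt 33 4 (block [.whileLt 33 4 (block [.store 25 31 30, .store 26 31 32, .store 24 31 4,
      .add 32 32 4, .load 31 8 31, .load 33 24 31]), .store 27 30 32]) .skip]

/-- Computes the roots, positions and lengths of the cycles in arrays 25, 26 and 27. -/
def positions : Prog :=
  block [.const 30 0, forLt 30 0 walkOrbit]

/-- A cycle of `d` lies inside `V` or avoids it. From an unmarked point, the first marked point met
is therefore the start itself, after exactly one period, and the time is charged to the points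
marked. -/
theorem wp_walkOrbit (hW : n + 1 ≤ W) {V : Finset (Fin n)} {x : Fin n} (h4 : σ.reg 4 = 1)
    (h8 : Stores σ 8 d) (hV : PositionedOn d V σ) (h30 : σ.reg 30 = x)
    (hQ : ∀ σ' t' V', Frame walkOrbit σ σ' → PositionedOn d V' σ' → V ⊆ V' → x ∈ V' →
      t' + 10 * V.card ≤ t + 10 + 10 * V'.card → Q σ' t') :
    wp W walkOrbit Q σ t := by
  apply wp.frame
  simp only [walkOrbit, wp_block_cons, wp_block_singleton, wp_load, wp_const, wp_move, wp_ifLt,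
    wp_skip]
  simp [h30, h4]
  refine ⟨fun hx => ?_, fun hx hF => ?_⟩
  swap
  · refine hQ _ _ V hF ⟨by simpa using hV.marks, hV.closed, by simpa using hV.root,
      by simpa using hV.root_apply⟩ subset_rfl ?_ (by omega)
    by_contra h
    rw [hV.marks] at hx
    simp [h] at hx
  replace hx : x ∉ V := fun h => by simp [hV.marks, h] at hx
  have hclosed : ∀ k, (d ^ k) x ∉ V := by
    intro k
    induction k with
    | zero => simpa
    | succ k ih => rwa [pow_succ', Equiv.Perm.mul_apply, hV.closed]
  have hT := minimalPeriod_le d x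
  have hTpos := minimalPeriod_pos d x
  have hinj : ∀ j k, j < k → k < Function.minimalPeriod d x → (d ^ k) x ≠ (d ^ j) x := by
    intro j k hjk hk h
    rw [pow_apply_eq_pow_apply_iff] at h
    have := Nat.ModEq.eq_of_lt_of_lt h hk (hjk.trans hk)
    omega
  refine wp_while (fun σ' t' => ∃ p, p ≤ Function.minimalPeriod d x ∧ σ'.reg 32 = p ∧
    σ'.reg 31 = (d ^ p) x ∧ σ'.reg 33 = σ'.arr 24 ((d ^ p) x) ∧
    (∀ z : Fin n, σ'.arr 24 z = if z ∈ V ∪ (Finset.range p).image (fun j => (d ^ j) x) then 1 else 0) ∧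
    (∀ z ∈ V, σ'.arr 25 z = σ.arr 25 z ∧ σ'.arr 26 z = σ.arr 26 z) ∧
    (∀ j < p, σ'.arr 25 ((d ^ j) x) = x ∧ σ'.arr 26 ((d ^ j) x) = j) ∧
    t' ≤ t + 4 + 7 * p) (t + 4 + 7 * n) ?_ ?_ ?_ ?_
  · exact ⟨0, by simp, by simp, by simp, by simp, by simpa using hV.marks, by simp, by simp,
      by simp⟩
  · rintro σ1 t1 - ⟨p, h1, -, -, -, -, -, -, ht⟩
    omega
  · rintro σ1 t1 hF ⟨p, g1, g2, g3, g4, g5, g6, g7, ht⟩ hlt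
    have r4 : σ1.reg 4 = 1 := by rw [hF.reg 4 rfl]; simp [h4]
    have r30 : σ1.reg 30 = x := by rw [hF.reg 30 rfl]; simp [h30]
    have a8 : ∀ z : Fin n, σ1.arr 8 z = d z := fun z => by rw [hF.arr 8 rfl]; exact h8 z
    have hmem : (d ^ p) x ∉ V ∪ (Finset.range p).image (fun j => (d ^ j) x) := by
      intro h
      rw [r4, g4, g5, if_pos h] at hlt
      omega
    have hp : p < Function.minimalPeriod d x := by
      refine g1.lt_of_ne fun h => hmem ?_
      refine Finset.mem_union_right _ (Finset.mem_image.2 ⟨0, by simp; omega, ?_⟩)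
      rw [h, (pow_apply_eq_self_iff).2 dvd_rfl]
      simp
    have hne : ∀ j < p, ((d ^ j) x : ℕ) ≠ (d ^ p) x := fun j hj h =>
      hinj j p hj hp (Fin.ext h).symm
    have hVne : ∀ z ∈ V, (z : ℕ) ≠ (d ^ p) x := fun z hz h => hclosed p (Fin.ext h ▸ hz)
    simp [g2, g3, r4, r30, a8, -exists_and_left, -exists_and_right]
    refine ⟨by omega, by omega, by rw [pow_succ', Equiv.Perm.mul_apply],
      by rw [pow_succ', Equiv.Perm.mul_apply], ?_, ?_, ?_, by omega⟩
    · intro z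
      by_cases hz : z = (d ^ p) x
      · subst hz
        rw [Function.update_self, if_pos]
        exact Or.inr ⟨p, by omega, rfl⟩
      · rw [Function.update_of_ne (fun h => hz (Fin.ext h)), g5]
        congr 1
        simp only [Finset.mem_union, Finset.mem_image, Finset.mem_range, eq_iff_iff]
        refine or_congr_right ⟨fun ⟨j, hj, h⟩ => ⟨j, by omega, h⟩, fun ⟨j, hj, h⟩ => ⟨j, ?_, h⟩⟩
        refine hj.lt_of_ne ?_
        rintro rfl
        exact hz h.symm
    · intro z hz
      rw [Function.update_of_ne (hVne z hz), Function.update_of_ne (hVne z hz)]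
      exact g6 z hz
    · intro j hj
      rcases hj.lt_or_eq with hj | rfl
      · rw [Function.update_of_ne (hne j hj), Function.update_of_ne (hne j hj)]
        exact g7 j hj
      · simp
  · rintro σ1 t1 hF ⟨p, g1, g2, g3, g4, g5, g6, g7, ht⟩ hle
    have r4 : σ1.reg 4 = 1 := by rw [hF.reg 4 rfl]; simp [h4]
    have r30 : σ1.reg 30 = x := by rw [hF.reg 30 rfl]; simp [h30]
    have a27 : σ1.arr 27 = σ.arr 27 := by rw [hF.arr 27 rfl]; simp
    have hmem : (d ^ p) x ∈ V ∪ (Finset.range p).image (fun j => (d ^ j) x) := by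
      by_contra h
      rw [r4, g4, g5, if_neg h] at hle
      omega
    obtain rfl : p = Function.minimalPeriod d x := by
      refine g1.antisymm (not_lt.1 fun hp => ?_)
      rcases Finset.mem_union.1 hmem with h | h
      · exact hclosed p h
      · obtain ⟨j, hj, h⟩ := Finset.mem_image.1 h
        exact hinj j p (by simpa using hj) hp h.symm
    have himg : ∀ z, z ∈ (Finset.range (Function.minimalPeriod d x)).image (fun j => (d ^ j) x) ↔
        d.SameCycle x z := by
      intro z
      simp only [Finset.mem_image, Finset.mem_range]
      constructor
      · rintro ⟨j, -, rfl⟩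
        exact ⟨j, by simp⟩
      · intro h
        obtain ⟨j, hj, h⟩ := SameCycle.exists_pow_lt h
        exact ⟨j, hj, h⟩
    have hxV : ∀ z ∈ V, z ≠ x := fun z hz h => hx (h ▸ hz)
    simp [g2, r30]
    intro hF'
    refine hQ _ _ (V ∪ (Finset.range (Function.minimalPeriod d x)).image (fun j => (d ^ j) x)) hF'
      ⟨by simpa using g5, fun z => ?_, fun z hz => ?_, fun z hz => ?_⟩
      Finset.subset_union_left (Finset.mem_union_right _ ((himg x).2 (.refl _ _))) ?_
    · rw [Finset.mem_union, Finset.mem_union, hV.closed, himg, himg]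
      simp
    · rcases Finset.mem_union.1 hz with hz | hz
      · obtain ⟨r, hr, e1, e2, e3, e4⟩ := hV.root z hz
        refine ⟨r, Finset.mem_union_left _ hr, ?_, ?_, ?_, ?_⟩
        · simpa [(g6 z hz).1] using e1
        · simpa [(g6 z hz).2] using e2
        · simpa [(g6 z hz).2] using e3
        · simp only [State.arr_setArr, if_true]
          rw [Function.update_of_ne (fun h => hxV r hr (Fin.ext h)), a27, e4]
      · obtain ⟨j, hj, rfl⟩ := Finset.mem_image.1 hz
        have := g7 j (by simpa using hj)
        refine ⟨x, Finset.mem_union_right _ ((himg x).2 (.refl _ _)), by simpa using this.1,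
          by simp [this.2], by simpa [this.2] using hj, by simp⟩
    · rcases Finset.mem_union.1 hz with hz | hz
      · simpa [(g6 z hz).1, (g6 _ ((hV.closed z).2 hz)).1] using hV.root_apply z hz
      · have hz' := (himg (d z)).2 (by simpa using (himg z).1 hz)
        obtain ⟨j, hj, hjz⟩ := Finset.mem_image.1 hz
        obtain ⟨k, hk, hkz⟩ := Finset.mem_image.1 hz'
        simp only [State.arr_setArr, show (25 : ℕ) ≠ 27 by decide, if_false]
        rw [← hkz, ← hjz, (g7 j (by simpa using hj)).1, (g7 k (by simpa using hk)).1]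
    · rw [Finset.card_union_of_disjoint, Finset.card_image_of_injOn, Finset.card_range]
      · omega
      · intro j hj k hk h
        simp only [Finset.coe_range, Set.mem_Iio] at hj hk
        rcases lt_trichotomy j k with hjk | hjk | hjk
        · exact absurd h.symm (hinj j k hjk hk)
        · exact hjk
        · exact absurd h (hinj k j hjk hj)
      · rw [Finset.disjoint_left]
        intro z hz hz'
        obtain ⟨j, -, rfl⟩ := Finset.mem_image.1 hz'
        exact hclosed j hz

theorem wp_positions (hW : n + 1 ≤ W) (h0 : σ.reg 0 = n) (h4 : σ.reg 4 = 1)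
    (h8 : Stores σ 8 d) (h24 : ∀ k, σ.arr 24 k = 0)
    (hQ : ∀ σ' t', Frame positions σ σ' → PositionedOn d Finset.univ σ' →
      t' ≤ t + 30 * n + 10 → Q σ' t') :
    wp W positions Q σ t := by
  apply wp.frame
  simp only [positions, wp_block_cons, wp_block_singleton, wp_const]
  refine ⟨by omega, ?_⟩
  refine wp_forLt (b := n) (fun k σ' t' => ∃ V, PositionedOn d V σ' ∧
    (∀ x : Fin n, (x : ℕ) < k → x ∈ V) ∧ t' ≤ t + 1 + 12 * k + 10 * V.card) (by simp [h4])
    (by simp [h0]) (by omega) rfl rfl rfl (by decide) (by decide) (by simp) ?_ ?_ ?_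
  · exact ⟨∅, ⟨by simp [h24], by simp, by simp, by simp⟩, by simp, by simp⟩
  · rintro k σ1 t1 hF _ hk hik ⟨V, g1, g2, ht⟩
    refine wp_walkOrbit (x := ⟨k, hk⟩) (d := d) (V := V) hW ?_ ?_ g1 hik ?_
    · rw [hF.reg 4 rfl]; simp [h4]
    · intro z; rw [hF.arr 8 rfl]; exact h8 z
    · intro σ2 t2 V' hF2 e1 e2 e3 ht2
      refine ⟨V', ⟨e1.marks, e1.closed, e1.root, e1.root_apply⟩, fun x hx => ?_, by omega⟩
      rcases (Nat.le_of_lt_succ hx).lt_or_eq with hx | hx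
      · exact e2 (g2 x hx)
      · rwa [show x = ⟨k, hk⟩ from Fin.ext hx]
  · rintro σ1 t1 hF _ ⟨V, g1, g2, ht⟩ hF'
    obtain rfl : V = Finset.univ := Finset.eq_univ_of_forall fun x => g2 x x.2
    rw [Finset.card_univ, Fintype.card_fin] at ht
    exact hQ _ _ hF' g1 (by omega)

theorem PositionedOn.root_eq (h : PositionedOn d Finset.univ σ) {x y : Fin n}
    (hxy : d.SameCycle x y) : σ.arr 25 y = σ.arr 25 x := by
  obtain ⟨k, -, rfl⟩ := SameCycle.exists_pow_lt hxy
  induction k with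
  | zero => rfl
  | succ k ih =>
    rw [pow_succ', Equiv.Perm.mul_apply, h.root_apply _ (Finset.mem_univ _)]
    exact ih ⟨k, by simp⟩

theorem PositionedOn.root_eq_iff (h : PositionedOn d Finset.univ σ) {x y : Fin n} :
    σ.arr 25 x = σ.arr 25 y ↔ d.SameCycle x y := by
  refine ⟨fun hxy => ?_, fun hxy => (h.root_eq hxy).symm⟩
  obtain ⟨r, -, hr, hrx, -⟩ := h.root x (Finset.mem_univ _)
  obtain ⟨r', -, hr', hry, -⟩ := h.root y (Finset.mem_univ _)
  obtain rfl : r = r' := Fin.ext (by rw [← hr, ← hr', hxy])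
  have h1 := sameCycle_pow_apply d r (σ.arr 26 x)
  have h2 := sameCycle_pow_apply d r (σ.arr 26 y)
  rw [hrx] at h1
  rw [hry] at h2
  exact h1.symm.trans h2

theorem PositionedOn.length_eq (h : PositionedOn d Finset.univ σ) (x : Fin n) :
    σ.arr 27 (σ.arr 25 x) = Function.minimalPeriod d x := by
  obtain ⟨r, -, hr, hrx, -, hr'⟩ := h.root x (Finset.mem_univ _)
  have h1 := minimalPeriod_pow_apply d r (σ.arr 26 x)
  rw [hr, hr', ← h1, hrx]

/-- Computes, for each entry, the distance of its point to its image, in array 28. -/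
def distances : Prog :=
  block [.const 30 0, forLt 30 5 (block [.load 31 4 30, .load 32 5 30, .load 33 26 31,
    .load 34 26 32, .ifLt 33 34 (block [.sub 35 34 33, .store 28 30 35])
      (block [.load 35 25 31, .load 35 27 35, .sub 35 35 33, .add 35 35 34, .store 28 30 35])])]

theorem wp_distances (hW : n + E + m + 2 ≤ W) (hC : Context L σ)
    (hd : ActsOnCycles s d)
    (hpos : PositionedOn d Finset.univ σ)
    (hQ : ∀ σ' t', Frame distances σ σ' →
      (∀ e : Fin E, σ'.arr 28 e = cycleDist d (L.pt e) (L.pt (L.nxt e))) →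
      t' ≤ t + 20 * E + 10 → Q σ' t') :
    wp W distances Q σ t := by
  apply wp.frame
  simp only [distances, wp_block_cons, wp_block_singleton, wp_const]
  refine ⟨by omega, ?_⟩
  refine wp_forLt_const (b := E) (fun k σ' => ∀ e : Fin E, (e : ℕ) < k →
    σ'.arr 28 e = cycleDist d (L.pt e) (L.pt (L.nxt e))) 12 (by simp [hC.reg4])
    (by simp [hC.reg5]) (by omega) rfl rfl rfl (by decide) (by decide) (by simp) (by simp) ?_ ?_
  · intro k σ1 t1 hF _ hk hik h1
    obtain ⟨e, rfl⟩ : ∃ e : Fin E, (e : ℕ) = k := ⟨⟨k, hk⟩, rfl⟩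
    have a4 : σ1.arr 4 e = L.pt e := by rw [hF.arr 4 rfl]; exact hC.stored.pt e
    have a5 : σ1.arr 5 e = L.pt (L.nxt e) := by rw [hF.arr 5 rfl]; exact hC.stored.img e
    have hsame : d.SameCycle (L.pt e) (L.pt (L.nxt e)) := by rw [L.pt_nxt]; exact hd _ _
    obtain ⟨r, -, p1, p2, p3, p4⟩ := hpos.root (L.pt e) (Finset.mem_univ _)
    obtain ⟨r', -, q1, q2, q3, q4⟩ := hpos.root (L.pt (L.nxt e)) (Finset.mem_univ _)
    obtain rfl : r' = r := Fin.ext (by rw [← p1, ← q1, hpos.root_eq hsame])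
    have hr := minimalPeriod_le d r'
    have hper : Function.minimalPeriod d (L.pt e) = Function.minimalPeriod d r' := by
      rw [← p2, minimalPeriod_pow_apply]
    have a25 : σ1.arr 25 (L.pt e) = r' := by rw [hF.arr 25 rfl]; exact p1
    have a26 : σ1.arr 26 = σ.arr 26 := hF.arr 26 rfl
    have a27 : σ1.arr 27 r' = Function.minimalPeriod d r' := by rw [hF.arr 27 rfl]; exact p4
    have key : ∀ j, j < Function.minimalPeriod d (L.pt e) →
        (d ^ (j + σ.arr 26 (L.pt e))) r' = L.pt (L.nxt e) →
        cycleDist d (L.pt e) (L.pt (L.nxt e)) = j := by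
      intro j hj h
      refine cycleDist_eq hj ?_
      rwa [pow_add, Equiv.Perm.mul_apply, p2] at h
    -- The point is moved, so the positions differ. In the branch that wraps around the root, the
    -- computed number is therefore smaller than the cycle length, as `cycleDist_eq` demands.
    have hne : σ.arr 26 (L.pt e) ≠ σ.arr 26 (L.pt (L.nxt e)) := by
      intro h
      rw [← h, p2] at q2
      exact L.pt_nxt_ne e q2.symm
    simp [hik, a4, a5, a25, a26, a27]
    refine ⟨fun hlt e' he' => ?_, fun hle => ⟨by omega, fun e' he' => ?_⟩⟩
    · by_cases hee : e' = e
      · subst hee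
        rw [Function.update_self, key]
        · omega
        · rwa [Nat.sub_add_cancel hlt.le]
      · rw [Function.update_of_ne (fun h => hee (Fin.ext h))]
        exact h1 e' (he'.lt_of_ne hee)
    · by_cases hee : e' = e
      · subst hee
        rw [Function.update_self, key]
        · omega
        · rw [add_right_comm, Nat.sub_add_cancel p3.le, add_comm, pow_add, Equiv.Perm.mul_apply,
            pow_apply_eq_self_iff.2 dvd_rfl, q2]
      · rw [Function.update_of_ne (fun h => hee (Fin.ext h))]
        exact h1 e' (he'.lt_of_ne hee)
  · intro σ1 t1 hF _ h1 ht1 hF'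
    simp at ht1
    exact hQ _ _ hF' (fun e => h1 e e.2) (by omega)

end

end OrbitEquivalence

namespace OrbitEquivalence

/-! ### Refinement of a coloring by a function -/

section
variable {n m E : ℕ} {s : Fin m → Equiv.Perm (Fin n)} {L : Listing s E}
  {d : Equiv.Perm (Fin n)} {W : ℕ} {σ : State} {t : ℕ} {Q : State → ℕ → Prop}

/-- Introduces a new color for the key in register 57. -/
def freshColor : Prog :=
  block [.store 29 57 53, .store 30 53 57, .store 7 54 53, .add 53 53 4]

/-- Recolors the points listed between the positions in registers 50 and 51 of array `p`,
according to their old colors (array 7) and the values in array `v`.  The new colors are at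
least the number in register 52; register 53 contains the next unused color. -/
def refineColors (p v : ℕ) : Prog :=
  forLt 50 51 (block [.load 54 p 50, .load 55 v 50, .load 56 7 54, .load 57 13 56, .add 57 57 55,
    .load 58 29 57, .ifLt 58 52 freshColor (.ifLt 58 53 (block [.load 59 30 58,
      .ifLt 59 57 freshColor (.ifLt 57 59 freshColor (.store 7 54 58))]) freshColor)])

theorem mul_add_inj {B a a' b b' : ℕ} (hb : b < B) (hb' : b' < B) :
    a * B + b = a' * B + b' ↔ a = a' ∧ b = b' := by
  refine ⟨fun h => ?_, fun ⟨h, h'⟩ => by rw [h, h']⟩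
  have h1 := congrArg (· / B) h
  have hB : 0 < B := by omega
  simp only [Nat.mul_comm _ B, Nat.mul_add_div hB, Nat.div_eq_of_lt hb, Nat.div_eq_of_lt hb',
    add_zero] at h1
  subst h1
  exact ⟨rfl, by omega⟩

/-- Array 29 is a table from keys to colors that is never cleared. Its content is trusted only if it
is a color between `lo` and the current counter for which array 30 returns the same key. Stale cells
thus do no harm, and the time depends only on the number of listed points. -/
theorem wp_refineColors {p v a b lo cnt : ℕ} (hW : (n + E + 2) * (n + E + 2) ≤ W)
    (hC : Context L σ) (hp : p ≠ 7 ∧ p ≠ 29 ∧ p ≠ 30) (hv : v ≠ 7 ∧ v ≠ 29 ∧ v ≠ 30)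
    (h50 : σ.reg 50 = a) (h51 : σ.reg 51 = b) (h52 : σ.reg 52 = lo) (h53 : σ.reg 53 = cnt)
    (hab : a ≤ b) (hbW : b ≤ W) (hlo : lo ≤ cnt) (hcnt : cnt + (b - a) ≤ n + E + 2)
    (hinj : ∀ q q', a ≤ q → q < b → a ≤ q' → q' < b → σ.arr p q = σ.arr p q' → q = q')
    (hu : ∀ q, a ≤ q → q < b → σ.arr 7 (σ.arr p q) < n + E + 2)
    (hval : ∀ q, a ≤ q → q < b → σ.arr v q < n + E + 2)
    (hQ : ∀ σ' t', Frame (refineColors p v) σ σ' → cnt ≤ σ'.reg 53 → σ'.reg 53 ≤ cnt + (b - a) →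
      (∀ q, a ≤ q → q < b → lo ≤ σ'.arr 7 (σ.arr p q) ∧ σ'.arr 7 (σ.arr p q) < σ'.reg 53) →
      (∀ q q', a ≤ q → q < b → a ≤ q' → q' < b →
        (σ'.arr 7 (σ.arr p q) = σ'.arr 7 (σ.arr p q') ↔
          σ.arr 7 (σ.arr p q) = σ.arr 7 (σ.arr p q') ∧ σ.arr v q = σ.arr v q')) →
      (∀ k, (∀ q, a ≤ q → q < b → σ.arr p q ≠ k) → σ'.arr 7 k = σ.arr 7 k) →
      t' ≤ t + 20 * (b - a) + 1 → Q σ' t') :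
    wp W (refineColors p v) Q σ t := by
  apply wp.frame
  obtain ⟨key, hkey⟩ : ∃ key : ℕ → ℕ, ∀ q, key q =
    σ.arr 7 (σ.arr p q) * (n + E + 2) + σ.arr v q := ⟨_, fun _ => rfl⟩
  have hkey_iff : ∀ q q', a ≤ q → q < b → a ≤ q' → q' < b → (key q = key q' ↔
      σ.arr 7 (σ.arr p q) = σ.arr 7 (σ.arr p q') ∧ σ.arr v q = σ.arr v q') := by
    intro q q' h1 h2 h3 h4
    rw [hkey, hkey, mul_add_inj (hval q h1 h2) (hval q' h3 h4)]
  have hB : n + E + 2 + 1 ≤ W := by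
    refine le_trans ?_ hW
    calc n + E + 2 + 1 ≤ 2 * (n + E + 2) := by omega
      _ ≤ _ := Nat.mul_le_mul_right _ (by omega)
  refine wp_forLt_const (b := b) (fun k σ' => cnt ≤ σ'.reg 53 ∧ σ'.reg 53 ≤ cnt + (k - a) ∧
    (∀ q, a ≤ q → q < k → lo ≤ σ'.arr 7 (σ.arr p q) ∧ σ'.arr 7 (σ.arr p q) < σ'.reg 53 ∧
      σ'.arr 29 (key q) = σ'.arr 7 (σ.arr p q) ∧ σ'.arr 30 (σ'.arr 7 (σ.arr p q)) = key q) ∧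
    ∀ i, (∀ q, a ≤ q → q < k → σ.arr p q ≠ i) → σ'.arr 7 i = σ.arr 7 i) 18 hC.reg4 h51
    (by omega) rfl rfl rfl (by decide) (by decide) (by omega) ?_ ?_ ?_
  · rw [h50, h53]
    exact ⟨le_rfl, by omega, fun q h1 h2 => by omega, fun _ _ => rfl⟩
  · rintro k σ1 t1 hF hak hkb hik ⟨g1, g2, g3, g4⟩
    rw [h50] at hak
    have r52 : σ1.reg 52 = lo := by rw [hF.reg 52 rfl, h52]
    have r4 : σ1.reg 4 = 1 := by rw [hF.reg 4 rfl, hC.reg4]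
    have ap : σ1.arr p = σ.arr p := hF.arr p (by simp [forLt, block, freshColor, Prog.writesArr, hp])
    have av : σ1.arr v = σ.arr v := hF.arr v (by simp [forLt, block, freshColor, Prog.writesArr, hv])
    -- The listed points are distinct, so the old color of this one has not been overwritten yet.
    have a7 : σ1.arr 7 (σ.arr p k) = σ.arr 7 (σ.arr p k) :=
      g4 _ fun q h1 h2 h => by have := hinj q k h1 (by omega) hak hkb h; omega
    have a13 : σ1.arr 13 (σ.arr 7 (σ.arr p k)) = σ.arr 7 (σ.arr p k) * (n + E + 2) := by
      rw [hF.arr 13 rfl, hC.mul _ (hu k hak hkb)]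
    have hkW : key k ≤ W := by
      rw [hkey]
      refine le_trans ?_ hW
      have h1 := hu k hak hkb
      have h2 := hval k hak hkb
      calc _ ≤ σ.arr 7 (σ.arr p k) * (n + E + 2) + (n + E + 2) := by omega
        _ = (σ.arr 7 (σ.arr p k) + 1) * (n + E + 2) := by ring
        _ ≤ _ := Nat.mul_le_mul_right _ h1
    have hne : ∀ q, a ≤ q → q < k → σ.arr p q ≠ σ.arr p k := fun q h1 h2 h => by
      have := hinj q k h1 (by omega) hak hkb h
      omega
    -- The lookup can fail because the color is too small, too large, or registered for another key.
    -- In each case no earlier point of the list had this key.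
    have fresh : ∀ σ2 t2, t2 ≤ t1 + 12 → σ2.reg 57 = key k → σ2.reg 53 = σ1.reg 53 →
        σ2.reg 54 = σ.arr p k → σ2.reg 4 = 1 → σ2.arr = σ1.arr →
        (lo ≤ σ1.arr 29 (key k) → σ1.arr 29 (key k) < σ1.reg 53 →
          σ1.arr 30 (σ1.arr 29 (key k)) ≠ key k) →
        wp W freshColor (fun σ'' t'' => (cnt ≤ (σ''.setReg 50 (k + 1)).reg 53 ∧
          (σ''.setReg 50 (k + 1)).reg 53 ≤ cnt + (k + 1 - a) ∧
          (∀ q, a ≤ q → q < k + 1 → lo ≤ (σ''.setReg 50 (k + 1)).arr 7 (σ.arr p q) ∧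
            (σ''.setReg 50 (k + 1)).arr 7 (σ.arr p q) < (σ''.setReg 50 (k + 1)).reg 53 ∧
            (σ''.setReg 50 (k + 1)).arr 29 (key q) = (σ''.setReg 50 (k + 1)).arr 7 (σ.arr p q) ∧
            (σ''.setReg 50 (k + 1)).arr 30 ((σ''.setReg 50 (k + 1)).arr 7 (σ.arr p q)) = key q) ∧
          ∀ i, (∀ q, a ≤ q → q < k + 1 → σ.arr p q ≠ i) →
            (σ''.setReg 50 (k + 1)).arr 7 i = σ.arr 7 i) ∧ t'' ≤ t1 + 18) σ2 t2 := by
      intro σ2 t2 ht2 e57 e53 e54 e4 earr hnew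
      have hkne : ∀ q, a ≤ q → q < k → key q ≠ key k := by
        intro q h1 h2 h
        obtain ⟨f1, f2, f3, f4⟩ := g3 q h1 h2
        rw [← h, f3] at hnew
        exact hnew f1 f2 f4
      simp only [freshColor, wp_block_cons, wp_block_singleton, wp_store, wp_add]
      simp [e57, e53, e54, e4, earr]
      refine ⟨by omega, ⟨by omega, by omega, ?_, ?_⟩, by omega⟩
      · intro q h1 h2
        rcases h2.lt_or_eq with h2 | rfl
        · obtain ⟨f1, f2, f3, f4⟩ := g3 q h1 h2
          rw [Function.update_of_ne (hne q h1 h2), Function.update_of_ne (hkne q h1 h2),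
            Function.update_of_ne f2.ne]
          exact ⟨f1, by omega, f3, f4⟩
        · simp
          omega
      · intro i hi
        rw [Function.update_of_ne (fun h => hi k hak le_rfl h.symm)]
        exact g4 i fun q h1 h2 => hi q h1 h2.le
    simp only [wp_block_cons, wp_block_singleton, wp_load, wp_add, wp_ifLt, wp_store]
    simp only [State.reg_setReg, State.arr_setReg, hik, ap, av, a7, a13, r52, ← hkey,
      Nat.reduceEqDiff, if_true, if_false]
    refine ⟨hkW, fun hlt => ?_, fun hle => ⟨fun hlt => ⟨fun hlt' => ?_, fun hle' =>
      ⟨fun hlt'' => ?_, fun hle'' => ?_⟩⟩, fun hle' => ?_⟩⟩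
    · exact fresh _ _ (by omega) (by simp) (by simp) (by simp) (by simp [r4]) (by ext; simp)
        fun h1 _ => by omega
    · exact fresh _ _ (by omega) (by simp) (by simp) (by simp) (by simp [r4]) (by ext; simp)
        fun _ _ => by omega
    · exact fresh _ _ (by omega) (by simp) (by simp) (by simp) (by simp [r4]) (by ext; simp)
        fun _ _ => by omega
    · have hK : σ1.arr 30 (σ1.arr 29 (key k)) = key k := le_antisymm hle'' hle'
      simp
      refine ⟨g1, by omega, ?_, ?_⟩
      · intro q h1 h2
        rcases h2.lt_or_eq with h2 | rfl
        · rw [Function.update_of_ne (hne q h1 h2)]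
          exact g3 q h1 h2
        · rw [Function.update_self]
          exact ⟨hle, hlt, rfl, hK⟩
      · intro i hi
        rw [Function.update_of_ne (fun h => hi k hak le_rfl h.symm)]
        exact g4 i fun q h1 h2 => hi q h1 h2.le
    · exact fresh _ _ (by omega) (by simp) (by simp) (by simp) (by simp [r4]) (by ext; simp)
        fun _ h2 => by omega
  · rintro σ1 t1 hF _ ⟨g1, g2, g3, g4⟩ ht1 hF'
    rw [h50] at ht1
    refine hQ _ _ hF' g1 g2 (fun q h1 h2 => ⟨(g3 q h1 h2).1, (g3 q h1 h2).2.1⟩) ?_ g4 (by omega)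
    intro q q' h1 h2 h3 h4
    rw [← hkey_iff q q' h1 h2 h3 h4]
    obtain ⟨-, -, f1, f2⟩ := g3 q h1 h2
    obtain ⟨-, -, f1', f2'⟩ := g3 q' h3 h4
    exact ⟨fun h => by rw [← f2, ← f2', h], fun h => by rw [← f1, ← f1', h]⟩

/-- The cycle lengths agree, and the first `k` generators move the points equally far. -/
def LetterSim (s : Fin m → Equiv.Perm (Fin n)) (d : Equiv.Perm (Fin n)) (k : ℕ) (x y : Fin n) :
    Prop :=
  Function.minimalPeriod d x = Function.minimalPeriod d y ∧
    ∀ i : Fin m, (i : ℕ) < k → cycleDist d x (s i x) = cycleDist d y (s i y)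

/-- Colors the points according to the lengths of their cycles and the distances to their
images under the generators. -/
def letterColors : Prog :=
  block [.const 30 0, forLt 30 0 (block [.load 31 25 30, .load 31 27 31, .store 7 30 31]),
    .add 53 0 4, .const 30 0, forLt 30 2 (block [.move 52 53, .load 50 3 30, .add 31 30 4,
      .load 51 3 31, refineColors 4 28])]

theorem cycleDist_self (d : Equiv.Perm (Fin n)) (x : Fin n) : cycleDist d x x = 0 :=
  cycleDist_eq (minimalPeriod_pos d x) rfl

theorem cycleDist_ne_zero {x y : Fin n} (h : d.SameCycle x y) (hxy : y ≠ x) :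
    cycleDist d x y ≠ 0 := by
  intro h0
  have := (cycleDist_spec h).2
  rw [h0] at this
  exact hxy this.symm

/-- The round for a generator recolors only the points it moves, so all rounds together are linear
in `E`. Setting `lo` to the counter gives them unused colors and separates them from the fixed
points, whose distance is 0. Cycle lengths are at most `n`, so new colors start at `n + 1`, and at
most `E` are ever introduced. -/
theorem wp_letterColors (hW : (n + E + 2) * (n + E + 2) ≤ W) (hmW : n + E + m + 2 ≤ W)
    (hC : Context L σ) (hd : ActsOnCycles s d) (hpos : PositionedOn d Finset.univ σ)
    (h28 : ∀ e : Fin E, σ.arr 28 e = cycleDist d (L.pt e) (L.pt (L.nxt e)))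
    (hQ : ∀ σ' t', Frame letterColors σ σ' →
      (∀ x y : Fin n, σ'.arr 7 x = σ'.arr 7 y ↔ LetterSim s d m x y) →
      (∀ x : Fin n, σ'.arr 7 x < n + E + 2) →
      t' ≤ t + 5 * n + 10 * m + 20 * E + 10 → Q σ' t') :
    wp W letterColors Q σ t := by
  apply wp.frame
  simp only [letterColors, wp_block_cons, wp_const]
  refine ⟨by omega, ?_⟩
  refine wp_forLt_const (b := n) (fun k σ' => ∀ x : Fin n, (x : ℕ) < k →
    σ'.arr 7 x = Function.minimalPeriod d x) 3 (by simp [hC.reg4])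
    (by simp [hC.reg0]) (by omega) rfl rfl rfl (by decide) (by decide) (by simp) (by simp) ?_ ?_
  · intro k σ1 t1 hF _ hk hik h1
    obtain ⟨x, rfl⟩ : ∃ x : Fin n, (x : ℕ) = k := ⟨⟨k, hk⟩, rfl⟩
    have a25 : σ1.arr 25 = σ.arr 25 := hF.arr 25 rfl
    have a27 : σ1.arr 27 = σ.arr 27 := hF.arr 27 rfl
    simp [hik, a25, a27, hpos.length_eq]
    intro y hy
    by_cases hyx : y = x
    · simp [hyx]
    · rw [Function.update_of_ne (fun h => hyx (Fin.ext h))]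
      exact h1 y (hy.lt_of_ne hyx)
  intro σ1 t1 hF1 _ h1 ht1
  have hC1 : Context L σ1 := Context.of_frame (σ := σ.setReg 30 0) (hC.setReg (by omega)) hF1
  have a28 : σ1.arr 28 = σ.arr 28 := hF1.arr 28 rfl
  simp only [wp_block_cons, wp_block_singleton, wp_const, wp_add]
  refine ⟨by rw [hC1.reg0, hC1.reg4]; omega, by omega, ?_⟩
  refine wp_forLt (b := m) (fun k σ' t' =>
    (∀ x y : Fin n, σ'.arr 7 x = σ'.arr 7 y ↔ LetterSim s d k x y) ∧
    (∀ x : Fin n, σ'.arr 7 x < σ'.reg 53) ∧ σ'.reg 53 ≤ n + 1 + L.off k ∧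
    t' ≤ t1 + 10 * k + 20 * L.off k + 2) (by simp [hC1.reg4]) (by simp [hC1.reg2])
    (by omega) rfl rfl rfl (by decide) (by decide) (by simp) ?_ ?_ ?_
  · refine ⟨fun x y => ?_, fun x => ?_, ?_, by simp⟩
    · simp [LetterSim, h1]
    · simp [h1, hC1.reg0, hC1.reg4, minimalPeriod_le]
    · simp [hC1.reg0, hC1.reg4]
  · rintro k σ2 t2 hF _ hk hik ⟨g1, g2, g3, ht2⟩
    have hC2 : Context L σ2 := Context.of_frame
      (σ := (σ1.setReg 53 (σ1.reg 0 + σ1.reg 4)).setReg 30 0)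
      ((hC1.setReg (by omega)).setReg (by omega)) hF
    have a28' : ∀ e : Fin E, σ2.arr 28 e = cycleDist d (L.pt e) (L.pt (L.nxt e)) := fun e => by
      rw [hF.arr 28 rfl]
      simp [a28, h28]
    have hok := L.off_le k hk
    have hoE := L.off_le_card (i := k + 1) hk
    have hlist : ∀ q, L.off k ≤ q → q < L.off (k + 1) → ∃ e : Fin E, (e : ℕ) = q ∧
        (L.gen e : ℕ) = k := fun q h h' =>
      ⟨⟨q, by omega⟩, rfl, congrArg Fin.val (((L.gen_iff ⟨q, by omega⟩ ⟨k, hk⟩).2 ⟨h, h'⟩))⟩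
    simp only [wp_block_cons, wp_block_singleton, wp_load, wp_add, wp_move]
    simp only [State.reg_setReg, State.arr_setReg, hik, hC2.reg4, hC2.stored.off k hk.le,
      hC2.stored.off (k + 1) hk, Nat.reduceEqDiff, if_true, if_false]
    refine ⟨by omega, ?_⟩
    refine wp_refineColors (L := L) (a := L.off k) (b := L.off (k + 1)) (lo := σ2.reg 53)
      (cnt := σ2.reg 53) hW ?_ (by decide) (by decide) (by simp) (by simp) (by simp) (by simp)
      hok (by omega) le_rfl (by omega) ?_ ?_ ?_ ?_
    · exact (((hC2.setReg (by omega)).setReg (by omega)).setReg (by omega)).setReg (by omega)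
    · intro q q' h1 h2 h3 h4 h
      obtain ⟨e, rfl, he⟩ := hlist q h1 h2
      obtain ⟨e', rfl, he'⟩ := hlist q' h3 h4
      simp [hC2.stored.pt] at h
      exact congrArg Fin.val (L.inj e e' (Fin.ext (he.trans he'.symm)) (Fin.ext h))
    · intro q h1 h2
      obtain ⟨e, rfl, he⟩ := hlist q h1 h2
      simp [hC2.stored.pt]
      have := g2 (L.pt e)
      omega
    · intro q h1 h2
      obtain ⟨e, rfl, he⟩ := hlist q h1 h2
      simp [a28']
      have h3 : d.SameCycle (L.pt e) (L.pt (L.nxt e)) := by rw [L.pt_nxt]; exact hd _ _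
      have := (cycleDist_spec h3).1
      have := minimalPeriod_le d (L.pt e)
      omega
    · intro σ3 t3 hF3 e1 e2 e3 e4 e5 ht3
      simp only [State.arr_setReg] at e3 e4 e5
      have hmoved : ∀ x : Fin n, s ⟨k, hk⟩ x ≠ x → ∃ e : Fin E, L.off k ≤ e ∧
          (e : ℕ) < L.off (k + 1) ∧ L.pt e = x ∧ σ2.arr 4 e = x ∧
          σ2.arr 28 e = cycleDist d x (s ⟨k, hk⟩ x) := by
        intro x hx
        obtain ⟨e, he, rfl⟩ := L.surj _ x hx
        have := (L.gen_iff e ⟨k, hk⟩).1 he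
        refine ⟨e, this.1, this.2, rfl, hC2.stored.pt e, ?_⟩
        rw [a28', L.pt_nxt, he]
      have hfix : ∀ x : Fin n, s ⟨k, hk⟩ x = x → σ3.arr 7 x = σ2.arr 7 x := by
        intro x hx
        refine e5 x fun q h1 h2 h => ?_
        obtain ⟨e, rfl, he⟩ := hlist q h1 h2
        rw [hC2.stored.pt] at h
        have := L.moved e
        rw [Fin.ext h, show L.gen e = ⟨k, hk⟩ from Fin.ext he] at this
        exact this hx
      have hstep : ∀ x y : Fin n, LetterSim s d (k + 1) x y ↔ LetterSim s d k x y ∧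
          cycleDist d x (s ⟨k, hk⟩ x) = cycleDist d y (s ⟨k, hk⟩ y) := by
        intro x y
        simp only [LetterSim, and_assoc]
        refine and_congr_right fun _ => ⟨fun h => ⟨fun i hi => h i (by omega), h ⟨k, hk⟩ (by simp)⟩,
          fun h i hi => ?_⟩
        rcases (Nat.le_of_lt_succ hi).lt_or_eq with hi | rfl
        · exact h.1 i hi
        · exact h.2
      refine ⟨fun x y => ?_, fun x => ?_, ?_, ?_⟩
      · rw [hstep, ← g1]
        by_cases hx : s ⟨k, hk⟩ x = x <;> by_cases hy : s ⟨k, hk⟩ y = y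
        · rw [hfix x hx, hfix y hy, hx, hy]
          simp [cycleDist_self]
        · obtain ⟨e, f1, f2, f3, f4, f5⟩ := hmoved y hy
          have h3 := (e3 e f1 f2).1
          rw [f4] at h3
          have h4 := cycleDist_ne_zero (hd ⟨k, hk⟩ y) hy
          have h5 := g2 x
          rw [hfix x hx, hx, cycleDist_self]
          constructor
          · intro h; omega
          · intro h; omega
        · obtain ⟨e, f1, f2, f3, f4, f5⟩ := hmoved x hx
          have h3 := (e3 e f1 f2).1
          rw [f4] at h3
          have h4 := cycleDist_ne_zero (hd ⟨k, hk⟩ x) hx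
          have h5 := g2 y
          rw [hfix y hy, hy, cycleDist_self]
          constructor
          · intro h; omega
          · intro h; omega
        · obtain ⟨e, f1, f2, f3, f4, f5⟩ := hmoved x hx
          obtain ⟨e', f1', f2', f3', f4', f5'⟩ := hmoved y hy
          have := e4 e e' f1 f2 f1' f2'
          rwa [f4, f4', f5, f5'] at this
      · by_cases hx : s ⟨k, hk⟩ x = x
        · rw [hfix x hx]
          exact (g2 x).trans_le e1
        · obtain ⟨e, f1, f2, f3, f4, f5⟩ := hmoved x hx
          have h3 := (e3 e f1 f2).2
          rwa [f4] at h3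
      · omega
      · omega
  · rintro σ2 t2 hF _ ⟨g1, g2, g3, ht2⟩ hF'
    rw [L.off_last] at g3 ht2
    simp at ht1
    refine hQ _ _ hF' g1 (fun x => ?_) (by omega)
    have := g2 x
    omega

end

end OrbitEquivalence

namespace OrbitEquivalence

/-! ### Colors of words: repeated doubling -/

section
variable {n m E : ℕ} {s : Fin m → Equiv.Perm (Fin n)} {L : Listing s E}
  {d : Equiv.Perm (Fin n)} {W : ℕ} {σ : State} {t : ℕ} {Q : State → ℕ → Prop}

theorem Sim.letterSim (hd : ActsOnCycles s d) {x y : Fin n} (h : Sim s d x y) :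
    LetterSim s d m x y := by
  refine ⟨h.1, fun i _ => ?_⟩
  obtain ⟨h1, h2⟩ := cycleDist_spec (hd i x)
  have h3 := (h.2 i 0 (cycleDist d x (s i x))).1 (by simpa using h2.symm)
  exact (cycleDist_eq (h.1 ▸ h1) (by simpa using h3.symm)).symm

/-- Exponents matter only modulo the cycle length, which is at most `n`; so `n` letters suffice, and
more do no harm. -/
theorem sim_iff_letterSim (hd : ActsOnCycles s d) {N : ℕ} (hN : n ≤ N) {x y : Fin n} :
    Sim s d x y ↔ ∀ j < N, LetterSim s d m ((d ^ j) x) ((d ^ j) y) := by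
  refine ⟨fun h j _ => (h.pow j).letterSim hd, fun h => ?_⟩
  have hpos := minimalPeriod_pos d x
  have hle := (minimalPeriod_le d x).trans hN
  have h0 : Function.minimalPeriod d x = Function.minimalPeriod d y := by
    simpa using (h 0 (by omega)).1
  refine ⟨h0, fun i j k => ?_⟩
  have hj : j % Function.minimalPeriod d x < Function.minimalPeriod d x := Nat.mod_lt _ hpos
  have hx : (d ^ j) x = (d ^ (j % Function.minimalPeriod d x)) x :=
    pow_apply_eq_pow_apply_iff.2 (Nat.mod_modEq _ _).symm
  have hy : (d ^ j) y = (d ^ (j % Function.minimalPeriod d x)) y :=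
    pow_apply_eq_pow_apply_iff.2 (h0 ▸ (Nat.mod_modEq _ _).symm)
  rw [hx, hy]
  have h1 := (h _ (hj.trans_le hle)).2 i i.2
  have hx' := (cycleDist_spec (hd i ((d ^ (j % Function.minimalPeriod d x)) x))).2
  have hy' := (cycleDist_spec (hd i ((d ^ (j % Function.minimalPeriod d x)) y))).2
  generalize cycleDist d ((d ^ (j % Function.minimalPeriod d x)) x) _ = l at h1 hx'
  rw [← h1] at hy'
  rw [← hx', ← hy', ← Equiv.Perm.mul_apply, ← Equiv.Perm.mul_apply, ← pow_add,
    pow_apply_eq_pow_apply_iff, pow_apply_eq_pow_apply_iff, h0]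

/-- One round of the doubling: array 33 contains a power of the canonical order. -/
def doublingRound : Prog :=
  block [.const 30 0, forLt 30 0 (block [.load 31 33 30, .load 32 7 31, .store 32 30 32,
      .load 32 33 31, .store 34 30 32]),
    .const 52 0, .const 53 0, .const 50 0, .move 51 0, refineColors 31 32,
    .const 30 0, forLt 30 0 (block [.load 32 34 30, .store 33 30 32]), .add 36 36 36]

/-- Colors the points according to the letter colors along their cycles. -/
def doubling : Prog :=
  block [.const 30 0, forLt 30 0 (block [.store 31 30 30, .load 32 8 30, .store 33 30 32]),
    .const 36 1, .add 37 0 4, .whileLt 36 37 doublingRound]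

/-- A word of length `2 * w` at `x` consists of the words of length `w` at `x` and at `d ^ w x`. The
second colors and the new powers are copied to arrays 32 and 34 beforehand, since arrays 7 and 33
are still being read. Colors are numbered afresh from 0 and end up below `n`. -/
theorem wp_doublingRound {w : ℕ} (hW : (n + E + 2) * (n + E + 2) ≤ W)
    (hC : Context L σ) (h31 : ∀ k < n, σ.arr 31 k = k)
    (h33 : ∀ x : Fin n, σ.arr 33 x = (d ^ w) x) (h36 : σ.reg 36 = w) (hw : w ≤ n)
    (h7 : ∀ x : Fin n, σ.arr 7 x < n + E + 2)
    (hQ : ∀ σ' t', Frame doublingRound σ σ' →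
      (∀ x : Fin n, σ'.arr 33 x = (d ^ (w + w)) x) → σ'.reg 36 = w + w →
      (∀ x : Fin n, σ'.arr 7 x < n) →
      (∀ x y : Fin n, σ'.arr 7 x = σ'.arr 7 y ↔ σ.arr 7 x = σ.arr 7 y ∧
        σ.arr 7 ((d ^ w) x) = σ.arr 7 ((d ^ w) y)) →
      t' ≤ t + 40 * n + 15 → Q σ' t') :
    wp W doublingRound Q σ t := by
  apply wp.frame
  have hB : n + n + 2 ≤ W := by
    refine le_trans ?_ hW
    calc n + n + 2 ≤ 2 * (n + E + 2) := by omega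
      _ ≤ _ := Nat.mul_le_mul_right _ (by omega)
  simp only [doublingRound, wp_block_cons, wp_const]
  refine ⟨by omega, ?_⟩
  refine wp_forLt_const (b := n) (fun k σ' => ∀ x : Fin n, (x : ℕ) < k →
    σ'.arr 32 x = σ.arr 7 ((d ^ w) x) ∧ σ'.arr 34 x = (d ^ (w + w)) x) 5 (by simp [hC.reg4])
    (by simp [hC.reg0]) (by omega) rfl rfl rfl (by decide) (by decide) (by simp) (by simp) ?_ ?_
  · intro k σ1 t1 hF _ hk hik h1
    obtain ⟨x, rfl⟩ : ∃ x : Fin n, (x : ℕ) = k := ⟨⟨k, hk⟩, rfl⟩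
    have a33 : ∀ x : Fin n, σ1.arr 33 x = (d ^ w) x := fun x => by
      rw [hF.arr 33 rfl]; exact h33 x
    have a7 : σ1.arr 7 = σ.arr 7 := hF.arr 7 rfl
    simp [hik, a33, a7]
    intro y hy
    by_cases hyx : y = x
    · subst hyx
      simp [pow_add]
    · have : (y : ℕ) ≠ x := fun h => hyx (Fin.ext h)
      rw [Function.update_of_ne this, Function.update_of_ne this]
      exact h1 y (hy.lt_of_ne hyx)
  intro σ1 t1 hF1 _ h1 ht1
  have hC1 : Context L σ1 := Context.of_frame (σ := σ.setReg 30 0) (hC.setReg (by omega)) hF1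
  have a7 : σ1.arr 7 = σ.arr 7 := hF1.arr 7 rfl
  have a31 : ∀ k < n, σ1.arr 31 k = k := fun k hk => by rw [hF1.arr 31 rfl]; exact h31 k hk
  have r36 : σ1.reg 36 = w := by rw [hF1.reg 36 rfl]; simp [h36]
  simp only [wp_block_cons, wp_const, wp_move]
  refine ⟨by omega, by omega, by omega, ?_⟩
  refine wp_refineColors (L := L) (a := 0) (b := n) (lo := 0) (cnt := 0) hW
    ((((hC1.setReg (by omega)).setReg (by omega)).setReg (by omega)).setReg (by omega))
    (by decide) (by decide) (by simp) (by simp [hC1.reg0]) (by simp) (by simp) (by omega)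
    (by omega) (by omega) (by omega) ?_ ?_ ?_ ?_
  · intro q q' _ hq _ hq'
    simp [a31 q hq, a31 q' hq']
  · intro q _ hq
    simpa [a31 q hq, a7] using h7 ⟨q, hq⟩
  · intro q _ hq
    have := (h1 ⟨q, hq⟩ hq).1
    simp at this
    simp [this, h7]
  intro σ2 t2 hF2 _ e2 e3 e4 _ ht2
  simp only [State.arr_setReg] at e3 e4
  have r0 : σ2.reg 0 = n := by rw [hF2.reg 0 rfl]; simp [hC1.reg0]
  have r4 : σ2.reg 4 = 1 := by rw [hF2.reg 4 rfl]; simp [hC1.reg4]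
  have r36 : σ2.reg 36 = w := by rw [hF2.reg 36 rfl]; simp [r36]
  have a34 : ∀ x : Fin n, σ2.arr 34 x = (d ^ (w + w)) x := fun x => by
    rw [hF2.arr 34 rfl]; exact (h1 x x.2).2
  have f3 : ∀ x : Fin n, σ2.arr 7 x < n := fun x => by
    have := (e3 x (Nat.zero_le _) x.2).2
    rw [a31 x x.2] at this
    omega
  have f4 : ∀ x y : Fin n, σ2.arr 7 x = σ2.arr 7 y ↔ σ.arr 7 x = σ.arr 7 y ∧
        σ.arr 7 ((d ^ w) x) = σ.arr 7 ((d ^ w) y) := fun x y => by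
    have := e4 x y (Nat.zero_le _) x.2 (Nat.zero_le _) y.2
    rwa [a31 x x.2, a31 y y.2, a7, (h1 x x.2).1, (h1 y y.2).1] at this
  simp only [wp_block_cons, wp_const]
  refine ⟨by omega, ?_⟩
  refine wp_forLt_const (b := n) (fun k σ' => ∀ x : Fin n, (x : ℕ) < k →
    σ'.arr 33 x = (d ^ (w + w)) x) 2 (by simp [r4])
    (by simp [r0]) (by omega) rfl rfl rfl (by decide) (by decide) (by simp) (by simp) ?_ ?_
  · intro k σ3 t3 hF _ hk hik h3
    have a34' : σ3.arr 34 k = (d ^ (w + w)) ⟨k, hk⟩ := by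
      rw [hF.arr 34 rfl]; exact a34 ⟨k, hk⟩
    simp [hik, a34']
    intro x hx
    simpa using Stores.update (σ' := σ3.setArr 33 k ((d ^ (w + w)) ⟨k, hk⟩)) hk h3 (by simp) x
      (Nat.lt_succ_of_le hx)
  · intro σ3 t3 hF3 _ h3 ht3
    have r36' : σ3.reg 36 = w := by rw [hF3.reg 36 rfl]; simp [r36]
    have a7' : σ3.arr 7 = σ2.arr 7 := hF3.arr 7 rfl
    simp at ht1 ht2 ht3
    simp only [wp_block_singleton, wp_add]
    refine ⟨by omega, fun hF' => hQ _ _ hF' (by simpa using fun x : Fin n => h3 x x.2)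
      (by simp [r36']) (by simpa [a7'] using f3) (by simpa [a7'] using f4) (by omega)⟩

theorem wp_doubling (hW : (n + E + 2) * (n + E + 2) ≤ W)
    (hC : Context L σ) (hd : ActsOnCycles s d) (h8 : Stores σ 8 d)
    (h7 : ∀ x : Fin n, σ.arr 7 x < n + E + 2)
    (hsim : ∀ x y : Fin n, σ.arr 7 x = σ.arr 7 y ↔ LetterSim s d m x y)
    (hQ : ∀ σ' t', Frame doubling σ σ' → (∀ x : Fin n, σ'.arr 7 x < n) →
      (∀ x y : Fin n, σ'.arr 7 x = σ'.arr 7 y ↔ Sim s d x y) →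
      t' ≤ t + (40 * n + 16) * (Nat.log 2 n + 1) + 5 * n + 10 → Q σ' t') :
    wp W doubling Q σ t := by
  apply wp.frame
  have hB : n + n + 2 ≤ W := by
    refine le_trans ?_ hW
    calc n + n + 2 ≤ 2 * (n + E + 2) := by omega
      _ ≤ _ := Nat.mul_le_mul_right _ (by omega)
  simp only [doubling, wp_block_cons, wp_const]
  refine ⟨by omega, ?_⟩
  refine wp_forLt_const (b := n) (fun k σ' => ∀ x : Fin n, (x : ℕ) < k →
    σ'.arr 31 x = x ∧ σ'.arr 33 x = d x) 3 (by simp [hC.reg4])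
    (by simp [hC.reg0]) (by omega) rfl rfl rfl (by decide) (by decide) (by simp) (by simp) ?_ ?_
  · intro k σ1 t1 hF _ hk hik h1
    obtain ⟨x, rfl⟩ : ∃ x : Fin n, (x : ℕ) = k := ⟨⟨k, hk⟩, rfl⟩
    have a8 : σ1.arr 8 x = d x := by rw [hF.arr 8 rfl]; exact h8 x
    simp [hik, a8]
    intro y hy
    by_cases hyx : y = x
    · subst hyx
      simp
    · have : (y : ℕ) ≠ x := fun h => hyx (Fin.ext h)
      rw [Function.update_of_ne this, Function.update_of_ne this]
      exact h1 y (hy.lt_of_ne hyx)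
  intro σ1 t1 hF1 _ h1 ht1
  have hC1 : Context L σ1 := Context.of_frame (σ := σ.setReg 30 0) (hC.setReg (by omega)) hF1
  have a7 : σ1.arr 7 = σ.arr 7 := hF1.arr 7 rfl
  simp only [wp_block_cons, wp_block_singleton, wp_const, wp_add]
  simp only [State.reg_setReg, Nat.reduceEqDiff, if_false, hC1.reg0, hC1.reg4]
  refine ⟨by omega, by omega, ?_⟩
  simp at ht1
  have hlog : ∀ j, 2 ^ j ≤ n → j ≤ Nat.log 2 n := fun j hj =>
    Nat.le_log_of_pow_le (by norm_num) hj
  -- Round `j` starts only if the previous word length `2 ^ (j - 1)` is at most `n`, which limits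
  -- the number of rounds.
  have htime : ∀ (j t' : ℕ), (j = 0 ∨ 2 ^ (j - 1) ≤ n) → t' ≤ t1 + 2 + (40 * n + 16) * j →
      t' ≤ t1 + 2 + (40 * n + 16) * (Nat.log 2 n + 1) := by
    intro j t' hj ht'
    have hj' : j ≤ Nat.log 2 n + 1 := by
      rcases hj with hj | hj
      · omega
      · have := hlog _ hj
        omega
    exact ht'.trans (Nat.add_le_add_left (Nat.mul_le_mul_left _ hj') _)
  refine wp_while (fun σ' t' => ∃ j, σ'.reg 36 = 2 ^ j ∧ (j = 0 ∨ 2 ^ (j - 1) ≤ n) ∧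
    (∀ k < n, σ'.arr 31 k = k) ∧ (∀ x : Fin n, σ'.arr 33 x = (d ^ 2 ^ j) x) ∧
    (∀ x : Fin n, σ'.arr 7 x < n + E + 2) ∧ (0 < j → ∀ x : Fin n, σ'.arr 7 x < n) ∧
    (∀ x y : Fin n, σ'.arr 7 x = σ'.arr 7 y ↔
      ∀ l < 2 ^ j, LetterSim s d m ((d ^ l) x) ((d ^ l) y)) ∧
    t' ≤ t1 + 2 + (40 * n + 16) * j) (t1 + 2 + (40 * n + 16) * (Nat.log 2 n + 1)) ?_ ?_ ?_ ?_
  · refine ⟨0, by simp, by simp, ?_, ?_, by simpa [a7] using h7, by simp, by simpa [a7] using hsim,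
      by simp⟩
    · simpa using fun k hk => (h1 ⟨k, hk⟩ hk).1
    · simpa using fun x : Fin n => (h1 x x.2).2
  · rintro σ2 t2 - ⟨j, -, hj, -, -, -, -, -, ht2⟩
    exact htime j _ hj ht2
  · rintro σ2 t2 hF ⟨j, g1, g2, g3, g4, g5, g6, g7, ht2⟩ hlt
    have hC2 : Context L σ2 := Context.of_frame (σ := (σ1.setReg 36 1).setReg 37 (n + 1))
      ((hC1.setReg (by omega)).setReg (by omega)) hF
    have r37 : σ2.reg 37 = n + 1 := by rw [hF.reg 37 rfl]; simp
    rw [g1, r37] at hlt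
    refine wp_doublingRound (L := L) (w := 2 ^ j) (d := d) hW hC2 g3 g4 g1 (by omega) g5 ?_
    intro σ3 t3 hF3 e1 e2 e3 e4 ht3
    have hpow : 2 ^ j + 2 ^ j = 2 ^ (j + 1) := by ring
    rw [hpow] at e1 e2
    refine ⟨j + 1, e2, Or.inr (by rw [Nat.add_sub_cancel]; omega), ?_, e1, fun x => ?_,
      fun _ => e3, fun x y => ?_, ?_⟩
    · rw [hF3.arr 31 rfl]
      exact g3
    · have := e3 x
      omega
    · rw [e4, g7, g7, ← hpow]
      constructor
      · rintro ⟨f1, f2⟩ l hl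
        by_cases hl' : l < 2 ^ j
        · exact f1 l hl'
        · have := f2 (l - 2 ^ j) (by omega)
          rwa [← Equiv.Perm.mul_apply, ← Equiv.Perm.mul_apply, ← pow_add,
            Nat.sub_add_cancel (by omega)] at this
      · intro f
        refine ⟨fun l hl => f l (by omega), fun l hl => ?_⟩
        rw [← Equiv.Perm.mul_apply, ← Equiv.Perm.mul_apply, ← pow_add]
        exact f _ (by omega)
    · rw [Nat.mul_succ]
      omega
  · rintro σ2 t2 hF ⟨j, g1, g2, g3, g4, g5, g6, g7, ht2⟩ hle hF'
    have r37 : σ2.reg 37 = n + 1 := by rw [hF.reg 37 rfl]; simp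
    rw [g1, r37] at hle
    have ht := htime j t2 g2 ht2
    refine hQ _ _ hF' (fun x => g6 ?_ x) (fun x y => ?_) (by omega)
    -- If no round took place, then `1 ≥ n + 1`, and there are no points.
    · have := x.2
      by_contra h0
      obtain rfl : j = 0 := by omega
      simp at hle
      omega
    · rw [g7, sim_iff_letterSim hd (N := 2 ^ j) (by omega)]

/-! ### Classes of orbits -/

/-- Computes the classes of the orbits in array 9. -/
def orbitClasses : Prog :=
  block [.const 30 0, forLt 30 0 (block [.load 31 25 30, .load 32 7 30, .sub 32 0 32,
      .load 33 35 31, .ifLt 33 32 (.store 35 31 32) .skip]),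
    .const 30 0, forLt 30 0 (block [.load 31 25 30, .load 32 35 31, .sub 32 0 32,
      .store 9 30 32])]

/-- A class is named by the least color on the cycle. The root stores the maximum of `n` minus the
color, so that the initial zero means that no color has been seen. Since similarity passes to powers
of `d`, cycles with one common color have the same set of colors, hence the same minimum. -/
theorem wp_orbitClasses (hW : n + 1 ≤ W) (h0 : σ.reg 0 = n) (h4 : σ.reg 4 = 1)
    (hpos : PositionedOn d Finset.univ σ) (h35 : ∀ k, σ.arr 35 k = 0)
    (h7 : ∀ x : Fin n, σ.arr 7 x < n)
    (hsim : ∀ x y : Fin n, σ.arr 7 x = σ.arr 7 y ↔ Sim s d x y)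
    (hQ : ∀ σ' t', Frame orbitClasses σ σ' → (∀ x : Fin n, σ'.arr 9 x < n) →
      (∀ x y : Fin n, σ'.arr 9 x = σ'.arr 9 y ↔ ∃ x', d.SameCycle x x' ∧ ∃ y',
        d.SameCycle y y' ∧ σ.arr 7 x' = σ.arr 7 y') →
      t' ≤ t + 20 * n + 10 → Q σ' t') :
    wp W orbitClasses Q σ t := by
  apply wp.frame
  simp only [orbitClasses, wp_block_cons, wp_const]
  refine ⟨by omega, ?_⟩
  refine wp_forLt_const (b := n) (fun k σ' =>
    (∀ z : Fin n, (z : ℕ) < k → n - σ.arr 7 z ≤ σ'.arr 35 (σ.arr 25 z)) ∧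
    ∀ r, σ'.arr 35 r = 0 ∨ ∃ z : Fin n, σ.arr 25 z = r ∧ σ'.arr 35 r = n - σ.arr 7 z) 6
    (by simp [h4]) (by simp [h0]) (by omega) rfl rfl rfl (by decide) (by decide) (by simp)
    (by simp [h35]) ?_ ?_
  · rintro k σ1 t1 hF _ hk hik ⟨g1, g2⟩
    obtain ⟨x, rfl⟩ : ∃ x : Fin n, (x : ℕ) = k := ⟨⟨k, hk⟩, rfl⟩
    have a7 : σ1.arr 7 = σ.arr 7 := hF.arr 7 rfl
    have a25 : σ1.arr 25 = σ.arr 25 := hF.arr 25 rfl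
    have r0 : σ1.reg 0 = n := by rw [hF.reg 0 rfl]; simp [h0]
    simp [hik, a7, a25, r0]
    refine ⟨fun hlt => ⟨fun z hz => ?_, fun r => ?_⟩, fun hle => ⟨fun z hz => ?_, g2⟩⟩
    · by_cases hr : σ.arr 25 z = σ.arr 25 x
      · rw [hr, Function.update_self]
        rcases hz.lt_or_eq with hz | hz
        · have := g1 z hz
          rw [hr] at this
          omega
        · rw [hz]
          omega
      · rw [Function.update_of_ne hr]
        have := g1 z (hz.lt_of_ne fun h => hr (h ▸ rfl))
        omega
    · by_cases hr : r = σ.arr 25 x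
      · subst hr
        right
        exact ⟨x, rfl, by simp⟩
      · rw [Function.update_of_ne hr]
        exact g2 r
    · rcases hz.lt_or_eq with hz | rfl
      · have := g1 z hz
        omega
      · omega
  rintro σ1 t1 hF1 _ ⟨g1, g2⟩ ht1
  have r0 : σ1.reg 0 = n := by rw [hF1.reg 0 rfl]; simp [h0]
  have r4 : σ1.reg 4 = 1 := by rw [hF1.reg 4 rfl]; simp [h4]
  have a25 : σ1.arr 25 = σ.arr 25 := hF1.arr 25 rfl
  have key : ∀ x : Fin n, ∃ z : Fin n, d.SameCycle x z ∧
      n - σ1.arr 35 (σ.arr 25 x) = σ.arr 7 z ∧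
      ∀ z' : Fin n, d.SameCycle x z' → σ.arr 7 z ≤ σ.arr 7 z' := by
    intro x
    have hx := h7 x
    rcases g2 (σ.arr 25 x) with h | ⟨z, hz, hz'⟩
    · have := g1 x x.2
      omega
    · have hzn := h7 z
      refine ⟨z, hpos.root_eq_iff.1 hz.symm, by omega, fun z' hz1 => ?_⟩
      have := g1 z' z'.2
      rw [hpos.root_eq hz1] at this
      omega
  simp only [wp_block_cons, wp_block_singleton, wp_const]
  refine ⟨by omega, ?_⟩
  refine wp_forLt_const (b := n) (fun k σ' => ∀ x : Fin n, (x : ℕ) < k →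
    σ'.arr 9 x = n - σ1.arr 35 (σ.arr 25 x)) 4
    (by simp [r4]) (by simp [r0]) (by omega) rfl rfl rfl (by decide) (by decide) (by simp)
    (by simp) ?_ ?_
  · intro k σ2 t2 hF _ hk hik h2
    obtain ⟨x, rfl⟩ : ∃ x : Fin n, (x : ℕ) = k := ⟨⟨k, hk⟩, rfl⟩
    have a25' : σ2.arr 25 = σ.arr 25 := by rw [hF.arr 25 rfl]; exact a25
    have a35 : σ2.arr 35 = σ1.arr 35 := hF.arr 35 rfl
    have r0' : σ2.reg 0 = n := by rw [hF.reg 0 rfl]; simp [r0]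
    simp [hik, a25', a35, r0']
    intro y hy
    by_cases hyx : y = x
    · simp [hyx]
    · rw [Function.update_of_ne (fun h => hyx (Fin.ext h))]
      exact h2 y (hy.lt_of_ne hyx)
  · intro σ2 t2 hF _ h2 ht2 hF'
    simp at ht1 ht2
    refine hQ _ _ hF' (fun x => ?_) (fun x y => ?_) (by omega)
    · obtain ⟨z, -, hz, -⟩ := key x
      rw [h2 x x.2, hz]
      exact h7 z
    · rw [h2 x x.2, h2 y y.2]
      obtain ⟨z, hz1, hz2, hz3⟩ := key x
      obtain ⟨z', hz1', hz2', hz3'⟩ := key y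
      rw [hz2, hz2']
      refine ⟨fun h => ⟨z, hz1, z', hz1', h⟩, ?_⟩
      have main : ∀ x y x' y' z z' : Fin n, d.SameCycle x x' → d.SameCycle y y' →
          σ.arr 7 x' = σ.arr 7 y' → d.SameCycle x z →
          (∀ w : Fin n, d.SameCycle y w → σ.arr 7 z' ≤ σ.arr 7 w) → σ.arr 7 z' ≤ σ.arr 7 z := by
        intro x y x' y' z z' h1 h2 h3 h4 h5
        obtain ⟨j, -, rfl⟩ := SameCycle.exists_pow_lt (h1.symm.trans h4)
        have h6 := (hsim x' y').1 h3
        rw [(hsim _ _).2 (h6.pow j)]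
        exact h5 _ (h2.trans (sameCycle_pow_apply d y' j))
      rintro ⟨x', hx', y', hy', hxy⟩
      exact le_antisymm (main y x y' x' z' z hy' hx' hxy.symm hz1' hz3)
        (main x y x' y' z z' hx' hy' hxy hz1 hz3')

end

end OrbitEquivalence

namespace OrbitEquivalence

/-! ### Matching two equivalent orbits -/

section
variable {n m : ℕ} {s : Fin m → Equiv.Perm (Fin n)} {d : Equiv.Perm (Fin n)} {π : Fin n → Fin n}
  {Δ₁ Δ₂ : Set (Fin n)} {x y z : Fin n} {W : ℕ} {σ : State} {t : ℕ} {Q : State → ℕ → Prop}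
  {Γ : Subgroup (Equiv.Perm (Fin n))} {b b' : Fin n → Fin n}

theorem bijective_of_covers_set {Δ : Set (Fin n)} {f : ℕ → ℕ}
    (h : ∀ x ∈ Δ, ∃ k < Δ.ncard, f k = (x : ℕ)) :
    (∀ k < Δ.ncard, ∃ x ∈ Δ, f k = (x : ℕ)) ∧
      ∀ k < Δ.ncard, ∀ k' < Δ.ncard, f k = f k' → k = k' := by
  classical
  have h1 : Δ.ncard = Δ.toFinset.card := Set.ncard_eq_toFinset_card' Δ
  rw [h1] at h ⊢
  have h2 := bijective_of_covers (S := Δ.toFinset) (f := f) (v := fun x : Fin n => (x : ℕ))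
    Fin.val_injective (fun x hx => h x (by simpa using hx))
  simpa using h2

theorem ncard_le_of_subset (Δ : Set (Fin n)) : Δ.ncard ≤ n := by
  simpa using Set.ncard_le_card Δ

theorem minimalPeriod_le_ncard (h : ∀ k : ℕ, (d ^ k) x ∈ Δ₁) :
    Function.minimalPeriod d x ≤ Δ₁.ncard := by
  have h1 : Set.InjOn (fun k => (d ^ k) x) (Finset.range (Function.minimalPeriod d x)) := by
    intro j hj k hk hjk
    exact eq_of_pow_apply_eq (by simpa using hj) (by simpa using hk) hjk
  have h2 := h1.ncard_image
  rw [Set.ncard_coe_finset, Finset.card_range] at h2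
  rw [← h2]
  exact Set.ncard_le_ncard (by rintro _ ⟨k, -, rfl⟩; exact h k) (Set.toFinite _)

/-- Finds a point of the second orbit with the color of the first point of the first orbit, and
walks along both canonical cycles. -/
def matchAlongCycles : Prog :=
  block [.const 4 1, .const 20 0, .load 21 10 20, .load 22 7 21,
    forLt 20 1 (block [.load 23 11 20, .load 24 7 23,
      .ifLt 24 22 .skip (.ifLt 22 24 .skip (.move 25 23))]),
    .const 20 0, forLt 20 0 (block [.store 12 21 25, .load 21 8 21, .load 25 8 25])]

theorem wp_matchAlongCycles (hW : n + 2 ≤ W) (hd : CyclesAreOrbits s d) (hinv : IsInvariant s d)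
    (hπ : ∀ x y, π x = π y ↔ Sim s d x y) (h₁ : Δ₁ = MulAction.orbit (group s) x)
    (h₂ : Δ₂ = MulAction.orbit (group s) y) (heq : OrbitEquiv (group s) Δ₁ Δ₂)
    (hσ : EncodesOrbits Δ₁ Δ₂ σ) (h7 : Stores σ 7 π) (h8 : Stores σ 8 d)
    (hQ : ∀ σ' t', StoresMatching (group s) Δ₁ Δ₂ σ' → t' ≤ t + 20 * Δ₁.ncard + 20 → Q σ' t') :
    wp W matchAlongCycles Q σ t := by
  obtain ⟨b, hb⟩ := heq
  have hcard : Δ₁.ncard = Δ₂.ncard := by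
    rw [← hb.1.image_eq, hb.1.injOn.ncard_image]
  have hn := ncard_le_of_subset Δ₁
  obtain ⟨l1, -⟩ := bijective_of_covers_set hσ.points_fst
  obtain ⟨l2, -⟩ := bijective_of_covers_set hσ.points_snd
  have hpos : 0 < Δ₁.ncard := by
    rw [Set.ncard_pos (Set.toFinite _), h₁]
    exact ⟨x, MulAction.mem_orbit_self x⟩
  obtain ⟨x₀, hx₀, e10⟩ := l1 0 hpos
  have hex : ∃ y₀ ∈ Δ₂, π x₀ = π y₀ := by
    refine ⟨b x₀, hb.1.mapsTo hx₀, (hπ _ _).2 ?_⟩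
    subst h₁ h₂
    exact hb.sim hinv hx₀
  simp only [matchAlongCycles, wp_block_cons, wp_const, wp_load]
  have e7 : ∀ z : Fin n, σ.arr 7 z = π z := h7
  have e8 : ∀ z : Fin n, σ.arr 8 z = d z := h8
  simp only [State.reg_setReg, State.arr_setReg, Nat.reduceEqDiff, if_true, if_false, e10, e7]
  refine ⟨by omega, by omega, ?_⟩
  -- The scan keeps the last point with the right color. The invariant refers to one fixed witness:
  -- once its cell has been passed, register 25 holds some such point.
  refine wp_forLt_const (b := Δ₂.ncard) (fun k σ' => (∃ k' < k, σ'.arr 11 k' =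
      ((Classical.choose hex : Fin n) : ℕ)) → ∃ y₀ ∈ Δ₂, π x₀ = π y₀ ∧ σ'.reg 25 = y₀) 5 (by simp)
    (by simp [hσ.card_snd]) (by omega) rfl rfl rfl (by decide) (by decide) (by simp) (by simp) ?_ ?_
  · rintro k σ1 t1 hF - hk hik h1
    obtain ⟨y₁, hy₁, e11⟩ := l2 k hk
    have a11 : σ1.arr 11 = σ.arr 11 := hF.arr 11 rfl
    have a7 : ∀ z : Fin n, σ1.arr 7 z = π z := fun z => by rw [hF.arr 7 rfl]; exact h7 z
    have r22 : σ1.reg 22 = π x₀ := by rw [hF.reg 22 rfl]; simp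
    simp only [wp_block_cons, wp_block_singleton, wp_load, wp_ifLt, wp_skip, wp_move]
    simp only [State.reg_setReg, State.arr_setReg, Nat.reduceEqDiff, if_true, if_false, hik, a11,
      e11, a7, r22]
    have hsame : π x₀ ≠ π y₁ → (∃ k' < k + 1, σ.arr 11 k' =
        ((Classical.choose hex : Fin n) : ℕ)) → ∃ y₀ ∈ Δ₂, π x₀ = π y₀ ∧ σ1.reg 25 = y₀ := by
      rintro hne ⟨k', hk', h⟩
      rcases (Nat.le_of_lt_succ hk').lt_or_eq with hk' | rfl
      · exact h1 ⟨k', hk', by rw [a11, h]⟩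
      · rw [e11] at h
        rw [Fin.ext h] at hne
        exact absurd (Classical.choose_spec hex).2 hne
    refine ⟨fun hlt => ⟨hsame fun h => ?_, by omega⟩, fun hle => ⟨fun hlt => ⟨hsame fun h => ?_,
      by omega⟩, fun hle' => ⟨fun _ => ⟨y₁, hy₁, Fin.ext (le_antisymm hle hle'), rfl⟩, by omega⟩⟩⟩
    · rw [h] at hlt; omega
    · rw [h] at hlt; omega
  intro σ1 t1 hF1 _ h1 ht1
  have a11 : σ1.arr 11 = σ.arr 11 := hF1.arr 11 rfl
  have a8 : ∀ z : Fin n, σ1.arr 8 z = d z := fun z => by rw [hF1.arr 8 rfl]; exact h8 z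
  have r0 : σ1.reg 0 = Δ₁.ncard := by rw [hF1.reg 0 rfl]; simp [hσ.card_fst]
  have r4 : σ1.reg 4 = 1 := by rw [hF1.reg 4 rfl]; simp
  have r21 : σ1.reg 21 = x₀ := by rw [hF1.reg 21 rfl]; simp
  obtain ⟨y₀, hy₀, hπ₀, r25⟩ : ∃ y₀ ∈ Δ₂, π x₀ = π y₀ ∧ σ1.reg 25 = y₀ := by
    refine h1 ?_
    rw [a11]
    exact hσ.points_snd _ (Classical.choose_spec hex).1
  have hsim := (hπ _ _).1 hπ₀
  simp only [wp_block_cons, wp_block_singleton, wp_const]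
  refine ⟨by omega, ?_⟩
  refine wp_forLt_const (b := Δ₁.ncard) (fun k σ' => σ'.reg 21 = (d ^ k) x₀ ∧
    σ'.reg 25 = (d ^ k) y₀ ∧ ∀ j < k, σ'.arr 12 ((d ^ j) x₀) = (d ^ j) y₀) 3 (by simp [r4])
    (by simp [r0]) (by omega) rfl rfl rfl (by decide) (by decide) (by simp)
    (by simp [r21, r25]) ?_ ?_
  · rintro k σ2 t2 hF - hk hik ⟨g1, g2, g3⟩
    have a8' : ∀ z : Fin n, σ2.arr 8 z = d z := fun z => by rw [hF.arr 8 rfl]; exact a8 z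
    simp [g1, g2, a8', pow_succ']
    intro j hj
    by_cases hjk : (d ^ j) x₀ = (d ^ k) x₀
    · rw [hjk, Function.update_self, (hsim.pow_eq_iff).1 hjk]
    · rw [Function.update_of_ne (fun h => hjk (Fin.ext h))]
      refine g3 j (hj.lt_of_ne ?_)
      rintro rfl
      exact hjk rfl
  · rintro σ2 t2 hF - ⟨-, -, g3⟩ ht2
    simp at ht1 ht2
    refine hQ _ _ ?_ (by omega)
    obtain ⟨b', hb'⟩ := hsim.exists_map
    subst h₁ h₂
    have o1 := MulAction.orbit_eq_iff.2 hx₀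
    have o2 := MulAction.orbit_eq_iff.2 hy₀
    refine ⟨b', by rw [← o1, ← o2]; exact hsim.isCommutingBijection hd hb', fun z hz => ?_⟩
    rw [← o1, hd] at hz
    obtain ⟨j, hj, rfl⟩ := SameCycle.exists_pow_lt hz
    -- The cycle is contained in `Δ₁`, so `Δ₁.ncard` steps visit all of it.
    rw [hb', g3 j (hj.trans_le (minimalPeriod_le_ncard fun k => ?_))]
    rw [← o1, hd]
    exact sameCycle_pow_apply d x₀ k

theorem group_mem_orbit_iff {φ : Equiv.Perm (Fin n)} (hφ : φ ∈ group s) :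
    φ z ∈ MulAction.orbit (group s) x ↔ z ∈ MulAction.orbit (group s) x := by
  have h1 : ∀ z, φ z ∈ MulAction.orbit (group s) z := fun z => ⟨⟨φ, hφ⟩, rfl⟩
  exact ⟨fun h => mem_orbit_trans h (MulAction.mem_orbit_symm.1 (h1 z)),
    fun h => mem_orbit_trans h (h1 z)⟩

/-- On orbits with at most two points, all bijections commute. -/
theorem IsCommutingBijection.of_ncard_le_two (h₁ : Δ₁ = MulAction.orbit (group s) x)
    (h₂ : Δ₂ = MulAction.orbit (group s) y) (hb : IsCommutingBijection (group s) Δ₁ Δ₂ b)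
    (hcard : Δ₂.ncard ≤ 2) (hb' : Set.BijOn b' Δ₁ Δ₂) :
    IsCommutingBijection (group s) Δ₁ Δ₂ b' := by
  refine ⟨hb', fun φ hφ δ hδ => ?_⟩
  have htwo : ∀ u ∈ Δ₂, ∀ v ∈ Δ₂, ∀ w ∈ Δ₂, u = v ∨ u = w ∨ v = w := by
    intro u hu v hv w hw
    by_contra! h
    have := (Set.two_lt_ncard_iff (Set.toFinite Δ₂)).2 ⟨u, v, w, hu, hv, hw, h.1, h.2.1, h.2.2⟩
    omega
  have hm1 : φ δ ∈ Δ₁ := by rw [h₁] at hδ ⊢; exact (group_mem_orbit_iff hφ).2 hδ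
  have hm2 : ∀ z ∈ Δ₂, φ z ∈ Δ₂ := by rw [h₂]; exact fun z hz => (group_mem_orbit_iff hφ).2 hz
  -- On at most two points, a permutation with a fixed point is trivial. So `φ` either fixes all of
  -- `Δ₂` or has no fixed point there, and `b` transfers this alternative to `Δ₁`.
  have hfix : ∀ p ∈ Δ₂, ∀ q ∈ Δ₂, φ p = p → φ q = q := by
    intro p hp q hq h
    rcases htwo p hp q hq _ (hm2 q hq) with rfl | h' | h'
    · exact h
    · have : φ p = φ q := by rw [h, ← h']
      rw [φ.injective.eq_iff] at this
      rw [← this, h]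
    · exact h'.symm
  by_cases hφδ : φ δ = δ
  · rw [hφδ]
    refine hfix (b δ) (hb.1.mapsTo hδ) _ (hb'.mapsTo hδ) ?_
    rw [hb.2 φ hφ δ hδ, hφδ]
  · have h3 : φ (b' δ) ≠ b' δ := by
      intro h
      have := hfix _ (hb'.mapsTo hδ) _ (hb.1.mapsTo hδ) h
      rw [hb.2 φ hφ δ hδ] at this
      exact hφδ (hb.1.injOn hm1 hδ this)
    have h4 : b' (φ δ) ≠ b' δ := fun h => hφδ (hb'.injOn hm1 hδ h)
    rcases htwo _ (hm2 _ (hb'.mapsTo hδ)) _ (hb'.mapsTo hm1) _ (hb'.mapsTo hδ) with h | h | h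
    · exact h
    · exact absurd h h3
    · exact absurd h h4

/-- On an orbit with at least three points and the full symmetric group as the induced action,
no two points are similar. -/
theorem Sim.eq_of_symmetric (hd : CyclesAreOrbits s d) (hcard : 2 < Δ₁.ncard)
    (hsym : HasNaturalSymmetricAction (group s) Δ₁) {z z' : Fin n}
    (hz : z ∈ Δ₁) (hz' : z' ∈ Δ₁) (h : Sim s d z z') : z = z' := by
  by_contra hne
  obtain ⟨b, hb⟩ := h.exists_map
  have hb2 := h.isCommutingBijection hd hb
  have hbz : b z = z' := by simpa using hb 0
  obtain ⟨w, hw, hwz, hwz'⟩ : ∃ w ∈ Δ₁, w ≠ z ∧ w ≠ z' := by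
    by_contra! h
    have hsub : Δ₁ ⊆ {z, z'} := fun w hw => by
      by_cases hwz : w = z
      · simp [hwz]
      · simp [h w hw hwz]
    have := Set.ncard_le_ncard hsub (Set.toFinite _)
    rw [Set.ncard_pair hne] at this
    omega
  -- The exchange of `z'` with a third point `w` fixes `z` but moves `b z = z'`, which is impossible
  -- for a map commuting with `b`.
  obtain ⟨φ, hφ, hφ'⟩ := hsym (Equiv.swap z' w) (by
    refine ⟨fun v hv => ?_, (Equiv.injective _).injOn, fun v hv => ?_⟩
    · rw [Equiv.swap_apply_def]
      split_ifs <;> assumption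
    · refine ⟨Equiv.swap z' w v, ?_, by simp⟩
      rw [Equiv.swap_apply_def]
      split_ifs <;> assumption)
  have h1 : φ z = z := by rw [hφ' z hz, Equiv.swap_apply_of_ne_of_ne hne hwz.symm]
  have h2 : φ z' = w := by rw [hφ' z' hz', Equiv.swap_apply_left]
  have h3 := hb2.2 φ hφ z (MulAction.mem_orbit_self z)
  rw [hbz, h1, h2, hbz] at h3
  exact hwz' h3

/-- Matches the points of the two orbits by their colors (by their positions in the lists if
there are at most two points). -/
def matchByColors : Prog :=
  block [.const 4 1, .const 5 3, .const 20 0, .ifLt 0 5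
    (forLt 20 0 (block [.load 21 10 20, .load 22 11 20, .store 12 21 22]))
    (block [forLt 20 1 (block [.load 21 11 20, .load 22 7 21, .store 13 22 21]), .const 20 0,
      forLt 20 0 (block [.load 21 10 20, .load 22 7 21, .load 22 13 22, .store 12 21 22])])]

/-- With three or more points, colors are distinct on `Δ₁`, and also on `Δ₂` because a commuting
bijection preserves them. Array 13 inverts the coloring on `Δ₂`; the colors looked up all occur
there, so its other cells are irrelevant. -/
theorem wp_matchByColors (hW : n + 3 ≤ W) (hd : CyclesAreOrbits s d) (hinv : IsInvariant s d)
    (hπ : ∀ x y, π x = π y ↔ Sim s d x y) (h₁ : Δ₁ = MulAction.orbit (group s) x)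
    (h₂ : Δ₂ = MulAction.orbit (group s) y) (heq : OrbitEquiv (group s) Δ₁ Δ₂)
    (hsym : HasNaturalSymmetricAction (group s) Δ₁)
    (hσ : EncodesOrbits Δ₁ Δ₂ σ) (h7 : Stores σ 7 π)
    (hQ : ∀ σ' t', StoresMatching (group s) Δ₁ Δ₂ σ' → t' ≤ t + 20 * Δ₁.ncard + 20 → Q σ' t') :
    wp W matchByColors Q σ t := by
  obtain ⟨b, hb⟩ := heq
  have hcard : Δ₁.ncard = Δ₂.ncard := by
    rw [← hb.1.image_eq, hb.1.injOn.ncard_image]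
  have hn := ncard_le_of_subset Δ₁
  obtain ⟨l1, i1⟩ := bijective_of_covers_set hσ.points_fst
  obtain ⟨l2, i2⟩ := bijective_of_covers_set hσ.points_snd
  have e7 : ∀ z : Fin n, σ.arr 7 z = π z := h7
  simp only [matchByColors, wp_block_cons, wp_block_singleton, wp_const, wp_ifLt]
  simp only [State.reg_setReg, Nat.reduceEqDiff, if_true, if_false, hσ.card_fst]
  refine ⟨by omega, by omega, by omega, fun hlt => ?_, fun hle => ?_⟩
  · refine wp_forLt_const (b := Δ₁.ncard) (fun k σ' => ∀ j < k, σ'.arr 12 (σ.arr 10 j) =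
      σ.arr 11 j) 3 (by simp) (by simp [hσ.card_fst]) (by omega) rfl rfl rfl (by decide)
      (by decide) (by simp) (by simp) ?_ ?_
    · intro k σ1 t1 hF _ hk hik h1
      have a10 : σ1.arr 10 = σ.arr 10 := hF.arr 10 rfl
      have a11 : σ1.arr 11 = σ.arr 11 := hF.arr 11 rfl
      simp [hik, a10, a11]
      intro j hj
      rcases hj.lt_or_eq with hj | rfl
      · rw [Function.update_of_ne fun h => ?_, h1 j hj]
        have := i1 j (hj.trans hk) k hk h
        omega
      · simp
    · intro σ1 t1 hF _ h1 ht1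
      simp at ht1
      refine hQ _ _ ?_ (by omega)
      have hex : ∀ z ∈ Δ₁, ∃ w ∈ Δ₂, σ1.arr 12 z = (w : Fin n) ∧
          ∃ k < Δ₁.ncard, σ.arr 10 k = z ∧ σ.arr 11 k = w := by
        intro z hz
        obtain ⟨k, hk, e10⟩ := hσ.points_fst z hz
        obtain ⟨w, hw, e11⟩ := l2 k (hcard ▸ hk)
        exact ⟨w, hw, by rw [← e10, h1 k hk, e11], k, hk, e10, e11⟩
      choose! b' hb1 hb2 hb3 using hex
      refine ⟨b', IsCommutingBijection.of_ncard_le_two h₁ h₂ hb (by omega) ⟨hb1, ?_, ?_⟩, hb2⟩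
      · intro z hz z' hz' hzz
        obtain ⟨k, hk, f1, f2⟩ := hb3 z hz
        obtain ⟨k', hk', f1', f2'⟩ := hb3 z' hz'
        obtain rfl := i2 k (hcard ▸ hk) k' (hcard ▸ hk') (by rw [f2, f2', hzz])
        exact Fin.ext (f1.symm.trans f1')
      · intro w hw
        obtain ⟨k, hk, e11⟩ := hσ.points_snd w hw
        obtain ⟨z, hz, e10⟩ := l1 k (hcard ▸ hk)
        refine ⟨z, hz, Fin.ext ?_⟩
        rw [← hb2 z hz, ← e10, h1 k (hcard ▸ hk), e11]
  · have hinj₁ : ∀ z ∈ Δ₁, ∀ z' ∈ Δ₁, π z = π z' → z = z' := fun z hz z' hz' h =>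
      ((hπ _ _).1 h).eq_of_symmetric hd (by omega) hsym hz hz'
    have hπb : ∀ z ∈ Δ₁, π (b z) = π z := by
      subst h₁ h₂
      exact fun z hz => ((hπ _ _).2 (hb.sim hinv hz)).symm
    have hinj₂ : ∀ z ∈ Δ₂, ∀ z' ∈ Δ₂, π z = π z' → z = z' := by
      intro z hz z' hz' h
      obtain ⟨w, hw, rfl⟩ := hb.1.surjOn hz
      obtain ⟨w', hw', rfl⟩ := hb.1.surjOn hz'
      rw [hπb w hw, hπb w' hw'] at h
      rw [hinj₁ w hw w' hw' h]
    refine wp_forLt_const (b := Δ₂.ncard) (fun k σ' => ∀ j < k, ∀ z : Fin n, σ.arr 11 j = z →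
      σ'.arr 13 (π z) = z) 3 (by simp) (by simp [hσ.card_snd]) (by omega) rfl rfl rfl (by decide)
      (by decide) (by simp) (by simp) ?_ ?_
    · intro k σ1 t1 hF _ hk hik h1
      have a11 : σ1.arr 11 = σ.arr 11 := hF.arr 11 rfl
      have a7 : ∀ z : Fin n, σ1.arr 7 z = π z := fun z => by rw [hF.arr 7 rfl]; exact h7 z
      obtain ⟨w, hw, e11⟩ := l2 k hk
      simp [hik, a11, e11, a7]
      intro j hj z hz
      by_cases hzw : z = w
      · simp [hzw]
      · have hjk : j < k := hj.lt_of_ne fun h => hzw (Fin.ext (by rw [← hz, h, e11]))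
        rw [Function.update_of_ne fun h => ?_, h1 j hjk z hz]
        obtain ⟨z', hz', e⟩ := l2 j (hjk.trans hk)
        obtain rfl : z = z' := Fin.ext (hz.symm.trans e)
        exact hzw (hinj₂ z hz' w hw (Fin.ext h))
    intro σ1 t1 hF1 _ h1 ht1
    have a13 : ∀ z ∈ Δ₁, σ1.arr 13 (π z) = b z := by
      intro z hz
      obtain ⟨k, hk, e11⟩ := hσ.points_snd (b z) (hb.1.mapsTo hz)
      rw [← hπb z hz]
      exact h1 k hk _ e11
    have r0 : σ1.reg 0 = Δ₁.ncard := by rw [hF1.reg 0 rfl]; simp [hσ.card_fst]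
    have r4 : σ1.reg 4 = 1 := by rw [hF1.reg 4 rfl]; simp
    have a10 : σ1.arr 10 = σ.arr 10 := hF1.arr 10 rfl
    have a7 : ∀ z : Fin n, σ1.arr 7 z = π z := fun z => by rw [hF1.arr 7 rfl]; exact h7 z
    simp only [wp_block_cons, wp_block_singleton, wp_const]
    refine ⟨by omega, ?_⟩
    refine wp_forLt_const (b := Δ₁.ncard) (fun k σ' => ∀ j < k, ∀ z : Fin n, σ.arr 10 j = z →
      σ'.arr 12 z = b z) 4 (by simp [r4]) (by simp [r0]) (by omega) rfl rfl rfl (by decide)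
      (by decide) (by simp) (by simp) ?_ ?_
    · intro k σ2 t2 hF _ hk hik h2
      have a10' : σ2.arr 10 = σ.arr 10 := by rw [hF.arr 10 rfl]; exact a10
      have a7' : ∀ z : Fin n, σ2.arr 7 z = π z := fun z => by rw [hF.arr 7 rfl]; exact a7 z
      have a13' : σ2.arr 13 = σ1.arr 13 := hF.arr 13 rfl
      obtain ⟨w, hw, e10⟩ := l1 k hk
      simp [hik, a10', e10, a7', a13', a13 w hw]
      intro j hj z hz
      by_cases hzw : z = w
      · simp [hzw]
      · have hjk : j < k := hj.lt_of_ne fun h => hzw (Fin.ext (by rw [← hz, h, e10]))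
        rw [Function.update_of_ne (fun h => hzw (Fin.ext h)), h2 j hjk z hz]
    · intro σ2 t2 hF _ h2 ht2
      simp at ht1 ht2
      refine hQ _ _ ⟨b, hb, fun z hz => ?_⟩ (by omega)
      obtain ⟨k, hk, e10⟩ := hσ.points_fst z hz
      exact h2 k hk z e10

end

end OrbitEquivalence

namespace OrbitEquivalence

/-! ### The algorithm -/

theorem PositionedOn.of_frame {n : ℕ} {d : Equiv.Perm (Fin n)} {V : Finset (Fin n)} {P : Prog}
    {σ σ' : State} (h : PositionedOn d V σ) (hF : Frame P σ σ')
    (h24 : P.writesArr 24 = false := by rfl) (h25 : P.writesArr 25 = false := by rfl)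
    (h26 : P.writesArr 26 = false := by rfl) (h27 : P.writesArr 27 = false := by rfl) :
    PositionedOn d V σ' := by
  refine ⟨?_, h.closed, ?_, ?_⟩
  · rw [hF.arr 24 h24]; exact h.marks
  · rw [hF.arr 25 h25, hF.arr 26 h26, hF.arr 27 h27]; exact h.root
  · rw [hF.arr 25 h25]; exact h.root_apply

/-- Computes a canonical order, the refined coloring and the equivalence classes of orbits. -/
def orbitEquivalence : Prog :=
  block [setup, linkEntries, chainEntries, initOverlap, overlapLoop, positions, distances,
    letterColors, doubling, orbitClasses]

/-- By `card_gens_le` the costs proportional to `m` are absorbed into those proportional to `enc s`.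
Only the doubling contributes a logarithmic factor. -/
theorem wp_orbitEquivalence {n m : ℕ} {G : ColoredGraph n} {s : Fin m → Equiv.Perm (Fin n)}
    {c : Equiv.Perm (Fin n)} {W : ℕ} {σ : State} (hs : Function.Injective s)
    (hc : IsInvariantUniqueCycles s c) (hW : (n + enc s + 2) * (n + enc s + 2) ≤ W)
    (hσ : EncodesInput G s c σ) :
    wp W orbitEquivalence (fun σ' t' => ∃ (d : Equiv.Perm (Fin n)) (π cls : Fin n → Fin n),
      t' ≤ 300 * (n + enc s + 2) + (40 * n + 16) * (Nat.log 2 n + 1) ∧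
      Stores σ' 7 π ∧ Stores σ' 8 d ∧ Stores σ' 9 cls ∧ IsCanonicalOrder s c d ∧
      (∀ x y, π x = π y ↔ Sim s d x y) ∧
      ∀ x y, cls x = cls y ↔ ∃ x' ∈ MulAction.orbit (group s) x,
        ∃ y' ∈ MulAction.orbit (group s) y, π x' = π y') σ 0 := by
  obtain ⟨L, hL⟩ := hσ.exists_listing
  have hm := card_gens_le hs
  have hmW : n + enc s + m + 2 ≤ W := by
    refine le_trans ?_ hW
    calc n + enc s + m + 2 ≤ 2 * (n + enc s + 2) := by omega
      _ ≤ _ := Nat.mul_le_mul_right _ (by omega)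
  have hz := hσ.arrs_zero
  unfold orbitEquivalence
  rw [wp_block_cons]
  refine wp_setup hW hσ.card_vertices hσ.card_gens (hσ.regs_zero 3 le_rfl) hL ?_
  intro σ1 t1 F1 C1 ht1
  rw [wp_block_cons]
  refine wp_linkEntries hmW C1 ?_
  intro σ2 t2 F2 L2 ht2
  have C2 := C1.of_frame F2
  rw [wp_block_cons]
  refine wp_chainEntries hmW C2 ?_ ?_
  · intro k
    rw [F2.arr 17 rfl, F1.arr 17 rfl, hz 17 (by decide)]
  intro σ3 t3 F3 H3 ht3
  have C3 := C2.of_frame F3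
  have L3 := L2.of_frame F3
  rw [wp_block_cons]
  refine wp_initOverlap hmW hc C3 L3 H3 ?_ ?_ ?_
  · intro x
    rw [F3.arr 6 rfl, F2.arr 6 rfl, F1.arr 6 rfl]
    exact hσ.cycles x
  · intro k
    rw [F3.arr 19 rfl, F2.arr 19 rfl, F1.arr 19 rfl, hz 19 (by decide)]
  intro σ4 t4 l F4 O4 P4 r20 ht4
  have C4 := C3.of_frame F4
  rw [wp_block_cons]
  refine wp_overlapLoop hmW hc C4 (L3.of_frame F4) (H3.of_frame F4) O4 P4 r20 ?_
  intro σ5 t5 d F5 S5 hd ht5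
  have C5 := C4.of_frame F5
  have hact := hd.actsOnCycles
  rw [wp_block_cons]
  refine wp_positions (by omega) C5.reg0 C5.reg4 S5 ?_ ?_
  · intro k
    rw [F5.arr 24 rfl, F4.arr 24 rfl, F3.arr 24 rfl, F2.arr 24 rfl, F1.arr 24 rfl,
      hz 24 (by decide)]
  intro σ6 t6 F6 P6 ht6
  have C6 := C5.of_frame F6
  rw [wp_block_cons]
  refine wp_distances hmW C6 hact P6 ?_
  intro σ7 t7 F7 D7 ht7
  have C7 := C6.of_frame F7
  have P7 := P6.of_frame F7
  rw [wp_block_cons]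
  refine wp_letterColors hW hmW C7 hact P7 D7 ?_
  intro σ8 t8 F8 S8 B8 ht8
  have C8 := C7.of_frame F8
  have P8 := P7.of_frame F8
  have d8 : Stores σ8 8 d := fun x => by
    rw [F8.arr 8 rfl, F7.arr 8 rfl, F6.arr 8 rfl]
    exact S5 x
  rw [wp_block_cons]
  refine wp_doubling hW C8 hact d8 B8 S8 ?_
  intro σ9 t9 F9 B9 S9 ht9
  have C9 := C8.of_frame F9
  rw [wp_block_singleton]
  refine wp_orbitClasses (by omega) C9.reg0 C9.reg4 (P8.of_frame F9) ?_ B9 S9 ?_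
  · intro k
    rw [F9.arr 35 rfl, F8.arr 35 rfl, F7.arr 35 rfl, F6.arr 35 rfl, F5.arr 35 rfl, F4.arr 35 rfl,
      F3.arr 35 rfl, F2.arr 35 rfl, F1.arr 35 rfl, hz 35 (by decide)]
  intro σ10 t10 F10 B10 S10 ht10
  refine ⟨d, fun x => ⟨σ9.arr 7 x, B9 x⟩, fun x => ⟨σ10.arr 9 x, B10 x⟩, by omega, fun x => ?_,
    fun x => ?_, fun x => rfl, hd, fun x y => ?_, fun x y => ?_⟩
  · rw [F10.arr 7 rfl]
  · rw [F10.arr 8 rfl, F9.arr 8 rfl]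
    exact d8 x
  · rw [Fin.mk.injEq]
    exact S9 x y
  · simp only [Fin.mk.injEq, hd.cycles]
    exact S10 x y

end OrbitEquivalence

/-! ### The theorem: assembling the algorithms and their time bounds -/

theorem mainTheorem2 :
    ∃ (P Q R : Prog) (K κ : ℕ),
      ∀ (n m : ℕ) (G : ColoredGraph n) (s : Fin m → Equiv.Perm (Fin n)) (c : Equiv.Perm (Fin n)),
        IsJointPair G s → IsInvariantUniqueCycles s c →
        -- `P` computes canonical cycles `d`, the coloring `π`, and the classes of orbits `cls`
        (∀ σ : State, EncodesInput G s c σ →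
          ∃ (t : ℕ) (σ' : State) (d : Equiv.Perm (Fin n)) (π cls : Fin n → Fin n),
            Exec ((instanceSize G s + 2) ^ K) P σ t σ' ∧
            t ≤ K * (instanceSize G s + 2) * Nat.log 2 (instanceSize G s + 2) ^ κ ∧
            Stores σ' 7 π ∧ Stores σ' 8 d ∧ Stores σ' 9 cls ∧
            IsCanonicalOrder s c d ∧ IsInvariant s d ∧ IsRefinedColoring s d π ∧
            (∀ x y, OrbitEquiv (group s) (MulAction.orbit (group s) x)
                (MulAction.orbit (group s) y) ↔
              ∃ x' ∈ MulAction.orbit (group s) x, ∃ y' ∈ MulAction.orbit (group s) y,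
                π x' = π y') ∧
            (∀ x y, cls x = cls y ↔ OrbitEquiv (group s) (MulAction.orbit (group s) x)
                (MulAction.orbit (group s) y))) ∧
        -- matchings of equivalent orbits
        (∀ (d : Equiv.Perm (Fin n)) (π : Fin n → Fin n),
          IsCanonicalOrder s c d → IsRefinedColoring s d π →
          ∀ (x y : Fin n) (Δ₁ Δ₂ : Set (Fin n)),
            Δ₁ = MulAction.orbit (group s) x → Δ₂ = MulAction.orbit (group s) y →
            OrbitEquiv (group s) Δ₁ Δ₂ →
            -- from the coloring and the canonical cycles
            (∀ σ : State, EncodesOrbits Δ₁ Δ₂ σ → Stores σ 7 π → Stores σ 8 d →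
              ∃ (t : ℕ) (σ' : State), Exec ((n + 2) ^ K) Q σ t σ' ∧ t ≤ K * Δ₁.ncard ∧
                StoresMatching (group s) Δ₁ Δ₂ σ') ∧
            -- from the coloring alone, if the action on the orbit is natural symmetric
            (HasNaturalSymmetricAction (group s) Δ₁ →
              ∀ σ : State, EncodesOrbits Δ₁ Δ₂ σ → Stores σ 7 π →
                ∃ (t : ℕ) (σ' : State), Exec ((n + 2) ^ K) R σ t σ' ∧ t ≤ K * Δ₁.ncard ∧
                  StoresMatching (group s) Δ₁ Δ₂ σ')) := by
  -- One number serves as time constant and as exponent of the word bound. It has to exceed 380 for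
  -- the first algorithm and 40 for the matchings; only the inequality is used.
  obtain ⟨K, hK⟩ : ∃ K, 400 ≤ K := ⟨400, le_rfl⟩
  refine ⟨orbitEquivalence, matchAlongCycles, matchByColors, K, 1, ?_⟩
  intro n m G s c hG hc
  refine ⟨fun σ hσ => ?_, fun d π hd hπ x y Δ₁ Δ₂ h₁ h₂ heq => ?_⟩
  · have hN : n + enc s ≤ instanceSize G s := by
      unfold instanceSize
      omega
    have hW : (n + enc s + 2) * (n + enc s + 2) ≤ (instanceSize G s + 2) ^ K := by
      rw [← sq]
      exact (Nat.pow_le_pow_left (by omega) 2).trans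
        (Nat.pow_le_pow_right (by omega) (by omega))
    obtain ⟨t, σ', hex, d, π, cls, ht, h7, h8, h9, hd, hπ, hcls⟩ :=
      wp_orbitEquivalence hG.1 hc hW hσ
    have hinv := hd.isInvariant hc.invariant
    have heq := orbitEquiv_iff hd.cycles hinv hπ
    refine ⟨t, σ', d, π, cls, hex, ?_, h7, h8, h9, hd, hinv,
      (isRefinedColoring_iff hd.actsOnCycles).2 hπ, heq, fun x y => by rw [hcls, heq]⟩
    have h1 : 1 ≤ Nat.log 2 (instanceSize G s + 2) := Nat.log_pos (by norm_num) (by omega)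
    have h2 : Nat.log 2 n ≤ Nat.log 2 (instanceSize G s + 2) := Nat.log_mono_right (by omega)
    rw [zero_add] at ht
    rw [pow_one]
    refine ht.trans ?_
    -- As the logarithm of the shifted instance size is at least 1, it absorbs the linear part, and
    -- twice it bounds `Nat.log 2 n + 1`. Together this makes `300 + 40 * 2 = 380`.
    calc _ ≤ 300 * (instanceSize G s + 2) * Nat.log 2 (instanceSize G s + 2) +
        40 * (instanceSize G s + 2) * (2 * Nat.log 2 (instanceSize G s + 2)) := by
          refine Nat.add_le_add ?_ (Nat.mul_le_mul (by omega) (by omega))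
          exact (Nat.mul_le_mul_left _ (by omega)).trans (Nat.le_mul_of_pos_right _ h1)
      _ = 380 * ((instanceSize G s + 2) * Nat.log 2 (instanceSize G s + 2)) := by ring
      _ ≤ _ := by
        rw [mul_assoc]
        exact Nat.mul_le_mul_right _ (by omega)
  · have hinv := hd.isInvariant hc.invariant
    have hsim := (isRefinedColoring_iff hd.actsOnCycles).1 hπ
    obtain ⟨W, hW⟩ : ∃ W, W = (n + 2) ^ K := ⟨_, rfl⟩
    rw [← hW]
    replace hW : n + 3 ≤ W := by
      rw [hW]
      calc n + 3 ≤ (n + 2) ^ 2 := by nlinarith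
        _ ≤ _ := Nat.pow_le_pow_right (by omega) (by omega)
    have hpos : 0 < Δ₁.ncard := by
      rw [Set.ncard_pos (Set.toFinite _), h₁]
      exact ⟨x, MulAction.mem_orbit_self x⟩
    -- An orbit is nonempty, so the additive constant is bounded by a multiple of its size.
    have htime : ∀ t, t ≤ 0 + 20 * Δ₁.ncard + 20 → t ≤ K * Δ₁.ncard := fun t ht =>
      (show t ≤ 400 * Δ₁.ncard by omega).trans (Nat.mul_le_mul_right _ hK)
    refine ⟨fun σ hσ h7 h8 => ?_, fun hsym σ hσ h7 => ?_⟩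
    · obtain ⟨t, σ', h3, h4, h5⟩ := wp_matchAlongCycles (t := 0)
        (Q := fun σ' t' => StoresMatching (group s) Δ₁ Δ₂ σ' ∧ t' ≤ K * Δ₁.ncard)
        ((Nat.le_succ _).trans hW) hd.cycles hinv hsim h₁ h₂ heq hσ h7 h8 fun _ _ h h' => ⟨h, htime _ h'⟩
      exact ⟨t, σ', h3, by simpa using h5, h4⟩
    · obtain ⟨t, σ', h3, h4, h5⟩ := wp_matchByColors (t := 0)
        (Q := fun σ' t' => StoresMatching (group s) Δ₁ Δ₂ σ' ∧ t' ≤ K * Δ₁.ncard) hW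
        hd.cycles hinv hsim h₁ h₂ heq hsym hσ h7 fun _ _ h h' => ⟨h, htime _ h'⟩
      exact ⟨t, σ', h3, by simpa using h5, h4⟩
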